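/- Let $\mathcal H_A$ and $\mathcal H_B\neq\{0\}$ be separable complex Hilbert spaces (finite- or infinite-dimensional), let $\{|k\rangle\}$ be a fixed orthonormal basis of $\mathcal H_B$, and let $\mathfrak S_{\rm qc}$ be the set of quantum-classical states of $AB$, i.e. states on $\mathcal H_A\otimes\mathcal H_B$ of the form $\rho=\sum_k p_k\,\rho_k\otimes|k\rangle\langle k|$, where $\{p_k,\rho_k\}$ is an ensemble of states on $\mathcal H_A$. For such $\rho$ the conditional entropy is $S(A|B)_\rho=\sum_k p_kS(\rho_k)\in[0,+\infty]$, where $S$ is the von Neumann entropy (natural logarithm). Let $\rho_A=\sum_kp_k\rho_k$ be the marginal state, $\|\cdot\|_1$ the trace norm, $h(x)=-x\ln x-(1-x)\ln(1-x)$ the binary entropy, and let $h^{\uparrow}(x)=h(x)$ for $x\in[0,\frac12]$ and $h^{\uparrow}(x)=\ln 2$ for $x\in(\frac12,1]$. A) Let $\rho\in\mathfrak S_{\rm qc}$ with $d=\operatorname{rank}\rho_A<+\infty$. Then $S(A|B)_\rho<+\infty$ and, for all $\varepsilon\in[0,1]$ and all $\sigma\in\mathfrak S_{\rm qc}$ with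 $\frac12\|\rho-\sigma\|_1\le\varepsilon$, $$S(A|B)_\rho-S(A|B)_\sigma\le\sup_{t\in[0,\varepsilon]}\{t\ln d+h(t)\}\le\varepsilon\ln d+h^{\uparrow}(\varepsilon).$$ B) Let $H$ be a positive self-adjoint operator on $\mathcal H_A$ (not necessarily densely defined: $H$ is self-adjoint on the closure of its domain $\mathcal D(H)$) such that $\operatorname{Tr}e^{-\beta H}<+\infty$ for all $\beta>0$ and $\inf_{\|\varphi\|=1}\langle\varphi|H|\varphi\rangle=0$. For positive trace class $\omega$ let $\operatorname{Tr}H\omega=\sup_n\operatorname{Tr}P_nH\omega$ if $\operatorname{supp}\omega\subseteq\overline{\mathcal D(H)}$, where $P_n$ is the spectral projector of $H$ for $[0,n]$, and $\operatorname{Tr}H\omega=+\infty$ otherwise; and let $F_H(E)=\sup\{S(\omega):\omega\text{ a state on }\mathcal H_A,\ \operatorname{Tr}H\omega\le E\}$. Let $\rho\in\mathfrak S_{\rm qc}$ with $E=\operatorname{Tr}H\rho_A<+\infty$. Then $S(A|B)_\rho<+\infty$ and, for all $\varepsilon\in(0,1]$ and all $\sigma\in\mathfrak S_{\rm qc}$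 with $\frac12\|\rho-\sigma\|_1\le\varepsilon$, $$S(A|B)_\rho-S(A|B)_\sigma\le\varepsilon F_H\!\left(\frac{E-E_{H,\varepsilon}(\rho)}{\varepsilon}\right)+h^{\uparrow}(\varepsilon)\le\varepsilon F_H(E/\varepsilon)+h^{\uparrow}(\varepsilon),$$ where $E_{H,\varepsilon}(\rho)=\sum_k\operatorname{Tr}H[p_k\rho_k-\varepsilon I_A]_+\le E$ and $[\,\cdot\,]_+$ denotes the positive part. All upper bounds in A and B are faithful: for fixed $\rho$ (and $H$) they tend to $0$ as $\varepsilon\to0^+$. Moreover, if $H$ is as in B and $\dim\mathcal D(H)\ge2$, then for each $E>0$ and $\varepsilon\in(0,1]$ there are $\rho,\sigma\in\mathfrak S_{\rm qc}$ with $\operatorname{Tr}H\rho_A,\operatorname{Tr}H\sigma_A\le E$, $\frac12\|\rho-\sigma\|_1\le\varepsilon$ and $$S(A|B)_\rho-S(A|B)_\sigma\ge\varepsilon F_H(E/\varepsilon),$$ with strict inequality if $\varepsilon<1$. -/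

import Mathlib

open scoped ENNReal Topology TensorProduct

set_option linter.unusedSectionVars false

noncomputable section

namespace QCEntropy

/-! ### Trace, trace norm, states and von Neumann entropy -/

section Hilbert

variable {V : Type*} [NormedAddCommGroup V] [InnerProductSpace ℂ V] [CompleteSpace V]

/-- The trace `∑ᵢ ⟨bᵢ, T bᵢ⟩ ∈ [0, ∞]` of a positive bounded operator `T`, computed in an orthonormal
basis of the Hilbert space (for positive `T` the value is the same for all orthonormal bases). It is
applied to positive operators only. -/
def opTrace (T : V →L[ℂ] V) : ℝ≥0∞ :=
  ∑' i, ENNReal.ofReal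
    (inner ℂ ((exists_hilbertBasis ℂ V).choose_spec.choose i)
      (T ((exists_hilbertBasis ℂ V).choose_spec.choose i))).re

/-- The trace norm `‖T‖₁ = Tr |T|`, where `|T| = √(T⋆ T)`. -/
def traceNorm (T : V →L[ℂ] V) : ℝ≥0∞ := opTrace (CFC.abs T)

variable (V) in
/-- Quantum states: positive operators with unit trace. -/
structure State where
  /-- the density operator -/
  op : V →L[ℂ] V
  isPositive : op.IsPositive
  trace_eq_one : opTrace op = 1

/-- The von Neumann entropy `S(ρ) = Tr η(ρ) ∈ [0, ∞]`, where `η(x) = -x ln x` and `η(0) = 0`. -/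
def State.entropy (ρ : State V) : ℝ≥0∞ := opTrace (cfc Real.negMulLog ρ.op)

/-! ### Positive (unbounded) operators -/

variable (V) in
/-- A positive operator on `V`: a symmetric, positive semi-definite linear operator which is
self-adjoint as an operator on the closure of its domain. The domain need not be dense in `V`. -/
structure PositiveOperator where
  /-- the operator, defined on `op.domain` -/
  op : V →ₗ.[ℂ] V
  symmetric : op.IsFormalAdjoint op
  nonneg : ∀ x : op.domain, 0 ≤ (inner ℂ (x : V) (op x)).re
  map_mem : ∀ x : op.domain, op x ∈ op.domain.topologicalClosure
  /-- the domain of the adjoint (taken in the closure of the domain) is contained in the domain -/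
  mem_domain : ∀ y ∈ op.domain.topologicalClosure, ∀ z ∈ op.domain.topologicalClosure,
    (∀ x : op.domain, inner ℂ (op x) y = inner ℂ (x : V) z) → y ∈ op.domain

namespace PositiveOperator

variable (H : PositiveOperator V)

/-- The closure of the domain. -/
abbrev closedDomain : Submodule ℂ V := H.op.domain.topologicalClosure

instance : CompleteSpace H.closedDomain :=
  H.op.domain.isClosed_topologicalClosure.completeSpace_coe

/-- The operator `I + H` on the domain of `H`. -/
def oneAdd : H.op.domain →ₗ[ℂ] V := H.op.domain.subtype + H.op.toFun

theorem oneAdd_apply (x : H.op.domain) : H.oneAdd x = (x : V) + H.op x := rfl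

theorem norm_le_oneAdd (x : H.op.domain) : ‖(x : V)‖ ≤ ‖H.oneAdd x‖ := by
  by_cases hx : ‖(x : V)‖ = 0
  · rw [hx]; exact norm_nonneg _
  have hpos : 0 < ‖(x : V)‖ := lt_of_le_of_ne (norm_nonneg _) (Ne.symm hx)
  have h1 : ‖(x : V)‖ ^ 2 ≤ (inner ℂ (x : V) (H.oneAdd x)).re := by
    rw [oneAdd_apply, inner_add_right, Complex.add_re, inner_self_eq_norm_sq_to_K]
    have := H.nonneg x
    have h2 : (((‖(x : V)‖ : ℂ)) ^ 2).re = ‖(x : V)‖ ^ 2 := by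
      rw [← Complex.ofReal_pow, Complex.ofReal_re]
    have h3 : ((((‖(x : V)‖ : ℝ) : ℂ)) ^ 2).re = ‖(x : V)‖ ^ 2 := h2
    simp only [Complex.coe_algebraMap] at *
    linarith
  have h2 : (inner ℂ (x : V) (H.oneAdd x)).re ≤ ‖(x : V)‖ * ‖H.oneAdd x‖ :=
    (Complex.re_le_norm _).trans (norm_inner_le_norm _ _)
  nlinarith

theorem oneAdd_mem (x : H.op.domain) : H.oneAdd x ∈ H.closedDomain :=
  Submodule.add_mem _ (H.op.domain.le_topologicalClosure x.2) (H.map_mem x)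

theorem eq_of_inner_domain {u v : V} (hu : u ∈ H.closedDomain) (hv : v ∈ H.closedDomain)
    (h : ∀ w : H.op.domain, inner ℂ (w : V) u = inner ℂ (w : V) v) : u = v := by
  have h0 : u - v ∈ H.op.domainᗮ := by
    rw [Submodule.mem_orthogonal]
    intro w hw
    rw [inner_sub_right, h ⟨w, hw⟩, sub_self]
  rw [← Submodule.orthogonal_closure] at h0
  have h1 : u - v ∈ H.closedDomain := Submodule.sub_mem _ hu hv
  have h2 := (Submodule.mem_orthogonal _ _).1 h0 _ h1
  exact sub_eq_zero.1 (inner_self_eq_zero.1 h2)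

theorem isClosed_range_oneAdd : IsClosed ((H.oneAdd.range : Submodule ℂ V) : Set V) := by
  rw [← isSeqClosed_iff_isClosed]
  intro s y hs hy
  choose x hx using hs
  have hc : CauchySeq (fun n => (x n : V)) := by
    rw [Metric.cauchySeq_iff']
    intro ε hε
    obtain ⟨N, hN⟩ := (Metric.cauchySeq_iff'.1 hy.cauchySeq) ε hε
    refine ⟨N, fun n hn => lt_of_le_of_lt ?_ (hN n hn)⟩
    have := H.norm_le_oneAdd (x n - x N)
    rw [map_sub, hx, hx] at this
    rw [dist_eq_norm, dist_eq_norm]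
    exact this
  obtain ⟨a, ha⟩ := cauchySeq_tendsto_of_complete hc
  have hz : Filter.Tendsto (fun n => H.op (x n)) Filter.atTop (𝓝 (y - a)) := by
    refine (hy.sub ha).congr fun n => ?_
    rw [← hx n, oneAdd_apply]; abel
  have hcl := H.op.domain.isClosed_topologicalClosure
  have haK : a ∈ H.closedDomain :=
    hcl.mem_of_tendsto ha (Filter.Eventually.of_forall fun n =>
      H.op.domain.le_topologicalClosure (x n).2)
  have hzK : y - a ∈ H.closedDomain :=
    hcl.mem_of_tendsto hz (Filter.Eventually.of_forall fun n => H.map_mem (x n))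
  have hin : ∀ w : H.op.domain, inner ℂ (H.op w) a = inner ℂ (w : V) (y - a) := by
    intro w
    have t1 := (tendsto_const_nhds (x := H.op w)).inner (𝕜 := ℂ) ha
    have t2 := (tendsto_const_nhds (x := (w : V))).inner (𝕜 := ℂ) hz
    exact tendsto_nhds_unique t1 (t2.congr fun n => (H.symmetric w (x n)).symm)
  have had : a ∈ H.op.domain := H.mem_domain a haK (y - a) hzK hin
  refine ⟨⟨a, had⟩, ?_⟩
  have : H.op ⟨a, had⟩ = y - a := by
    refine H.eq_of_inner_domain (H.map_mem _) hzK fun w => ?_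
    rw [← hin w]; exact (H.symmetric w ⟨a, had⟩).symm
  rw [oneAdd_apply, this]; simp

theorem range_oneAdd : H.oneAdd.range = H.closedDomain := by
  apply le_antisymm
  · rintro _ ⟨x, rfl⟩
    exact H.oneAdd_mem x
  · intro y hy
    have : CompleteSpace H.oneAdd.range := H.isClosed_range_oneAdd.completeSpace_coe
    set p : V := H.oneAdd.range.starProjection y with hp
    have hpm : p ∈ H.oneAdd.range := H.oneAdd.range.starProjection_apply_mem y
    have hpK : p ∈ H.closedDomain := by
      obtain ⟨x, hx⟩ := hpm
      rw [← hx]; exact H.oneAdd_mem x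
    have hdK : y - p ∈ H.closedDomain := Submodule.sub_mem _ hy hpK
    have horth : ∀ w : H.op.domain, inner ℂ (H.oneAdd w) (y - p) = 0 := fun w =>
      (Submodule.mem_orthogonal _ _).1 (Submodule.sub_starProjection_mem_orthogonal y) _ ⟨w, rfl⟩
    have had : y - p ∈ H.op.domain := by
      refine H.mem_domain _ hdK (-(y - p)) (Submodule.neg_mem _ hdK) fun w => ?_
      have := horth w
      rw [oneAdd_apply, inner_add_left] at this
      rw [inner_neg_right]
      exact eq_neg_of_add_eq_zero_right this
    have h0 := horth ⟨y - p, had⟩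
    have h1 : (y - p) = 0 := by
      have hn := H.nonneg ⟨y - p, had⟩
      rw [oneAdd_apply, inner_add_left, inner_self_eq_norm_sq_to_K] at h0
      have h3 := congrArg Complex.re h0
      rw [show inner ℂ (H.op ⟨y - p, had⟩) (y - p) = inner ℂ (y - p) (H.op ⟨y - p, had⟩) from
        H.symmetric ⟨y - p, had⟩ ⟨y - p, had⟩, Complex.add_re] at h3
      have h2 : ((((‖y - p‖ : ℝ) : ℂ)) ^ 2).re = ‖y - p‖ ^ 2 := by
        rw [← Complex.ofReal_pow, Complex.ofReal_re]
      simp only [Complex.coe_algebraMap, Complex.zero_re] at h3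
      rw [h2] at h3
      have h4 : ‖y - p‖ ^ 2 = 0 := le_antisymm (by linarith) (sq_nonneg _)
      exact norm_eq_zero.1 (pow_eq_zero_iff (two_ne_zero)|>.1 h4)
    rw [sub_eq_zero.1 h1]; exact hpm

theorem oneAdd_injective : Function.Injective H.oneAdd := by
  rw [injective_iff_map_eq_zero]
  intro x hx
  have := H.norm_le_oneAdd x
  rw [hx, norm_zero] at this
  exact Subtype.ext (norm_le_zero_iff.1 this)

/-- The bijection `I + H` from the domain of `H` onto the closure of this domain. -/
def oneAddEquiv : H.op.domain ≃ₗ[ℂ] H.closedDomain :=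
  (LinearEquiv.ofInjective H.oneAdd H.oneAdd_injective).trans
    (LinearEquiv.ofEq _ _ H.range_oneAdd)

theorem coe_oneAddEquiv (x : H.op.domain) : (H.oneAddEquiv x : V) = (x : V) + H.op x := rfl

/-- The bounded operator equal to the resolvent `(I + H)⁻¹` on the closure of the domain of `H` and
to zero on its orthogonal complement. -/
def resolvent : V →L[ℂ] V :=
  LinearMap.mkContinuous
    (H.op.domain.subtype ∘ₗ H.oneAddEquiv.symm.toLinearMap ∘ₗ
      H.closedDomain.orthogonalProjectionOnto.toLinearMap) 1 (by
    intro v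
    have h1 := H.norm_le_oneAdd (H.oneAddEquiv.symm (H.closedDomain.orthogonalProjectionOnto v))
    have h2 : H.oneAdd (H.oneAddEquiv.symm (H.closedDomain.orthogonalProjectionOnto v)) =
        (H.closedDomain.orthogonalProjectionOnto v : V) := by
      rw [oneAdd_apply, ← coe_oneAddEquiv, LinearEquiv.apply_symm_apply]
    rw [h2] at h1
    rw [one_mul]
    exact h1.trans (H.closedDomain.norm_orthogonalProjectionOnto_apply_le v))

theorem resolvent_add (x : H.op.domain) : H.resolvent ((x : V) + H.op x) = x := by
  change ((H.oneAddEquiv.symm (H.closedDomain.orthogonalProjectionOnto _) : H.op.domain) : V) = x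
  rw [← coe_oneAddEquiv, Submodule.orthogonalProjectionOnto_mem_subspace_eq_self,
    LinearEquiv.symm_apply_apply]

theorem resolvent_of_mem_orthogonal {v : V} (hv : v ∈ H.op.domainᗮ) : H.resolvent v = 0 := by
  change ((H.oneAddEquiv.symm (H.closedDomain.orthogonalProjectionOnto v) : H.op.domain) : V) = 0
  rw [← Submodule.orthogonal_closure] at hv
  rw [Submodule.orthogonalProjectionOnto_eq_zero_iff.2 hv]
  simp

/-- The bounded operator `g(H)` for a continuous function `g` on `[0, ∞)` with limit `c` at `+∞`;
it acts as multiplication by `c` on the orthogonal complement of the domain of `H` (where `H` is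
regarded as being equal to `+∞`). It is obtained from the continuous functional calculus of the
bounded self-adjoint operator `R = (I + H)⁻¹`, since `H = R⁻¹ - I`. -/
def functionalCalculus (g : ℝ → ℝ) (c : ℝ) : V →L[ℂ] V :=
  cfc (fun r : ℝ => if r ≤ 0 then c else g (1 / r - 1)) H.resolvent

/-- The operator `e^{-βH}` (for `β > 0`), equal to zero on the complement of the domain of `H`. -/
def expNeg (β : ℝ) : V →L[ℂ] V := H.functionalCalculus (fun x => Real.exp (-(β * x))) 0

/-- The Gibbs condition: `Tr e^{-βH} < ∞` for all `β > 0`. -/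
def Gibbs : Prop := ∀ β : ℝ, 0 < β → opTrace (H.expNeg β) < ∞

/-- The infimum of `⟨φ, H φ⟩` over the unit vectors `φ` in the domain of `H` is zero. -/
def GroundEnergyZero : Prop :=
  IsGLB {t : ℝ | ∃ φ : H.op.domain, ‖(φ : V)‖ = 1 ∧ t = (inner ℂ (φ : V) (H.op φ)).re} 0

/-- The bounded truncation `min (H, n)` of `H`, equal to `n` on the complement of the domain. -/
def truncation (n : ℕ) : V →L[ℂ] V := H.functionalCalculus (fun x => min x n) n

/-- The mean energy `Tr H ρ = supₙ Tr min(H, n) ρ ∈ [0, ∞]` of a positive trace class operator `ρ`,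
where `Tr A ρ` is written as `Tr √ρ A √ρ`. It equals `supₙ Tr H Pₙ ρ`, with `Pₙ` the spectral
projector of `H` for `[0, n]`, if the support of `ρ` lies in the closure of the domain of `H`, and
`+∞` otherwise. -/
def meanEnergy (ρ : V →L[ℂ] V) : ℝ≥0∞ :=
  ⨆ n : ℕ, opTrace (CFC.sqrt ρ * H.truncation n * CFC.sqrt ρ)

/-- The function `F_H(E)`: the supremum of the entropies of the states `ρ` with `Tr H ρ ≤ E`. -/
def maxEntropy (E : ℝ≥0∞) : ℝ≥0∞ :=
  ⨆ (ρ : State V) (_ : H.meanEnergy ρ.op ≤ E), ρ.entropy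

end PositiveOperator

end Hilbert

/-! ### Bipartite systems and quantum-classical states -/

section Bipartite

variable {A B : Type*} [NormedAddCommGroup A] [InnerProductSpace ℂ A] [CompleteSpace A]
  [NormedAddCommGroup B] [InnerProductSpace ℂ B] [CompleteSpace B]

variable (A B) in
/-- The Hilbert space tensor product: the completion of the algebraic tensor product. -/
abbrev HilbertTensor : Type _ := UniformSpace.Completion (A ⊗[ℂ] B)

/-- The tensor product of two bounded operators. -/
def opTensor (S : A →L[ℂ] A) (T : B →L[ℂ] B) : HilbertTensor A B →L[ℂ] HilbertTensor A B :=
  (TensorProduct.mapL S T).completion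

variable (A) in
/-- The bounded operator `a ↦ a ⊗ b`. -/
def tensorRight (b : B) : A →L[ℂ] HilbertTensor A B :=
  UniformSpace.Completion.toComplL ∘L (TensorProduct.mkL ℂ A B).flip b

variable {κ : Type*}

/-- The partial trace over `B` of a trace class operator `T`: the operator
`∑ₖ ⟨k| T |k⟩` on `A`, where `⟨k| T |k⟩ = Vₖ⋆ T Vₖ` with `Vₖ a = a ⊗ |k⟩`. The series converges
absolutely in the operator norm for every trace class `T`. -/
def partialTrace (e : HilbertBasis κ ℂ B) (T : HilbertTensor A B →L[ℂ] HilbertTensor A B) :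
    A →L[ℂ] A :=
  ∑' k, ContinuousLinearMap.adjoint (tensorRight A (e k)) ∘L T ∘L tensorRight A (e k)

variable (A) in
/-- Quantum-classical states of the system `AB` for the fixed orthonormal basis `e = {|k⟩}` of `B`:
the states `∑ₖ pₖ ρₖ ⊗ |k⟩⟨k|`, where `{pₖ, ρₖ}` is an ensemble of states of `A`. -/
structure QCState (e : HilbertBasis κ ℂ B) extends State (HilbertTensor A B) where
  /-- the probabilities `pₖ` -/
  prob : κ → ℝ
  /-- the states `ρₖ` -/
  cond : κ → State A
  prob_nonneg : ∀ k, 0 ≤ prob k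
  hasSum_prob : HasSum prob 1
  hasSum_op : HasSum
    (fun k => prob k • opTensor (cond k).op (InnerProductSpace.rankOne ℂ (e k) (e k))) op

namespace QCState

variable {e : HilbertBasis κ ℂ B} (ρ : QCState A e)

/-- The marginal operator `ρ_A`. -/
def marginal : A →L[ℂ] A := partialTrace e ρ.op

/-- The conditional entropy `S(A|B)_ρ = ∑ₖ pₖ S(ρₖ) ∈ [0, ∞]` of a quantum-classical state. -/
def condEntropy : ℝ≥0∞ := ∑' k, ENNReal.ofReal (ρ.prob k) * (ρ.cond k).entropy

/-- The quantity `E_{H,ε}(ρ) = ∑ₖ Tr H [pₖ ρₖ - ε I]₊`. -/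
def energyAbove (H : PositiveOperator A) (ε : ℝ) : ℝ≥0∞ :=
  ∑' k, H.meanEnergy ((ρ.prob k • (ρ.cond k).op - ε • (1 : A →L[ℂ] A))⁺)

end QCState

/-- The trace distance `‖ρ - σ‖₁ / 2`. -/
def traceDist {V : Type*} [NormedAddCommGroup V] [InnerProductSpace ℂ V] [CompleteSpace V]
    (ρ σ : State V) : ℝ≥0∞ := traceNorm (ρ.op - σ.op) / 2

end Bipartite

/-- The nondecreasing envelope `x ↦ sup_{t ∈ [0, x]} f t`. -/
def upperEnvelope (f : ℝ → ℝ) (x : ℝ) : ℝ := sSup (f '' Set.Icc 0 x)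

/-- The function `h↑` on `[0, 1]`: the binary entropy on `[0, 1/2]` and `ln 2` on `(1/2, 1]`. -/
def binEntropyUp (x : ℝ) : ℝ := if x ≤ 1 / 2 then Real.binEntropy x else Real.log 2

end QCEntropy

end

set_option linter.unusedSectionVars false
set_option linter.unusedSimpArgs false

noncomputable section

open scoped ComplexOrder

namespace QCEntropy

universe u

/-! ### Traces of positive operators and compactness of trace class ones -/

section Trace

variable {V W : Type*} [NormedAddCommGroup V] [InnerProductSpace ℂ V] [CompleteSpace V]
  [NormedAddCommGroup W] [InnerProductSpace ℂ W] [CompleteSpace W] {ι ι' : Type*}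

/-! Both bounds rest on one decomposition. If ½‖ρ - σ‖₁ ≤ ε, the positive part P of ρ - σ gives ρ ≤
σ + P with Tr P ≤ ε, and taking diagonal blocks gives p_k ρ_k ≤ q_k σ_k + Q_k with ∑ Tr Q_k ≤ ε. By
Weyl's monotonicity (`ncard_eigenvalues_le`) the ordered eigenvalues of p_k ρ_k lie below those of
q_k σ_k + Q_k. So the eigenvalues of p_k ρ_k split into a part lying, in order, below those of q_k
σ_k, and a remainder t_k, where the total remainder s is at most ε (`exists_lowering`). Entropies
are written in the homogeneous form ∑ xᵢ ln (X / xᵢ), X = ∑ xᵢ. In this form the first parts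
contribute at most S(A|B)_σ (`relEnt_mono`), and undoing the splitting costs at most h(s), by the
log sum inequality over k. This is `condEntropy_le_add`: S(A|B)_ρ ≤ S(A|B)_σ + (entropy of the
remainders) + h(s).

Only a classical remainder is left to bound. With finite rank d, each t_k lives on at most d
eigenvectors, and its entropy is at most ln d times its mass. With an energy constraint, the Gibbs
condition makes e^{-H} trace class, so there is an orthonormal basis of energy eigenvectors with
levels E_j in [0, ∞] (`exists_energyBasis`). The remainders are dephased in this basis, summed over
k and padded to mass ε on a level of energy zero. None of these steps lowers the entropy or raises
the energy, whence the bound ε F_H(energy / ε) (`tsum_homEnt_le_mul_maxEntropy`). Since t_{k,i} ≤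
min (p_k r_{k,i}, ε), that energy is at most E - E_{H,ε}(ρ).

Faithfulness follows from F_H(e) ≤ βe + ∑_j e^{-βE_j}. For optimality, F_H(E/ε) is attained by a
distribution on the levels, by compactness. Its mixture with weight ε with the ground level is
compared with the pure ground state; concavity of -x ln x gives the lower bound, and strictness
comes from any weight off the ground level.

Sums are taken in [0, ∞] as far as possible, so that exchanging them needs no summability. -/

/-- The quadratic form `⟨x, T x⟩` of an operator. -/
def quad (T : V →L[ℂ] V) (x : V) : ℝ := (inner ℂ x (T x)).re

theorem quad_add (S T : V →L[ℂ] V) (x : V) : quad (S + T) x = quad S x + quad T x := by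
  simp [quad, inner_add_right]

theorem quad_sub (S T : V →L[ℂ] V) (x : V) : quad (S - T) x = quad S x - quad T x := by
  simp [quad, inner_sub_right]

theorem quad_smul (c : ℝ) (T : V →L[ℂ] V) (x : V) : quad (c • T) x = c * quad T x := by
  simp [quad, inner_smul_right_eq_smul]

theorem quad_nonneg {T : V →L[ℂ] V} (hT : T.IsPositive) (x : V) : 0 ≤ quad T x :=
  hT.re_inner_nonneg_right x

theorem quad_mono {S T : V →L[ℂ] V} (h : S ≤ T) (x : V) : quad S x ≤ quad T x := by
  have := quad_nonneg ((ContinuousLinearMap.le_def S T).1 h) x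
  rw [quad_sub] at this
  linarith

theorem quad_adjoint_comp (S : V →L[ℂ] W) (x : V) :
    quad (ContinuousLinearMap.adjoint S ∘L S) x = ‖S x‖ ^ 2 := by
  simp only [quad, ContinuousLinearMap.comp_apply, ContinuousLinearMap.adjoint_inner_right]
  rw [inner_self_eq_norm_sq_to_K]
  norm_cast

theorem quad_conj (S : V →L[ℂ] W) (T : W →L[ℂ] W) (x : V) :
    quad (ContinuousLinearMap.adjoint S ∘L T ∘L S) x = quad T (S x) := by
  simp only [quad, ContinuousLinearMap.comp_apply, ContinuousLinearMap.adjoint_inner_right]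

theorem exists_adjoint_comp_self {T : V →L[ℂ] V} (hT : T.IsPositive) :
    ∃ S : V →L[ℂ] V, ContinuousLinearMap.adjoint S ∘L S = T := by
  have h0 : 0 ≤ T := (ContinuousLinearMap.nonneg_iff_isPositive T).2 hT
  refine ⟨CFC.sqrt T, ?_⟩
  have h1 : IsSelfAdjoint (CFC.sqrt T) := IsSelfAdjoint.of_nonneg (CFC.sqrt_nonneg T)
  rw [← ContinuousLinearMap.star_eq_adjoint, h1.star_eq]
  exact CFC.sqrt_mul_sqrt_self T

theorem hasSum_normSq_inner (b : HilbertBasis ι ℂ V) (x : V) :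
    HasSum (fun i => ‖inner ℂ (b i) x‖ ^ 2) (‖x‖ ^ 2) := by
  have h := Complex.hasSum_re (b.hasSum_inner_mul_inner x x)
  rw [inner_self_eq_norm_sq_to_K] at h
  convert h using 1
  · ext i
    rw [← inner_conj_symm x (b i), ← Complex.normSq_eq_conj_mul_self, Complex.ofReal_re,
      Complex.normSq_eq_norm_sq]
  · norm_cast

theorem tsum_normSq_inner (b : HilbertBasis ι ℂ V) (x : V) :
    ∑' i, ENNReal.ofReal (‖inner ℂ (b i) x‖ ^ 2) = ENNReal.ofReal (‖x‖ ^ 2) := by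
  have h := hasSum_normSq_inner b x
  rw [← h.tsum_eq, ENNReal.ofReal_tsum_of_nonneg (fun _ => sq_nonneg _) h.summable]

/-- Parseval in both spaces and Tonelli. Basis independence of the trace is this identity used
twice. -/
theorem tsum_normSq_adjoint (b : HilbertBasis ι ℂ V) (c : HilbertBasis ι' ℂ W) (S : V →L[ℂ] W) :
    ∑' i, ENNReal.ofReal (‖S (b i)‖ ^ 2) =
      ∑' j, ENNReal.ofReal (‖ContinuousLinearMap.adjoint S (c j)‖ ^ 2) := by
  simp_rw [← tsum_normSq_inner c, ← tsum_normSq_inner b]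
  rw [ENNReal.tsum_comm]
  simp_rw [ContinuousLinearMap.adjoint_inner_right, norm_inner_symm]

theorem opTrace_eq {T : V →L[ℂ] V} (hT : T.IsPositive) (b : HilbertBasis ι ℂ V) :
    opTrace T = ∑' i, ENNReal.ofReal (quad T (b i)) := by
  obtain ⟨S, rfl⟩ := exists_adjoint_comp_self hT
  have key : ∀ {ι : Type _} (b : HilbertBasis ι ℂ V),
      ∑' i, ENNReal.ofReal (quad (ContinuousLinearMap.adjoint S ∘L S) (b i)) =
        ∑' i, ENNReal.ofReal (‖S (b i)‖ ^ 2) := by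
    intro ι b
    simp_rw [quad_adjoint_comp]
  have key' : ∑' i, ENNReal.ofReal (quad (ContinuousLinearMap.adjoint S ∘L S) (b i)) =
        ∑' i, ENNReal.ofReal (‖S (b i)‖ ^ 2) := by
    simp_rw [quad_adjoint_comp]
  rw [key', tsum_normSq_adjoint b (exists_hilbertBasis ℂ V).choose_spec.choose,
    ← tsum_normSq_adjoint (exists_hilbertBasis ℂ V).choose_spec.choose
      (exists_hilbertBasis ℂ V).choose_spec.choose, ← key]
  rfl

theorem opTrace_add {S T : V →L[ℂ] V} (hS : S.IsPositive) (hT : T.IsPositive) :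
    opTrace (S + T) = opTrace S + opTrace T := by
  obtain ⟨w, b, -⟩ := exists_hilbertBasis ℂ V
  rw [opTrace_eq hS b, opTrace_eq hT b, opTrace_eq (hS.add hT) b, ← ENNReal.tsum_add]
  simp_rw [quad_add, ENNReal.ofReal_add (quad_nonneg hS _) (quad_nonneg hT _)]

theorem IsPositive.real_smul {T : V →L[ℂ] V} (hT : T.IsPositive) {c : ℝ} (hc : 0 ≤ c) :
    (c • T).IsPositive := by
  rw [← ContinuousLinearMap.nonneg_iff_isPositive] at *
  exact smul_nonneg hc hT

theorem opTrace_smul {T : V →L[ℂ] V} (hT : T.IsPositive) {c : ℝ} (hc : 0 ≤ c) :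
    opTrace (c • T) = ENNReal.ofReal c * opTrace T := by
  obtain ⟨w, b, -⟩ := exists_hilbertBasis ℂ V
  rw [opTrace_eq hT b, opTrace_eq (IsPositive.real_smul hT hc) b, ← ENNReal.tsum_mul_left]
  simp_rw [quad_smul, ENNReal.ofReal_mul hc]

/-- The Hilbert–Schmidt norm dominates the operator norm: pass to coordinates of `S x`, move `S` to
the adjoint and use Cauchy–Schwarz in each coordinate. -/
theorem ofReal_normSq_apply_le (b : HilbertBasis ι ℂ V) (S : V →L[ℂ] W) (x : V) :
    ENNReal.ofReal (‖S x‖ ^ 2) ≤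
      (∑' i, ENNReal.ofReal (‖S (b i)‖ ^ 2)) * ENNReal.ofReal (‖x‖ ^ 2) := by
  obtain ⟨w', c, -⟩ := exists_hilbertBasis ℂ W
  rw [← tsum_normSq_inner c, tsum_normSq_adjoint b c, ← ENNReal.tsum_mul_right]
  refine ENNReal.tsum_le_tsum fun j => ?_
  rw [← ENNReal.ofReal_mul (sq_nonneg _), ← ContinuousLinearMap.adjoint_inner_left, ← mul_pow]
  refine ENNReal.ofReal_le_ofReal (pow_le_pow_left₀ (norm_nonneg _) (norm_inner_le_norm _ _) 2)

theorem isCompactOperator_rankOne (x : W) (y : V) :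
    IsCompactOperator (InnerProductSpace.rankOne ℂ x y) := by
  have h : (InnerProductSpace.rankOne ℂ x y : V → W) =
      (ContinuousLinearMap.toSpanSingleton ℂ x : ℂ → W) ∘ (innerSL ℂ y : V → ℂ) := by
    ext z; simp [InnerProductSpace.rankOne_apply]
  rw [h]
  exact (isCompactOperator_of_locallyCompactSpace_rng
    (ContinuousLinearMap.toSpanSingleton ℂ x)).comp_clm (innerSL ℂ y)

/-- A Hilbert–Schmidt operator is the norm limit of its finite rank truncations `K F`: the
difference kills `b i` for `i ∈ F`, so its norm is controlled by the tail of the series. -/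
theorem isCompactOperator_of_tsum_normSq (b : HilbertBasis ι ℂ V) (S : V →L[ℂ] W)
    (h : ∑' i, ENNReal.ofReal (‖S (b i)‖ ^ 2) ≠ ∞) : IsCompactOperator S := by
  classical
  set K : Finset ι → V →L[ℂ] W := fun F => ∑ i ∈ F, InnerProductSpace.rankOne ℂ (S (b i)) (b i)
    with hK
  have hKc : ∀ F, IsCompactOperator (K F) := fun F =>
    (compactOperator (RingHom.id ℂ) V W).sum_mem (t := F)
      (f := fun i => ((InnerProductSpace.rankOne ℂ (S (b i)) (b i) : V →L[ℂ] W)))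
      (fun i _ => isCompactOperator_rankOne _ _)
  have hKb : ∀ F i, (S - K F) (b i) = if i ∈ F then 0 else S (b i) := by
    intro F i
    simp only [hK, sub_apply, sum_apply,
      InnerProductSpace.rankOne_apply, orthonormal_iff_ite.1 b.orthonormal]
    simp only [ite_smul, one_smul, zero_smul, Finset.sum_ite_eq']
    split_ifs <;> simp
  have hlim := ENNReal.tendsto_tsum_compl_atTop_zero h
  refine isCompactOperator_of_tendsto (l := Filter.atTop) (F := K) ?_
    (Filter.Eventually.of_forall hKc)
  rw [tendsto_iff_norm_sub_tendsto_zero]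
  have hle : ∀ F, ‖K F - S‖ ≤
      Real.sqrt (∑' i : {i // i ∉ F}, ENNReal.ofReal (‖S (b i)‖ ^ 2)).toReal := by
    intro F
    rw [norm_sub_rev]
    refine ContinuousLinearMap.opNorm_le_bound _ (Real.sqrt_nonneg _) fun x => ?_
    have hfin : ∑' i : {i // i ∉ F}, ENNReal.ofReal (‖S (b i)‖ ^ 2) ≠ ∞ :=
      ne_top_of_le_ne_top h (ENNReal.tsum_comp_le_tsum_of_injective Subtype.val_injective _)
    have h1 := ofReal_normSq_apply_le b (S - K F) x
    have h2 : ∑' i, ENNReal.ofReal (‖(S - K F) (b i)‖ ^ 2) =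
        ∑' i : {i // i ∉ F}, ENNReal.ofReal (‖S (b i)‖ ^ 2) := by
      have := tsum_subtype {i | i ∉ F} (fun i => ENNReal.ofReal (‖S (b i)‖ ^ 2))
      refine Eq.trans (tsum_congr fun i => ?_) this.symm
      rw [hKb]
      by_cases hi : i ∈ F
      · rw [Set.indicator_of_notMem (by simpa using hi)]; simp [hi]
      · rw [Set.indicator_of_mem (by exact hi)]; simp [hi]
    rw [h2, ← ENNReal.ofReal_toReal hfin, ← ENNReal.ofReal_mul ENNReal.toReal_nonneg,
      ENNReal.ofReal_le_ofReal_iff (by positivity)] at h1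
    rw [← Real.sqrt_sq (norm_nonneg ((S - K F) x))]
    refine (Real.sqrt_le_sqrt h1).trans ?_
    rw [Real.sqrt_mul ENNReal.toReal_nonneg, Real.sqrt_sq (norm_nonneg _)]
  refine squeeze_zero (fun _ => norm_nonneg _) hle ?_
  have h3 := (ENNReal.continuousAt_toReal ENNReal.zero_ne_top).tendsto.comp hlim
  have h4 := (Real.continuous_sqrt.tendsto _).comp h3
  rw [ENNReal.toReal_zero, Real.sqrt_zero] at h4
  exact h4

theorem IsPositive.isCompactOperator {T : V →L[ℂ] V} (hT : T.IsPositive) (h : opTrace T ≠ ∞) :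
    IsCompactOperator T := by
  obtain ⟨w, b, -⟩ := exists_hilbertBasis ℂ V
  obtain ⟨S, rfl⟩ := exists_adjoint_comp_self hT
  rw [opTrace_eq hT b] at h
  simp_rw [quad_adjoint_comp] at h
  have h1 := (isCompactOperator_of_tsum_normSq b S h).clm_comp (ContinuousLinearMap.adjoint S)
  exact h1

end Trace

/-! ### Eigenbases and the functional calculus on eigenvectors -/

section Eigenbasis

variable {V : Type*} [NormedAddCommGroup V] [InnerProductSpace ℂ V] [CompleteSpace V]

/-- The eigenspaces of a compact symmetric operator are orthogonal and have dense span, so Hilbert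
bases of all of them, the kernel included, combine into one of the whole space. -/
theorem exists_eigenbasis_of_isCompactOperator {V : Type u} [NormedAddCommGroup V]
    [InnerProductSpace ℂ V] [CompleteSpace V] {T : V →L[ℂ] V} (hT : T.IsPositive)
    (hc : IsCompactOperator T) :
    ∃ (ι : Type u) (b : HilbertBasis ι ℂ V) (r : ι → ℝ), (∀ i, 0 ≤ r i) ∧
      ∀ i, T (b i) = (r i : ℂ) • b i := by
  have hsymm : (T : V →ₗ[ℂ] V).IsSymmetric := hT.isSymmetric
  have hbot := ContinuousLinearMap.orthogonalComplement_iSup_eigenspaces_eq_bot hc hsymm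
  have hcl : ∀ μ : ℂ, IsClosed (Module.End.eigenspace (T : Module.End ℂ V) μ : Set V) := by
    intro μ
    have : (Module.End.eigenspace (T : Module.End ℂ V) μ : Set V) =
        {x | T x = μ • x} := by
      ext x; simp
    rw [this]
    exact isClosed_eq T.continuous (continuous_const_smul μ)
  have hcs : ∀ μ : ℂ, CompleteSpace (Module.End.eigenspace (T : Module.End ℂ V) μ) :=
    fun μ => (hcl μ).completeSpace_coe
  choose w c hw using fun μ : ℂ =>
    exists_hilbertBasis ℂ (Module.End.eigenspace (T : Module.End ℂ V) μ)
  have hfam := hsymm.orthogonalFamily_eigenspaces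
  have horth : Orthonormal ℂ (fun i : Σ μ, w μ => ((c i.1 i.2 : Module.End.eigenspace
      (T : Module.End ℂ V) i.1) : V)) :=
    hfam.orthonormal_sigma_orthonormal (fun μ => (c μ).orthonormal)
  have hspan : (Submodule.span ℂ (Set.range (fun i : Σ μ, w μ => ((c i.1 i.2 :
      Module.End.eigenspace (T : Module.End ℂ V) i.1) : V))))ᗮ = ⊥ := by
    rw [eq_bot_iff, ← hbot, ← Submodule.orthogonal_closure]
    refine Submodule.orthogonal_le (iSup_le fun μ => ?_)
    intro x hx
    have h1 := (c μ).hasSum_repr ⟨x, hx⟩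
    have h2 := h1.mapL (Submodule.subtypeL _)
    refine (Submodule.isClosed_topologicalClosure _).mem_of_tendsto h2
      (Filter.Eventually.of_forall fun F => ?_)
    refine Submodule.le_topologicalClosure _ (Submodule.sum_mem _ fun i _ => ?_)
    exact Submodule.smul_mem _ _ (Submodule.subset_span ⟨⟨μ, i⟩, rfl⟩)
  have hev : ∀ i : Σ μ, w μ, T (c i.1 i.2) = i.1 • (c i.1 i.2 : V) := fun i =>
    Module.End.mem_eigenspace_iff.1 (c i.1 i.2).2
  have hreal : ∀ i : Σ μ, w μ, 0 ≤ i.1 := by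
    intro i
    have h1 := hT.inner_nonneg_right (c i.1 i.2 : V)
    rw [hev, inner_smul_right, inner_self_eq_norm_sq_to_K, horth.1 i] at h1
    simpa using h1
  refine ⟨Σ μ, w μ, HilbertBasis.mkOfOrthogonalEqBot horth hspan, fun i => i.1.re,
    fun i => (Complex.nonneg_iff.1 (hreal i)).1, fun i => ?_⟩
  rw [HilbertBasis.coe_mkOfOrthogonalEqBot, hev]
  congr 1
  exact (Complex.ext rfl (by simp [← (Complex.nonneg_iff.1 (hreal i)).2]))

theorem exists_eigenbasis {V : Type u} [NormedAddCommGroup V]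
    [InnerProductSpace ℂ V] [CompleteSpace V] {T : V →L[ℂ] V} (hT : T.IsPositive)
    (h : opTrace T ≠ ∞) :
    ∃ (ι : Type u) (b : HilbertBasis ι ℂ V) (r : ι → ℝ), (∀ i, 0 ≤ r i) ∧
      ∀ i, T (b i) = (r i : ℂ) • b i :=
  exists_eigenbasis_of_isCompactOperator hT (IsPositive.isCompactOperator hT h)

theorem mem_spectrum_of_apply_eq {T : V →L[ℂ] V} {v : V} (hv : v ≠ 0) {r : ℝ}
    (h : T v = (r : ℂ) • v) : r ∈ spectrum ℝ T := by
  intro hu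
  obtain ⟨U, hU⟩ := hu
  have h0 : (U : V →L[ℂ] V) v = 0 := by
    rw [hU, sub_apply, h, Algebra.algebraMap_eq_smul_one]
    simp
  have h1 : ((↑U⁻¹ * ↑U : V →L[ℂ] V)) v = 0 := by
    rw [mul_apply_eq_comp, h0, map_zero]
  rw [Units.inv_mul] at h1
  exact hv h1

/-- Stone–Weierstrass: the functions for which the formula holds form a closed subalgebra containing
the constants and the identity. -/
theorem cfc_apply_eigenvector {T : V →L[ℂ] V} (hT : IsSelfAdjoint T) {v : V} {r : ℝ}
    (h : T v = (r : ℂ) • v) (f : ℝ → ℝ) (hf : ContinuousOn f (spectrum ℝ T)) :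
    cfc f T v = (f r : ℂ) • v := by
  by_cases hv : v = 0
  · simp [hv]
  have hr := mem_spectrum_of_apply_eq hv h
  rw [cfc_apply f T hT hf]
  have key : ∀ g : C(spectrum ℝ T, ℝ), cfcHom hT g v = ((g ⟨r, hr⟩ : ℝ) : ℂ) • v := by
    intro g
    induction g using ContinuousMap.induction_on_of_compact with
    | const c =>
      have : (ContinuousMap.const (spectrum ℝ T) c) = algebraMap ℝ C(spectrum ℝ T, ℝ) c := rfl
      rw [this, AlgHomClass.commutes, Algebra.algebraMap_eq_smul_one]
      simp
    | id => rw [cfcHom_id hT]; simpa using h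
    | star_id => rw [star_trivial, cfcHom_id hT]; simpa using h
    | add f g hf hg => rw [map_add, add_apply, hf, hg, ← add_smul]; simp
    | mul f g hf hg =>
      rw [map_mul, mul_apply_eq_comp, hg, map_smul, hf, smul_smul]
      simp [mul_comm]
    | frequently f hf =>
      refine hf.mem_of_closed (s := {f | cfcHom hT f v = ((f ⟨r, hr⟩ : ℝ) : ℂ) • v})
        (isClosed_eq ?_ ?_)
      · exact (ContinuousLinearMap.apply ℂ V v).continuous.comp (cfcHom_continuous hT)
      · exact (Complex.continuous_ofReal.comp (continuous_eval_const _)).smul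
          continuous_const
  exact key _

variable {ι : Type*}

theorem quad_eigenvector {T : V →L[ℂ] V} {v : V} (hv : ‖v‖ = 1) {r : ℝ}
    (h : T v = (r : ℂ) • v) : quad T v = r := by
  simp [quad, h, inner_smul_right, inner_self_eq_norm_sq_to_K, hv]

theorem hasSum_quad_eigenbasis {T : V →L[ℂ] V} (hT : T.IsPositive) (b : HilbertBasis ι ℂ V)
    {r : ι → ℝ} (h : ∀ i, T (b i) = (r i : ℂ) • b i) (x : V) :
    HasSum (fun i => r i * ‖inner ℂ (b i) x‖ ^ 2) (quad T x) := by
  have h1 := Complex.hasSum_re (b.hasSum_inner_mul_inner x (T x))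
  change HasSum _ (inner ℂ x (T x)).re
  convert h1 using 1
  ext i
  have h2 : inner ℂ (b i) (T x) = (r i : ℂ) * inner ℂ (b i) x := by
    rw [← ContinuousLinearMap.adjoint_inner_left, hT.isSelfAdjoint.adjoint_eq, h,
      inner_smul_left, Complex.conj_ofReal]
  rw [h2, ← inner_conj_symm x (b i), mul_left_comm, ← Complex.normSq_eq_conj_mul_self,
    ← Complex.ofReal_mul, Complex.ofReal_re, Complex.normSq_eq_norm_sq]

theorem ofReal_quad_eigenbasis {T : V →L[ℂ] V} (hT : T.IsPositive) (b : HilbertBasis ι ℂ V)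
    {r : ι → ℝ} (hr : ∀ i, 0 ≤ r i) (h : ∀ i, T (b i) = (r i : ℂ) • b i) (x : V) :
    ENNReal.ofReal (quad T x) =
      ∑' i, ENNReal.ofReal (r i) * ENNReal.ofReal (‖inner ℂ (b i) x‖ ^ 2) := by
  have h1 := hasSum_quad_eigenbasis hT b h x
  rw [← h1.tsum_eq, ENNReal.ofReal_tsum_of_nonneg
    (fun i => mul_nonneg (hr i) (sq_nonneg _)) h1.summable]
  simp_rw [ENNReal.ofReal_mul (hr _)]

theorem opTrace_eigenbasis {T : V →L[ℂ] V} (hT : T.IsPositive) (b : HilbertBasis ι ℂ V)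
    {r : ι → ℝ} (h : ∀ i, T (b i) = (r i : ℂ) • b i) :
    opTrace T = ∑' i, ENNReal.ofReal (r i) := by
  rw [opTrace_eq hT b]
  simp_rw [quad_eigenvector (b.orthonormal.1 _) (h _)]

theorem isPositive_cfc {T : V →L[ℂ] V} {f : ℝ → ℝ} (hf : ∀ x ∈ spectrum ℝ T, 0 ≤ f x) :
    (cfc f T).IsPositive :=
  (ContinuousLinearMap.nonneg_iff_isPositive _).1 (cfc_nonneg hf)

theorem nonneg_of_mem_spectrum {T : V →L[ℂ] V} (hT : T.IsPositive) {x : ℝ}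
    (hx : x ∈ spectrum ℝ T) : 0 ≤ x :=
  spectrum_nonneg_of_nonneg ((ContinuousLinearMap.nonneg_iff_isPositive T).2 hT) hx

theorem le_one_of_mem_spectrum {T : V →L[ℂ] V} (hT : ‖T‖ ≤ 1) {x : ℝ}
    (hx : x ∈ spectrum ℝ T) : x ≤ 1 := by
  by_cases hV : Nontrivial V
  · exact (le_abs_self x).trans ((spectrum.norm_le_norm_of_mem hx).trans hT)
  -- On the zero space every operator is a unit, so the spectrum is empty.
  · rw [not_nontrivial_iff_subsingleton] at hV
    have : Subsingleton (V →L[ℂ] V) := ⟨fun a b => by ext x; exact Subsingleton.elim _ _⟩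
    exact absurd (isUnit_of_subsingleton _) hx

end Eigenbasis

/-! ### Sums of nonnegative families -/

section Sums

variable {ι ι' : Type*}

theorem tsum_ofReal_of_hasSum {y : ι → ℝ} {Y : ℝ} (h0 : ∀ i, 0 ≤ y i) (h : HasSum y Y) :
    ∑' i, ENNReal.ofReal (y i) = ENNReal.ofReal Y := by
  rw [← h.tsum_eq, ENNReal.ofReal_tsum_of_nonneg h0 h.summable]

theorem summable_of_tsum_ofReal {y : ι → ℝ} (h0 : ∀ i, 0 ≤ y i)
    (h : ∑' i, ENNReal.ofReal (y i) ≠ ∞) : Summable y := by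
  have := ENNReal.summable_toReal h
  simpa only [ENNReal.toReal_ofReal (h0 _)] using this

theorem hasSum_of_tsum_ofReal {y : ι → ℝ} {Y : ℝ} (h0 : ∀ i, 0 ≤ y i) (hY : 0 ≤ Y)
    (h : ∑' i, ENNReal.ofReal (y i) = ENNReal.ofReal Y) : HasSum y Y := by
  have hs := summable_of_tsum_ofReal h0 (by rw [h]; exact ENNReal.ofReal_ne_top)
  have h1 := tsum_ofReal_of_hasSum h0 hs.hasSum
  rw [h, ENNReal.ofReal_eq_ofReal_iff hY (tsum_nonneg h0)] at h1
  rw [h1]; exact hs.hasSum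

/-- Moves sums between a family and its decreasing rearrangement, which correspond only on their
positive entries. -/
theorem tsum_eq_of_equiv_pos {r : ι → ℝ} {a : ι' → ℝ} (hr : ∀ i, 0 ≤ r i) (ha : ∀ n, 0 ≤ a n)
    (e : {i // 0 < r i} ≃ {n // 0 < a n}) {F : ι → ℝ≥0∞} {G : ι' → ℝ≥0∞}
    (hF : ∀ i, r i = 0 → F i = 0) (hG : ∀ n, a n = 0 → G n = 0)
    (hFG : ∀ i : {i // 0 < r i}, F i = G (e i)) : ∑' i, F i = ∑' n, G n := by
  have h1 : ∑' i : {i // 0 < r i}, F i = ∑' i, F i :=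
    tsum_subtype_eq_of_support_subset (s := {i | 0 < r i}) fun i hi =>
      lt_of_le_of_ne (hr i) fun h => hi (hF i h.symm)
  have h2 : ∑' i : {i // 0 < a i}, G i = ∑' i, G i :=
    tsum_subtype_eq_of_support_subset (s := {i | 0 < a i}) fun i hi =>
      lt_of_le_of_ne (ha i) fun h => hi (hG i h.symm)
  rw [← h1, ← h2, ← e.tsum_eq]
  exact tsum_congr hFG

end Sums

/-! ### The homogeneous entropy function and its inequalities -/

section RelEnt

variable {ι : Type*}

/-- The homogeneous form `x ln (X / x)` of the function `-x ln x`. -/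
def relEnt (x X : ℝ) : ℝ := x * (Real.log X - Real.log x)

@[simp] theorem relEnt_zero_left (X : ℝ) : relEnt 0 X = 0 := by simp [relEnt]

theorem relEnt_one_right (x : ℝ) : relEnt x 1 = Real.negMulLog x := by
  simp [relEnt, Real.negMulLog]

theorem relEnt_nonneg {x X : ℝ} (hx : 0 ≤ x) (h : x ≤ X) : 0 ≤ relEnt x X := by
  rcases hx.eq_or_lt with rfl | hx
  · simp
  · exact mul_nonneg hx.le (sub_nonneg.2 (Real.log_le_log hx h))

theorem relEnt_mul {c x X : ℝ} (hx : 0 ≤ x) (h : x ≤ X) :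
    relEnt (c * x) (c * X) = c * relEnt x X := by
  rcases hx.eq_or_lt with rfl | hx
  · simp
  rcases eq_or_ne c 0 with rfl | hc
  · simp
  have hX : 0 < X := hx.trans_le h
  rw [relEnt, relEnt, Real.log_mul hc hX.ne', Real.log_mul hc hx.ne']
  ring

theorem relEnt_mul_self {p x : ℝ} (hx : 0 ≤ x) (h : x ≤ 1) :
    relEnt (p * x) p = p * Real.negMulLog x := by
  have := relEnt_mul (c := p) hx h
  rwa [mul_one, relEnt_one_right] at this

/-- The tangent plane bound for the concave homogeneous function `relEnt`. -/
theorem relEnt_le_tangent {y w Y W : ℝ} (hy : 0 ≤ y) (h : y ≤ w) (hY : 0 < Y) (hW : 0 < W) :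
    relEnt y w ≤ y * (Real.log W - Real.log Y) + (w * (Y / W) - y) := by
  rcases hy.eq_or_lt with rfl | hy
  · simp only [relEnt_zero_left, zero_mul, zero_add, sub_zero]
    positivity
  have hw : 0 < w := hy.trans_le h
  have h1 := Real.log_le_sub_one_of_pos (x := w * (Y / W) / y) (by positivity)
  rw [Real.log_div (by positivity) hy.ne', Real.log_mul hw.ne' (by positivity),
    Real.log_div hY.ne' hW.ne'] at h1
  have h2 := mul_le_mul_of_nonneg_left h1 hy.le
  have h3 : y * (w * (Y / W) / y - 1) = w * (Y / W) - y := by field_simp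
  rw [h3] at h2
  unfold relEnt
  linarith

/-- The derivative of `x ln (X / x)` along (1, 1) is `ln (X / x) - (1 - x / X) ≥ 0`, and raising `X`
further only helps. Instead of differentiating, the proof combines the tangent plane at `(y, Y)`
with `1 - 1/u ≤ ln u`. -/
theorem relEnt_mono {x X y Y : ℝ} (hx : 0 ≤ x) (hxX : x ≤ X) (hxy : x ≤ y)
    (h : y - x ≤ Y - X) : relEnt x X ≤ relEnt y Y := by
  rcases hx.eq_or_lt with rfl | hx
  · rw [relEnt_zero_left]
    exact relEnt_nonneg hxy (by linarith)
  have hy : 0 < y := hx.trans_le hxy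
  have hyY : y ≤ Y := by linarith
  have hY : 0 < Y := hy.trans_le hyY
  have h1 := relEnt_le_tangent hx.le hxX hy hY
  have h2 : 1 - y / Y ≤ Real.log Y - Real.log y := by
    have := Real.one_sub_inv_le_log_of_pos (x := Y / y) (by positivity)
    rwa [Real.log_div hY.ne' hy.ne', inv_div] at this
  have h3 : (y - x) * (1 - y / Y) ≤ (y - x) * (Real.log Y - Real.log y) :=
    mul_le_mul_of_nonneg_left h2 (by linarith)
  have h4 : X * (y / Y) ≤ (Y - (y - x)) * (y / Y) :=
    mul_le_mul_of_nonneg_right (by linarith) (by positivity)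
  have h5 : Y * (y / Y) = y := by field_simp
  unfold relEnt at *
  nlinarith

/-- The terms in `log M` and `log T` cancel on the right, so only `log m ≤ log (m + t)` and `log t ≤
log (m + t)` are needed; for `m = 0` or `t = 0` the factor in front vanishes. -/
theorem relEnt_add_le {m t M T X : ℝ} (hm : 0 ≤ m) (ht : 0 ≤ t) :
    relEnt (m + t) X ≤ relEnt m M + relEnt t T + (m * (Real.log X - Real.log M) +
      t * (Real.log X - Real.log T)) := by
  have h1 : m * Real.log m ≤ m * Real.log (m + t) := by
    rcases hm.eq_or_lt with rfl | hm
    · simp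
    · exact mul_le_mul_of_nonneg_left (Real.log_le_log hm (by linarith)) hm.le
  have h2 : t * Real.log t ≤ t * Real.log (m + t) := by
    rcases ht.eq_or_lt with rfl | ht
    · simp
    · exact mul_le_mul_of_nonneg_left (Real.log_le_log ht (by linarith)) ht.le
  unfold relEnt
  nlinarith

/-- The log sum inequality. -/
theorem tsum_relEnt_le {y w : ι → ℝ} {Y W : ℝ} (hy : ∀ i, 0 ≤ y i) (hyw : ∀ i, y i ≤ w i)
    (hY0 : 0 ≤ Y) (hY : ∑' i, ENNReal.ofReal (y i) = ENNReal.ofReal Y)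
    (hW0 : 0 ≤ W) (hW : ∑' i, ENNReal.ofReal (w i) ≤ ENNReal.ofReal W) :
    ∑' i, ENNReal.ofReal (relEnt (y i) (w i)) ≤ ENNReal.ofReal (relEnt Y W) := by
  have hsy := hasSum_of_tsum_ofReal hy hY0 hY
  rcases hY0.eq_or_lt with rfl | hYpos
  · have h0 := (hasSum_zero_iff_of_nonneg hy).1 hsy
    simp [h0]
  have hw : ∀ i, 0 ≤ w i := fun i => (hy i).trans (hyw i)
  have hsw := summable_of_tsum_ofReal hw (ne_top_of_le_ne_top ENNReal.ofReal_ne_top hW)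
  have hwW : ∑' i, w i ≤ W := by
    rw [tsum_ofReal_of_hasSum hw hsw.hasSum] at hW
    exact (ENNReal.ofReal_le_ofReal_iff hW0).1 hW
  have hYW : Y ≤ W := (hasSum_le hyw hsy hsw.hasSum).trans hwW
  have hWpos : 0 < W := hYpos.trans_le hYW
  -- The sum of the tangent planes at the totals `(Y, W)`. It exceeds `relEnt Y W` by `(∑ w) Y / W -
  -- Y`, which is nonpositive.
  have h1 := (hsy.mul_right (Real.log W - Real.log Y)).add
    ((hsw.hasSum.mul_right (Y / W)).sub hsy)
  have hle : ∀ i, relEnt (y i) (w i) ≤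
      y i * (Real.log W - Real.log Y) + (w i * (Y / W) - y i) :=
    fun i => relEnt_le_tangent (hy i) (hyw i) hYpos hWpos
  calc ∑' i, ENNReal.ofReal (relEnt (y i) (w i))
      ≤ ∑' i, ENNReal.ofReal (y i * (Real.log W - Real.log Y) + (w i * (Y / W) - y i)) :=
        ENNReal.tsum_le_tsum fun i => ENNReal.ofReal_le_ofReal (hle i)
    _ = _ := tsum_ofReal_of_hasSum
        (fun i => (relEnt_nonneg (hy i) (hyw i)).trans (hle i)) h1
    _ ≤ _ := by
        refine ENNReal.ofReal_le_ofReal ?_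
        have : (∑' i, w i) * (Y / W) ≤ W * (Y / W) :=
          mul_le_mul_of_nonneg_right hwW (by positivity)
        have h5 : W * (Y / W) = Y := by field_simp
        unfold relEnt
        linarith

/-- The entropy of a nonnegative family `x` with sum `X`, extended by homogeneity. -/
def homEnt (x : ι → ℝ) (X : ℝ) : ℝ≥0∞ := ∑' i, ENNReal.ofReal (relEnt (x i) X)

/-- The entropy of a sum is at most the two entropies plus the entropy of the choice between them.
-/
theorem homEnt_add_le {m t : ι → ℝ} {M T : ℝ} (hm : ∀ i, 0 ≤ m i) (ht : ∀ i, 0 ≤ t i)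
    (hM : HasSum m M) (hT : HasSum t T) :
    homEnt (fun i => m i + t i) (M + T) ≤ homEnt m M + homEnt t T +
      (ENNReal.ofReal (relEnt M (M + T)) + ENNReal.ofReal (relEnt T (M + T))) := by
  have hM0 : 0 ≤ M := hM.nonneg hm
  have hT0 : 0 ≤ T := hT.nonneg ht
  have hmM : ∀ i, m i ≤ M := fun i => le_hasSum hM i fun j _ => hm j
  have htT : ∀ i, t i ≤ T := fun i => le_hasSum hT i fun j _ => ht j
  -- If `M = 0`, the value `log 0 = 0` is meaningless but harmless, since every `m i` is then zero.
  have hn1 : ∀ i, 0 ≤ m i * (Real.log (M + T) - Real.log M) := fun i => by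
    rcases hM0.eq_or_lt with h | h
    · have : m i = 0 := le_antisymm (by rw [h]; exact hmM i) (hm i)
      simp [this]
    · exact mul_nonneg (hm i) (sub_nonneg.2 (Real.log_le_log h (by linarith)))
  have hn2 : ∀ i, 0 ≤ t i * (Real.log (M + T) - Real.log T) := fun i => by
    rcases hT0.eq_or_lt with h | h
    · have : t i = 0 := le_antisymm (by rw [h]; exact htT i) (ht i)
      simp [this]
    · exact mul_nonneg (ht i) (sub_nonneg.2 (Real.log_le_log h (by linarith)))
  have e1 := tsum_ofReal_of_hasSum hn1 (hM.mul_right (Real.log (M + T) - Real.log M))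
  have e2 := tsum_ofReal_of_hasSum hn2 (hT.mul_right (Real.log (M + T) - Real.log T))
  simp only [homEnt]
  unfold relEnt at e1 e2 ⊢
  rw [← e1, ← e2, ← ENNReal.tsum_add, ← ENNReal.tsum_add, ← ENNReal.tsum_add]
  refine ENNReal.tsum_le_tsum fun i => ?_
  have p1 := relEnt_nonneg (hm i) (hmM i)
  have p2 := relEnt_nonneg (ht i) (htT i)
  unfold relEnt at p1 p2
  rw [← ENNReal.ofReal_add p1 p2, ← ENNReal.ofReal_add (hn1 i) (hn2 i),
    ← ENNReal.ofReal_add (add_nonneg p1 p2) (add_nonneg (hn1 i) (hn2 i))]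
  exact ENNReal.ofReal_le_ofReal (relEnt_add_le (hm i) (ht i))

/-- The tangent plane at `(1, d)`, the direction of the uniform distribution on `d` points, bounds
each term by `t ln d + (T / d - t)`; the correction sums to at most zero over at most `d` indices.
-/
theorem homEnt_le_of_card_le {t : ι → ℝ} {T : ℝ} (ht : ∀ i, 0 ≤ t i) (hT : HasSum t T)
    {s : Finset ι} (hs : ∀ i, i ∉ s → t i = 0) {d : ℕ} (hd : s.card ≤ d) :
    homEnt t T ≤ ENNReal.ofReal (T * Real.log d) := by
  have hT0 : 0 ≤ T := hT.nonneg ht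
  have hTs : T = ∑ i ∈ s, t i := hT.unique (hasSum_sum_of_ne_finset_zero hs)
  rw [homEnt, tsum_eq_sum (s := s) fun i hi => by rw [hs i hi]; simp]
  rcases hT0.eq_or_lt with h | hTpos
  · have : ∀ i, t i = 0 := fun i =>
      le_antisymm (by rw [h]; exact le_hasSum hT i fun j _ => ht j) (ht i)
    simp [this]
  have hdpos : 0 < (d : ℝ) := by
    rcases Nat.eq_zero_or_pos d with h | h
    · have : s = ∅ := Finset.card_eq_zero.1 (by omega)
      rw [this] at hTs
      simp at hTs
      linarith
    · exact_mod_cast h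
  have hle : ∀ i ∈ s, relEnt (t i) T ≤ t i * Real.log d + (T * (1 / d) - t i) := by
    intro i _
    have := relEnt_le_tangent (ht i) (le_hasSum hT i fun j _ => ht j) (one_pos) hdpos
    simpa using this
  rw [← ENNReal.ofReal_sum_of_nonneg fun i _ =>
    relEnt_nonneg (ht i) (le_hasSum hT i fun j _ => ht j)]
  refine ENNReal.ofReal_le_ofReal ((Finset.sum_le_sum hle).trans ?_)
  rw [Finset.sum_add_distrib, Finset.sum_sub_distrib, ← Finset.sum_mul, ← hTs]
  simp only [Finset.sum_const, nsmul_eq_mul]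
  have h1 : (s.card : ℝ) * (T * (1 / d)) ≤ d * (T * (1 / d)) :=
    mul_le_mul_of_nonneg_right (by exact_mod_cast hd) (by positivity)
  have h2 : (d : ℝ) * (T * (1 / d)) = T := by field_simp
  linarith

theorem binEntropy_eq_relEnt (t : ℝ) :
    Real.binEntropy t = relEnt (1 - t) 1 + relEnt t 1 := by
  rw [Real.binEntropy_eq_negMulLog_add_negMulLog_one_sub, relEnt_one_right, relEnt_one_right,
    add_comm]

end RelEnt

/-! ### Decreasing rearrangement -/

section Rearrangement

variable {ι : Type*}

/-- The decreasing rearrangement of a nonnegative family whose superlevel sets are finite. -/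
theorem exists_rearrangement (r : ι → ℝ)
    (hfin : ∀ s : ℝ, 0 < s → {i | s < r i}.Finite) :
    ∃ a : ℕ → ℝ, (∀ n, 0 ≤ a n) ∧
      (∀ s : ℝ, 0 < s → ∀ n, s < a n ↔ n < {i | s < r i}.ncard) ∧
      ∃ e : {i // 0 < r i} ≃ {n // 0 < a n}, ∀ i, a (e i) = r i := by
  classical
  set N : ℝ → ℕ := fun s => {i | s < r i}.ncard with hN
  have hNanti : ∀ s t, 0 < s → s ≤ t → N t ≤ N s := fun s t hs hst =>
    Set.ncard_le_ncard (fun i hi => lt_of_le_of_lt hst hi) (hfin s hs)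
  -- The generalized inverse of the counting function `N`: the lowest level with at most `n` values
  -- above it.
  set a : ℕ → ℝ := fun n => sInf {s : ℝ | 0 < s ∧ N s ≤ n} with ha
  have hbdd : ∀ n, BddBelow {s : ℝ | 0 < s ∧ N s ≤ n} := fun n => ⟨0, fun s hs => hs.1.le⟩
  have hne : ∀ n, {s : ℝ | 0 < s ∧ N s ≤ n}.Nonempty := by
    intro n
    obtain ⟨B, hB⟩ := ((hfin 1 one_pos).image r).bddAbove
    refine ⟨max B 1, lt_of_lt_of_le one_pos (le_max_right _ _), ?_⟩
    have : {i | max B 1 < r i} = ∅ := by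
      ext i
      simp only [Set.mem_ofPred_eq, Set.mem_empty_iff_false, iff_false, not_lt]
      by_cases h : 1 < r i
      · exact (hB ⟨i, h, rfl⟩).trans (le_max_left _ _)
      · exact (not_lt.1 h).trans (le_max_right _ _)
    change {i | max B 1 < r i}.ncard ≤ n
    rw [this, Set.ncard_empty]
    exact Nat.zero_le n
  have ha0 : ∀ n, 0 ≤ a n := fun n => Real.sInf_nonneg fun s hs => hs.1.le
  have hiff : ∀ s : ℝ, 0 < s → ∀ n, s < a n ↔ n < N s := by
    intro s hs n
    constructor
    · intro h
      by_contra hcon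
      exact absurd (csInf_le (hbdd n) ⟨hs, not_lt.1 hcon⟩) (not_le.2 h)
    · intro h
      have hset := hfin s hs
      -- Finiteness leaves a gap: the least value `r j` above `s` bounds from below every level that
      -- has at most `n` values above it, so `s < r j ≤ a n`.
      have hnonempty : {i | s < r i}.Nonempty := by
        rw [← Set.ncard_pos hset]; exact lt_of_le_of_lt (Nat.zero_le n) h
      obtain ⟨j, hj, hmin⟩ := Set.exists_min_image _ r hset hnonempty
      refine lt_of_lt_of_le hj (le_csInf (hne n) fun u hu => ?_)
      by_contra hcon
      push Not at hcon
      have hsub : {i | s < r i} ⊆ {i | u < r i} := fun i hi => lt_of_lt_of_le hcon (hmin i hi)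
      have : N s ≤ N u := Set.ncard_le_ncard hsub (hfin u hu.1)
      have := hu.2
      omega
  have hgt : ∀ s : ℝ, 0 < s → {n | s < a n} = ↑(Finset.range (N s)) := by
    intro s hs
    ext n
    simp [hiff s hs n]
  have hge : ∀ v : ℝ, 0 < v → ∃ s, 0 < s ∧ s < v ∧ {i | v ≤ r i} = {i | s < r i} ∧
      {n | v ≤ a n} = {n | s < a n} := by
    intro v hv
    have hf1 := hfin (v / 2) (by linarith)
    have hf2 : {n | v / 2 < a n}.Finite := by
      rw [hgt _ (by linarith)]; exact Finset.finite_toSet _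
    -- Finitely many values of `r` and `a` lie in `(v/2, v)`. Taking `s` as the largest of them, or
    -- `v/2` if there is none, leaves no value strictly between `s` and `v`.
    set S : Finset ℝ := ((hf1.toFinset.image r) ∪ (hf2.toFinset.image a)).filter (· < v) with hS
    set s := (insert (v / 2) S).max' ⟨_, Finset.mem_insert_self _ _⟩ with hs
    have hs1 : v / 2 ≤ s := Finset.le_max' _ _ (Finset.mem_insert_self _ _)
    have hsv : s < v := by
      have := Finset.max'_mem (insert (v / 2) S) ⟨_, Finset.mem_insert_self _ _⟩
      rw [← hs, Finset.mem_insert] at this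
      rcases this with h | h
      · linarith
      · exact (Finset.mem_filter.1 h).2
    refine ⟨s, by linarith, hsv, ?_, ?_⟩
    · ext i
      simp only [Set.mem_ofPred_eq]
      refine ⟨fun h => hsv.trans_le h, fun h => ?_⟩
      by_contra hcon
      push Not at hcon
      refine absurd (Finset.le_max' (insert (v / 2) S) (r i) (Finset.mem_insert_of_mem ?_))
        (not_le.2 h)
      refine Finset.mem_filter.2 ⟨Finset.mem_union_left _ (Finset.mem_image_of_mem _ ?_), hcon⟩
      simpa using lt_of_le_of_lt hs1 h
    · ext i
      simp only [Set.mem_ofPred_eq]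
      refine ⟨fun h => hsv.trans_le h, fun h => ?_⟩
      by_contra hcon
      push Not at hcon
      refine absurd (Finset.le_max' (insert (v / 2) S) (a i) (Finset.mem_insert_of_mem ?_))
        (not_le.2 h)
      refine Finset.mem_filter.2 ⟨Finset.mem_union_right _ (Finset.mem_image_of_mem _ ?_), hcon⟩
      simpa using lt_of_le_of_lt hs1 h
  have hcard : ∀ s : ℝ, 0 < s → {n | s < a n}.ncard = {i | s < r i}.ncard := by
    intro s hs
    rw [hgt s hs, Set.ncard_coe_finset, Finset.card_range]
  -- A fibre is the difference of two superlevel sets, whose cardinalities agree for `r` and `a`.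
  -- Bijections between fibres then glue to one between the positive entries.
  have hfiber : ∀ v : ℝ, 0 < v → {i | r i = v}.ncard = {n | a n = v}.ncard ∧
      {i | r i = v}.Finite ∧ {n | a n = v}.Finite := by
    intro v hv
    obtain ⟨s, hs, -, h1, h2⟩ := hge v hv
    have hfr : {i | v ≤ r i}.Finite := h1 ▸ hfin s hs
    have hfa : {n | v ≤ a n}.Finite := by
      rw [h2, hgt s hs]; exact Finset.finite_toSet _
    have e1 : {i | r i = v} = {i | v ≤ r i} \ {i | v < r i} := by
      ext i; simp only [Set.mem_ofPred_eq, Set.mem_sdiff, not_lt]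
      exact ⟨fun h => ⟨h.ge, h.le⟩, fun h => le_antisymm h.2 h.1⟩
    have e2 : {i | a i = v} = {i | v ≤ a i} \ {i | v < a i} := by
      ext i; simp only [Set.mem_ofPred_eq, Set.mem_sdiff, not_lt]
      exact ⟨fun h => ⟨h.ge, h.le⟩, fun h => le_antisymm h.2 h.1⟩
    refine ⟨?_, hfr.subset (e1 ▸ Set.sdiff_subset), hfa.subset (e2 ▸ Set.sdiff_subset)⟩
    have s1 : {i | v < r i} ⊆ {i | v ≤ r i} := Set.ofPred_subset_ofPred.2 fun i hi => le_of_lt hi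
    have s2 : {i | v < a i} ⊆ {i | v ≤ a i} := Set.ofPred_subset_ofPred.2 fun i hi => le_of_lt hi
    rw [e1, e2, Set.ncard_sdiff s1 (hfin v hv), Set.ncard_sdiff s2 (hfa.subset s2), hcard v hv,
      h1, h2, hcard s hs]
  have hequiv : ∀ v : ℝ, Nonempty ({x : {i // 0 < r i} // r x = v} ≃
      {x : {n // 0 < a n} // a x = v}) := by
    intro v
    by_cases hv : 0 < v
    · obtain ⟨hc, hf1, hf2⟩ := hfiber v hv
      have := hf1.to_subtype
      have := hf2.to_subtype
      obtain ⟨e0⟩ : Nonempty ({i | r i = v} ≃ {n | a n = v}) :=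
        Finite.card_eq.1 (by rwa [Nat.card_coe_set_eq, Nat.card_coe_set_eq])
      refine ⟨?_⟩
      refine (Equiv.subtypeSubtypeEquivSubtype (p := fun i => 0 < r i) (q := fun i => r i = v)
        (fun h => h ▸ hv)).trans (Equiv.trans e0
        (Equiv.subtypeSubtypeEquivSubtype (p := fun i => 0 < a i) (q := fun i => a i = v)
        (fun h => h ▸ hv)).symm)
    · have h1 : IsEmpty {x : {i // 0 < r i} // r x = v} := ⟨fun x => hv (x.2 ▸ x.1.2)⟩
      have h2 : IsEmpty {x : {n // 0 < a n} // a x = v} := ⟨fun x => hv (x.2 ▸ x.1.2)⟩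
      exact ⟨Equiv.equivOfIsEmpty _ _⟩
  refine ⟨a, ha0, hiff, Equiv.ofFiberEquiv (f := fun x : {i // 0 < r i} => r x)
    (g := fun x : {n // 0 < a n} => a x) fun v => (hequiv v).some, fun i => ?_⟩
  exact Equiv.ofFiberEquiv_map (f := fun x : {i // 0 < r i} => r x)
    (g := fun x : {n // 0 < a n} => a x) (fun v => (hequiv v).some) i

theorem finite_superlevel_of_tsum {r : ι → ℝ} (h : ∑' i, ENNReal.ofReal (r i) ≠ ∞)
    {s : ℝ} (hs : 0 < s) : {i | s < r i}.Finite := by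
  have h1 := ENNReal.finite_const_le_of_tsum_ne_top h (ε := ENNReal.ofReal s)
    (by simpa using hs)
  exact h1.subset fun i hi => ENNReal.ofReal_le_ofReal (le_of_lt hi)

end Rearrangement

/-! ### Weyl monotonicity and lowering of eigenvalues -/

section Weyl

variable {V : Type*} [NormedAddCommGroup V] [InnerProductSpace ℂ V] [CompleteSpace V]
  {ι ι' : Type*}

/-- Weyl's monotonicity principle: if `X ≤ Y`, then `Y` has at least as many eigenvalues above any
given level as `X`. -/
theorem ncard_eigenvalues_le {X Y : V →L[ℂ] V} (hX : X.IsPositive) (hY : Y.IsPositive)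
    (hXY : X ≤ Y) (b : HilbertBasis ι ℂ V) {x : ι → ℝ}
    (hbx : ∀ i, X (b i) = (x i : ℂ) • b i) (c : HilbertBasis ι' ℂ V) {y : ι' → ℝ}
    (hcy : ∀ i, Y (c i) = (y i : ℂ) • c i) {s : ℝ}
    (hfx : {i | s < x i}.Finite) (hfy : {j | s < y j}.Finite) :
    {i | s < x i}.ncard ≤ {j | s < y j}.ncard := by
  classical
  set I := hfx.toFinset
  set J := hfy.toFinset
  rw [Set.ncard_eq_toFinset_card _ hfx, Set.ncard_eq_toFinset_card _ hfy]
  change I.card ≤ J.card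
  -- `w` builds a vector from the eigenvectors of `X` above level `s`, and `L` reads off its
  -- coefficients along those of `Y`. On the kernel of `L` the form of `Y` is at most `s ‖w z‖²`,
  -- while that of `X` is strictly larger unless `z = 0`. So `L` is injective, and dimensions can be
  -- compared.
  let w : (I → ℂ) →ₗ[ℂ] V :=
    { toFun := fun z => ∑ i : I, z i • b i
      map_add' := fun z z' => by simp [add_smul, Finset.sum_add_distrib]
      map_smul' := fun a z => by simp [Finset.smul_sum, smul_smul] }
  let L : (I → ℂ) →ₗ[ℂ] (J → ℂ) :=
    { toFun := fun z j => inner ℂ (c j) (w z)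
      map_add' := fun z z' => by ext j; simp [inner_add_right]
      map_smul' := fun a z => by ext j; simp [inner_smul_right] }
  have hinj : Function.Injective L := by
    rw [injective_iff_map_eq_zero]
    intro z hz
    have hcoef : ∀ i, inner ℂ (b i) (w z) = if h : i ∈ I then z ⟨i, h⟩ else 0 := by
      intro i
      change inner ℂ (b i) (∑ k : I, z k • b k) = _
      rw [inner_sum]
      simp_rw [inner_smul_right, orthonormal_iff_ite.1 b.orthonormal, mul_ite, mul_one, mul_zero]
      split_ifs with h
      · rw [Finset.sum_eq_single ⟨i, h⟩]
        · simp
        · intro k _ hk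
          rw [if_neg]
          rintro rfl
          exact hk rfl
        · simp
      · refine Finset.sum_eq_zero fun k _ => ?_
        rw [if_neg]
        rintro rfl
        exact h k.2
    have h1 : quad Y (w z) ≤ s * ‖w z‖ ^ 2 := by
      refine hasSum_le ?_ (hasSum_quad_eigenbasis hY c hcy (w z))
        ((hasSum_normSq_inner c (w z)).mul_left s)
      intro j
      by_cases hj : j ∈ J
      · have : inner ℂ (c j) (w z) = 0 := congrFun hz ⟨j, hj⟩
        simp [this]
      · have : y j ≤ s := by simpa [J] using hj
        exact mul_le_mul_of_nonneg_right this (sq_nonneg _)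
    have hsX := hasSum_quad_eigenbasis hX b hbx (w z)
    have hsN := (hasSum_normSq_inner b (w z)).mul_left s
    have hle : ∀ i, s * ‖inner ℂ (b i) (w z)‖ ^ 2 ≤ x i * ‖inner ℂ (b i) (w z)‖ ^ 2 := by
      intro i
      by_cases hi : i ∈ I
      · have : s < x i := by simpa [I] using hi
        exact mul_le_mul_of_nonneg_right this.le (sq_nonneg _)
      · rw [hcoef i, dif_neg hi]; simp
    by_contra hz0
    obtain ⟨i, hi⟩ : ∃ i, z i ≠ 0 := by
      by_contra hcon
      push Not at hcon
      exact hz0 (funext hcon)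
    have hlt : s * ‖w z‖ ^ 2 < quad X (w z) := by
      refine hasSum_lt (i := (i : ι)) hle ?_ hsN hsX
      rw [hcoef i, dif_pos i.2]
      have h3 : s < x i := (Set.Finite.mem_toFinset hfx).1 i.2
      exact mul_lt_mul_of_pos_right h3 (by positivity)
    have := quad_mono hXY (w z)
    linarith
  have := LinearMap.finrank_le_finrank_of_injective hinj
  simpa using this

/-- If `R ≤ S + Q` for positive trace class operators, then the eigenvalues of `R` can be lowered by
a total amount of at most `Tr Q` to become dominated by the eigenvalues of `S`. -/
theorem exists_lowering {V : Type u} [NormedAddCommGroup V] [InnerProductSpace ℂ V]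
    [CompleteSpace V] {ι ι' : Type*} {R S Q : V →L[ℂ] V} (hR : R.IsPositive)
    (hS : S.IsPositive) (hQ : Q.IsPositive) (hRSQ : R ≤ S + Q) (hRt : opTrace R ≠ ∞)
    (hSt : opTrace S ≠ ∞) (hQt : opTrace Q ≠ ∞) (b : HilbertBasis ι ℂ V) {r : ι → ℝ}
    (hr : ∀ i, 0 ≤ r i) (hbr : ∀ i, R (b i) = (r i : ℂ) • b i)
    (c : HilbertBasis ι' ℂ V) {s : ι' → ℝ}
    (hs : ∀ i, 0 ≤ s i) (hcs : ∀ i, S (c i) = (s i : ℂ) • c i) :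
    ∃ t : ι → ℝ, (∀ i, 0 ≤ t i) ∧ (∀ i, t i ≤ r i) ∧
      ∑' i, ENNReal.ofReal (t i) ≤ opTrace Q ∧
      ∀ M X, HasSum (fun i => r i - t i) M → HasSum s X →
        homEnt (fun i => r i - t i) M ≤ homEnt s X := by
  have hY : (S + Q).IsPositive := hS.add hQ
  have hYt : opTrace (S + Q) ≠ ∞ := by
    rw [opTrace_add hS hQ]; exact ENNReal.add_ne_top.2 ⟨hSt, hQt⟩
  obtain ⟨κ, d, y, hy, hdy⟩ := exists_eigenbasis hY hYt
  have hSY : S ≤ S + Q := by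
    rw [ContinuousLinearMap.le_def]; simpa using hQ
  rw [opTrace_eigenbasis hR b hbr] at hRt
  have hSt' := hSt
  have hYt' := hYt
  rw [opTrace_eigenbasis hS c hcs] at hSt'
  rw [opTrace_eigenbasis hY d hdy] at hYt'
  obtain ⟨a, ha0, haN, e, he⟩ := exists_rearrangement r
    fun s hs => finite_superlevel_of_tsum hRt hs
  obtain ⟨a', ha'0, ha'N, e', he'⟩ := exists_rearrangement s
    fun s hs => finite_superlevel_of_tsum hSt' hs
  obtain ⟨z, hz0, hzN, e'', he''⟩ := exists_rearrangement y
    fun s hs => finite_superlevel_of_tsum hYt' hs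
  -- Weyl's counting inequality at every positive level `u < a n` becomes domination of the ordered
  -- eigenvalues.
  have hle : ∀ n, a n ≤ z n := by
    intro n
    refine le_of_forall_lt_imp_le_of_dense fun u hu => ?_
    rcases le_or_gt u 0 with h | h
    · exact h.trans (hz0 n)
    · refine ((hzN u h n).2 (((haN u h n).1 hu).trans_le ?_)).le
      exact ncard_eigenvalues_le hR hY hRSQ b hbr d hdy (finite_superlevel_of_tsum hRt h)
        (finite_superlevel_of_tsum hYt' h)
  have hle' : ∀ n, a' n ≤ z n := by
    intro n
    refine le_of_forall_lt_imp_le_of_dense fun u hu => ?_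
    rcases le_or_gt u 0 with h | h
    · exact h.trans (hz0 n)
    · refine ((hzN u h n).2 (((ha'N u h n).1 hu).trans_le ?_)).le
      exact ncard_eigenvalues_le hS hY hSY c hcs d hdy (finite_superlevel_of_tsum hSt' h)
        (finite_superlevel_of_tsum hYt' h)
  have hsum' : ∑' i, ENNReal.ofReal (s i) = ∑' n, ENNReal.ofReal (a' n) :=
    tsum_eq_of_equiv_pos hs ha'0 e' (fun i h => by simp [h]) (fun i h => by simp [h])
      (fun i => by rw [he'])
  have hsumz : ∑' i, ENNReal.ofReal (y i) = ∑' n, ENNReal.ofReal (z n) :=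
    tsum_eq_of_equiv_pos hy hz0 e'' (fun i h => by simp [h]) (fun i h => by simp [h])
      (fun i => by rw [he''])
  have htrace : ∑' n, ENNReal.ofReal (z n - a' n) = opTrace Q := by
    have h1 : ∑' n, ENNReal.ofReal (z n - a' n) + ∑' n, ENNReal.ofReal (a' n) =
        opTrace Q + ∑' n, ENNReal.ofReal (a' n) := by
      rw [← ENNReal.tsum_add, ← hsum', ← opTrace_eigenbasis hS c hcs, add_comm (opTrace Q),
        ← opTrace_add hS hQ, opTrace_eigenbasis hY d hdy, hsumz]
      refine tsum_congr fun n => ?_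
      rw [← ENNReal.ofReal_add (sub_nonneg.2 (hle' n)) (ha'0 n), sub_add_cancel]
    -- Cancelling `Tr S` in `[0, ∞]` is legitimate because it is finite.
    exact (ENNReal.add_left_inj (by rw [← hsum']; exact hSt')).1 h1
  classical
  -- The excess of `R` over `S` at equal rank. What remains is `min a a'`, and the excess is at most
  -- `z - a'`, whose total is `Tr Q`.
  let t : ι → ℝ := fun i => if h : 0 < r i then max (a (e ⟨i, h⟩) - a' (e ⟨i, h⟩)) 0 else 0
  have ht_pos : ∀ i : {i // 0 < r i}, t i = max (a (e i) - a' (e i)) 0 := fun i => dif_pos i.2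
  have ht0 : ∀ i, 0 ≤ t i := by
    intro i
    by_cases h : 0 < r i
    · rw [ht_pos ⟨i, h⟩]; exact le_max_right _ _
    · simp [t, h]
  have htr : ∀ i, t i ≤ r i := by
    intro i
    by_cases h : 0 < r i
    · rw [ht_pos ⟨i, h⟩, he ⟨i, h⟩]
      exact max_le (sub_le_self _ (ha'0 _)) (hr i)
    · simp [t, h, hr i]
  refine ⟨t, ht0, htr, ?_, ?_⟩
  · have h1 : ∑' i, ENNReal.ofReal (t i) = ∑' n, ENNReal.ofReal (max (a n - a' n) 0) := by
      refine tsum_eq_of_equiv_pos hr ha0 e (fun i h => ?_) (fun n h => ?_) (fun i => ?_)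
      · simp [t, h]
      · simp [h, ha'0 n]
      · rw [ht_pos]
    rw [h1, ← htrace]
    refine ENNReal.tsum_le_tsum fun n => ENNReal.ofReal_le_ofReal (max_le ?_ ?_)
    · linarith [hle n]
    · linarith [hle' n]
  · intro M X hM hX
    have hmin : ∀ i : {i // 0 < r i}, r i - t i = min (a (e i)) (a' (e i)) := by
      intro i
      rw [ht_pos, he i]
      rcases le_total (r i) (a' (e i)) with h | h
      · rw [min_eq_left h, max_eq_right (by linarith), sub_zero]
      · rw [min_eq_right h, max_eq_left (by linarith)]; ring
    have hz : ∀ i, r i = 0 → t i = 0 := fun i h => by simp [t, h]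
    have hmin0 : ∀ n, a n = 0 → min (a n) (a' n) = 0 := fun n h => by
      rw [h, min_eq_left (ha'0 n)]
    have hnn : ∀ n, 0 ≤ min (a n) (a' n) := fun n => le_min (ha0 n) (ha'0 n)
    have hM0 : 0 ≤ M := hM.nonneg fun i => sub_nonneg.2 (htr i)
    have hX0 : 0 ≤ X := hX.nonneg hs
    have hsumM : HasSum (fun n => min (a n) (a' n)) M := by
      refine hasSum_of_tsum_ofReal hnn hM0 ?_
      rw [← tsum_ofReal_of_hasSum (fun i => sub_nonneg.2 (htr i)) hM]
      refine (tsum_eq_of_equiv_pos hr ha0 e (fun i h => ?_) (fun n h => ?_) (fun i => ?_)).symm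
      · simp [hz i h, h]
      · simp [hmin0 n h]
      · rw [hmin]
    have hsumX : HasSum a' X := by
      refine hasSum_of_tsum_ofReal ha'0 hX0 ?_
      rw [← hsum', tsum_ofReal_of_hasSum hs hX]
    have e1 : homEnt (fun i => r i - t i) M = homEnt (fun n => min (a n) (a' n)) M := by
      refine tsum_eq_of_equiv_pos hr ha0 e (fun i h => ?_) (fun n h => ?_) (fun i => ?_)
      · simp [hz i h, h]
      · simp [hmin0 n h]
      · beta_reduce; rw [hmin]
    have e2 : homEnt s X = homEnt a' X := by
      refine tsum_eq_of_equiv_pos hs ha'0 e' (fun i h => ?_) (fun n h => ?_) (fun i => ?_)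
      · simp [h]
      · simp [h]
      · rw [he']
    rw [e1, e2]
    -- Passing from `min a a'` to `a'` raises each entry by no more than it raises the total, as
    -- `relEnt_mono` requires.
    refine ENNReal.tsum_le_tsum fun n => ENNReal.ofReal_le_ofReal (relEnt_mono (hnn n) ?_ ?_ ?_)
    · exact le_hasSum hsumM n fun j _ => hnn j
    · exact min_le_right _ _
    · exact le_hasSum (hsumX.sub hsumM) n fun j _ => sub_nonneg.2 (min_le_right _ _)

end Weyl

/-! ### States in an eigenbasis and the trace distance -/

section StateEntropy

variable {V : Type*} [NormedAddCommGroup V] [InnerProductSpace ℂ V] [CompleteSpace V]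
  {ι : Type*}

theorem IsPositive.norm_le_of_opTrace_le {T : V →L[ℂ] V} (hT : T.IsPositive)
    (h : opTrace T ≤ 1) : ‖T‖ ≤ 1 := by
  obtain ⟨w, b, -⟩ := exists_hilbertBasis ℂ V
  obtain ⟨S, rfl⟩ := exists_adjoint_comp_self hT
  rw [opTrace_eq hT b] at h
  simp_rw [quad_adjoint_comp] at h
  rw [← ContinuousLinearMap.star_eq_adjoint, ← ContinuousLinearMap.mul_def,
    CStarRing.norm_star_mul_self]
  have hS : ‖S‖ ≤ 1 := by
    refine ContinuousLinearMap.opNorm_le_bound _ zero_le_one fun x => ?_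
    have h1 := (ofReal_normSq_apply_le b S x).trans (mul_le_mul_left h _)
    rw [one_mul, ENNReal.ofReal_le_ofReal_iff (sq_nonneg _)] at h1
    rw [one_mul]
    exact (pow_le_pow_iff_left₀ (norm_nonneg _) (norm_nonneg _) two_ne_zero).1 h1
  nlinarith [norm_nonneg S]

theorem State.norm_le (ρ : State V) : ‖ρ.op‖ ≤ 1 :=
  IsPositive.norm_le_of_opTrace_le ρ.isPositive ρ.trace_eq_one.le

theorem State.hasSum_eigenvalues (ρ : State V) (b : HilbertBasis ι ℂ V) {r : ι → ℝ}
    (hr : ∀ i, 0 ≤ r i) (h : ∀ i, ρ.op (b i) = (r i : ℂ) • b i) : HasSum r 1 := by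
  refine hasSum_of_tsum_ofReal hr zero_le_one ?_
  rw [← opTrace_eigenbasis ρ.isPositive b h, ρ.trace_eq_one, ENNReal.ofReal_one]

theorem State.entropy_eq (ρ : State V) (b : HilbertBasis ι ℂ V) {r : ι → ℝ}
    (h : ∀ i, ρ.op (b i) = (r i : ℂ) • b i) :
    ρ.entropy = ∑' i, ENNReal.ofReal (Real.negMulLog (r i)) := by
  refine opTrace_eigenbasis (isPositive_cfc fun x hx => ?_) b fun i =>
    cfc_apply_eigenvector ρ.isPositive.isSelfAdjoint (h i) _ Real.continuous_negMulLog.continuousOn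
  exact Real.negMulLog_nonneg (nonneg_of_mem_spectrum ρ.isPositive hx)
    (le_one_of_mem_spectrum ρ.norm_le hx)

theorem State.ofReal_mul_entropy (ρ : State V) (b : HilbertBasis ι ℂ V) {r : ι → ℝ}
    (hr : ∀ i, 0 ≤ r i) (h : ∀ i, ρ.op (b i) = (r i : ℂ) • b i) {p : ℝ} (hp : 0 ≤ p) :
    ENNReal.ofReal p * ρ.entropy = homEnt (fun i => p * r i) p := by
  have hsum := ρ.hasSum_eigenvalues b hr h
  rw [ρ.entropy_eq b h, ← ENNReal.tsum_mul_left]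
  refine tsum_congr fun i => ?_
  rw [relEnt_mul_self (hr i) (le_hasSum hsum i fun j _ => hr j), ENNReal.ofReal_mul hp]

theorem exists_sub_eq_of_isSelfAdjoint {D : V →L[ℂ] V} (hD : IsSelfAdjoint D) :
    ∃ P N : V →L[ℂ] V, P.IsPositive ∧ N.IsPositive ∧ P - N = D ∧
      traceNorm D = opTrace P + opTrace N := by
  have hp : (D⁺).IsPositive :=
    (ContinuousLinearMap.nonneg_iff_isPositive _).1 (CFC.posPart_nonneg D)
  have hn : (D⁻).IsPositive :=
    (ContinuousLinearMap.nonneg_iff_isPositive _).1 (CFC.negPart_nonneg D)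
  refine ⟨D⁺, D⁻, hp, hn, CFC.posPart_sub_negPart D hD, ?_⟩
  rw [traceNorm, ← CFC.posPart_add_negPart D hD, opTrace_add hp hn]

/-- The difference of two states is dominated by a positive operator whose trace is the trace
distance of the states. -/
theorem State.exists_le_add (ρ σ : State V) :
    ∃ P N : V →L[ℂ] V, P.IsPositive ∧ N.IsPositive ∧ ρ.op + N = σ.op + P ∧
      opTrace P = traceDist ρ σ := by
  obtain ⟨P, N, hp, hn, hPN, hD⟩ := exists_sub_eq_of_isSelfAdjoint
    (ρ.isPositive.isSelfAdjoint.sub σ.isPositive.isSelfAdjoint)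
  have hsplit : ρ.op + N = σ.op + P := by
    rw [sub_eq_sub_iff_add_eq_add] at hPN
    rw [← hPN, add_comm]
  refine ⟨P, N, hp, hn, hsplit, ?_⟩
  -- Both states have trace one, so `Tr P = Tr N`, and each is half of the trace norm.
  have h1 := congrArg opTrace hsplit
  rw [opTrace_add ρ.isPositive hn, opTrace_add σ.isPositive hp, ρ.trace_eq_one,
    σ.trace_eq_one] at h1
  rw [traceDist, hD, (ENNReal.add_right_inj ENNReal.one_ne_top).1 h1, ENNReal.add_div,
    ENNReal.add_halves]

end StateEntropy

/-! ### Product bases and diagonal blocks on the tensor product -/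

section Tensor

variable {A B : Type*} [NormedAddCommGroup A] [InnerProductSpace ℂ A] [CompleteSpace A]
  [NormedAddCommGroup B] [InnerProductSpace ℂ B] [CompleteSpace B] {κ ι : Type*}

theorem tensorRight_apply (b : B) (a : A) :
    tensorRight A b a = ((a ⊗ₜ[ℂ] b : A ⊗[ℂ] B) : HilbertTensor A B) := rfl

theorem inner_tensorRight (b b' : B) (a a' : A) :
    inner ℂ (tensorRight A b a) (tensorRight A b' a') = inner ℂ a a' * inner ℂ b b' := by
  rw [tensorRight_apply, tensorRight_apply, UniformSpace.Completion.inner_coe,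
    TensorProduct.inner_tmul]

theorem adjoint_tensorRight_apply (b b' : B) (a : A) :
    ContinuousLinearMap.adjoint (tensorRight A b) (tensorRight A b' a) = inner ℂ b b' • a := by
  refine ext_inner_left ℂ fun x => ?_
  rw [ContinuousLinearMap.adjoint_inner_right, inner_tensorRight, inner_smul_right, mul_comm]

theorem eq_zero_of_inner_basis {V : Type*} [NormedAddCommGroup V] [InnerProductSpace ℂ V]
    [CompleteSpace V] (b : HilbertBasis ι ℂ V) {x : V} (h : ∀ i, inner ℂ (b i) x = 0) :
    x = 0 := by
  have h1 : HasSum (fun _ : ι => (0 : ℝ)) (‖x‖ ^ 2) := by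
    simpa [h] using hasSum_normSq_inner b x
  have h2 := h1.unique hasSum_zero
  exact norm_eq_zero.1 (pow_eq_zero_iff two_ne_zero |>.1 h2)

theorem eq_of_tensor {W : Type*} [NormedAddCommGroup W] [NormedSpace ℂ W]
    {S T : HilbertTensor A B →L[ℂ] W}
    (h : ∀ a b, S (tensorRight A b a) = T (tensorRight A b a)) : S = T := by
  refine ContinuousLinearMap.ext fun x => ?_
  induction x using UniformSpace.Completion.induction_on with
  | hp => exact isClosed_eq S.continuous T.continuous
  | ih x =>
    induction x using TensorProduct.induction_on with
    | zero => rw [UniformSpace.Completion.coe_zero, map_zero, map_zero]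
    | tmul a b => exact h a b
    | add x y hx hy => rw [UniformSpace.Completion.coe_add, map_add, map_add, hx, hy]

theorem eq_zero_of_inner_tensor {x : HilbertTensor A B}
    (h : ∀ a b, inner ℂ (tensorRight A b a) x = 0) : x = 0 := by
  have h1 : innerSL ℂ x = 0 := eq_of_tensor fun a b => by
    rw [innerSL_apply_apply, ← inner_conj_symm, h]; simp
  have h2 : innerSL ℂ x x = 0 := by rw [h1]; rfl
  rw [innerSL_apply_apply] at h2
  exact inner_self_eq_zero.1 h2

theorem orthonormal_tensor (c : HilbertBasis ι ℂ A) (e : HilbertBasis κ ℂ B) :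
    Orthonormal ℂ (fun p : κ × ι => tensorRight A (e p.1) (c p.2)) := by
  classical
  rw [orthonormal_iff_ite]
  rintro ⟨k, i⟩ ⟨l, j⟩
  rw [inner_tensorRight, orthonormal_iff_ite.1 c.orthonormal, orthonormal_iff_ite.1 e.orthonormal]
  simp only [Prod.mk.injEq]
  split_ifs <;> simp_all

theorem span_tensor_orthogonal (c : HilbertBasis ι ℂ A) (e : HilbertBasis κ ℂ B) :
    (Submodule.span ℂ (Set.range (fun p : κ × ι => tensorRight A (e p.1) (c p.2))))ᗮ = ⊥ := by
  rw [Submodule.eq_bot_iff]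
  intro x hx
  have h0 : ∀ k i, inner ℂ (tensorRight A (e k) (c i)) x = 0 := fun k i =>
    (Submodule.mem_orthogonal _ _).1 hx _ (Submodule.subset_span ⟨(k, i), rfl⟩)
  -- One tensor factor at a time: the basis of `A` is exhausted first, then that of `B` through the
  -- adjoint of `b ↦ a ⊗ b`.
  have h1 : ∀ k, ContinuousLinearMap.adjoint (tensorRight A (e k)) x = 0 := fun k =>
    eq_zero_of_inner_basis c fun i => by
      rw [ContinuousLinearMap.adjoint_inner_right]; exact h0 k i
  refine eq_zero_of_inner_tensor fun a b => ?_
  set U : B →L[ℂ] HilbertTensor A B :=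
    UniformSpace.Completion.toComplL ∘L (TensorProduct.mkL ℂ A B) a with hU
  have h2 : ContinuousLinearMap.adjoint U x = 0 := eq_zero_of_inner_basis e fun k => by
    rw [ContinuousLinearMap.adjoint_inner_right]
    change inner ℂ (tensorRight A (e k) a) x = 0
    rw [← ContinuousLinearMap.adjoint_inner_right, h1, inner_zero_right]
  change inner ℂ (U b) x = 0
  rw [← ContinuousLinearMap.adjoint_inner_right, h2, inner_zero_right]

/-- The product orthonormal basis `{cᵢ ⊗ eₖ}`. -/
def tensorBasis (c : HilbertBasis ι ℂ A) (e : HilbertBasis κ ℂ B) :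
    HilbertBasis (κ × ι) ℂ (HilbertTensor A B) :=
  HilbertBasis.mkOfOrthogonalEqBot (orthonormal_tensor c e) (span_tensor_orthogonal c e)

theorem tensorBasis_apply (c : HilbertBasis ι ℂ A) (e : HilbertBasis κ ℂ B) (p : κ × ι) :
    tensorBasis c e p = tensorRight A (e p.1) (c p.2) := by
  rw [tensorBasis, HilbertBasis.coe_mkOfOrthogonalEqBot]

/-- The diagonal block `⟨b| T |b⟩` of an operator on the tensor product. -/
def block (b : B) (T : HilbertTensor A B →L[ℂ] HilbertTensor A B) : A →L[ℂ] A :=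
  ContinuousLinearMap.adjoint (tensorRight A b) ∘L T ∘L tensorRight A b

theorem isPositive_block (b : B) {T : HilbertTensor A B →L[ℂ] HilbertTensor A B}
    (hT : T.IsPositive) : (block b T).IsPositive :=
  hT.adjoint_conj _

theorem block_add (b : B) (S T : HilbertTensor A B →L[ℂ] HilbertTensor A B) :
    block b (S + T) = block b S + block b T := by
  ext x; simp [block]

theorem opTrace_eq_tsum_block (e : HilbertBasis κ ℂ B)
    {T : HilbertTensor A B →L[ℂ] HilbertTensor A B} (hT : T.IsPositive) :
    opTrace T = ∑' k, opTrace (block (e k) T) := by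
  obtain ⟨w, c, -⟩ := exists_hilbertBasis ℂ A
  rw [opTrace_eq hT (tensorBasis c e), ENNReal.tsum_prod']
  refine tsum_congr fun k => ?_
  rw [opTrace_eq (isPositive_block _ hT) c]
  refine tsum_congr fun i => ?_
  rw [tensorBasis_apply, block, quad_conj]

/-- The factorization `V τ V⋆` with `V a = a ⊗ b` makes positivity and the blocks of `τ ⊗ |b⟩⟨b|`
immediate. -/
theorem opTensor_rankOne (τ : A →L[ℂ] A) (b : B) :
    opTensor τ (InnerProductSpace.rankOne ℂ b b) =
      tensorRight A b ∘L τ ∘L ContinuousLinearMap.adjoint (tensorRight A b) := by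
  refine eq_of_tensor fun a b' => ?_
  simp only [ContinuousLinearMap.comp_apply]
  rw [adjoint_tensorRight_apply, map_smul, map_smul, opTensor, tensorRight_apply,
    ContinuousLinearMap.completion_apply_coe, TensorProduct.mapL_tmul,
    InnerProductSpace.rankOne_apply, TensorProduct.tmul_smul, UniformSpace.Completion.coe_smul,
    ← tensorRight_apply]

theorem isPositive_opTensor_rankOne {τ : A →L[ℂ] A} (hτ : τ.IsPositive) (b : B) :
    (opTensor τ (InnerProductSpace.rankOne ℂ b b)).IsPositive := by
  rw [opTensor_rankOne]
  exact hτ.conj_adjoint (tensorRight A b)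

theorem block_opTensor_rankOne [DecidableEq κ] (e : HilbertBasis κ ℂ B) (τ : A →L[ℂ] A)
    (k l : κ) : block (e k) (opTensor τ (InnerProductSpace.rankOne ℂ (e l) (e l))) =
      if l = k then τ else 0 := by
  ext a
  rw [opTensor_rankOne, block]
  simp only [ContinuousLinearMap.comp_apply]
  rw [adjoint_tensorRight_apply, adjoint_tensorRight_apply, map_smul,
    orthonormal_iff_ite.1 e.orthonormal, orthonormal_iff_ite.1 e.orthonormal]
  by_cases h : l = k
  · simp [h]
  · simp [h]

theorem opTrace_opTensor_rankOne (e : HilbertBasis κ ℂ B) {τ : A →L[ℂ] A} (hτ : τ.IsPositive)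
    (k : κ) : opTrace (opTensor τ (InnerProductSpace.rankOne ℂ (e k) (e k))) = opTrace τ := by
  classical
  rw [opTrace_eq_tsum_block e (isPositive_opTensor_rankOne hτ _), tsum_eq_single k]
  · rw [block_opTensor_rankOne, if_pos rfl]
  · intro l hl
    rw [block_opTensor_rankOne, if_neg hl.symm]
    obtain ⟨w, c, -⟩ := exists_hilbertBasis ℂ A
    rw [opTrace_eq (ContinuousLinearMap.isPositive_zero) c]
    simp [quad]

end Tensor

/-! ### Blocks of quantum-classical states and the main entropy estimate -/

namespace QCState

variable {A B : Type*} [NormedAddCommGroup A] [InnerProductSpace ℂ A] [CompleteSpace A]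
  [NormedAddCommGroup B] [InnerProductSpace ℂ B] [CompleteSpace B] {κ : Type*}
  {e : HilbertBasis κ ℂ B} (ρ : QCState A e)

/-- Taking a block is continuous and additive, so it acts termwise on the defining series, where one
term survives. -/
theorem block_op (k : κ) : block (e k) ρ.op = ρ.prob k • (ρ.cond k).op := by
  classical
  have hcont : Continuous fun T : HilbertTensor A B →L[ℂ] HilbertTensor A B => block (e k) T := by
    unfold block
    fun_prop
  let Φ : (HilbertTensor A B →L[ℂ] HilbertTensor A B) →+ (A →L[ℂ] A) :=
    { toFun := block (e k)
      map_zero' := by ext x; simp [block]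
      map_add' := block_add (e k) }
  have hterm : (Φ ∘ fun l => ρ.prob l • opTensor (ρ.cond l).op
      (InnerProductSpace.rankOne ℂ (e l) (e l))) =
      fun l => if l = k then ρ.prob k • (ρ.cond k).op else 0 := by
    ext1 l
    have : ∀ T : HilbertTensor A B →L[ℂ] HilbertTensor A B,
        block (e k) (ρ.prob l • T) = ρ.prob l • block (e k) T := fun T => by
      ext x; simp [block]
    refine (this _).trans ?_
    rw [block_opTensor_rankOne]
    split_ifs with h
    · rw [h]
    · rw [smul_zero]
  have h1 := ρ.hasSum_op.map Φ hcont
  rw [hterm] at h1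
  exact h1.unique (hasSum_ite_eq k _)

theorem isPositive_smul_cond (k : κ) : (ρ.prob k • (ρ.cond k).op).IsPositive :=
  IsPositive.real_smul (ρ.cond k).isPositive (ρ.prob_nonneg k)

theorem opTrace_smul_cond (k : κ) :
    opTrace (ρ.prob k • (ρ.cond k).op) = ENNReal.ofReal (ρ.prob k) := by
  rw [opTrace_smul (ρ.cond k).isPositive (ρ.prob_nonneg k), (ρ.cond k).trace_eq_one, mul_one]

/-- The partial trace is a `tsum`, meaningful only if its series converges; here it does so
absolutely, the norms being bounded by the probabilities. -/
theorem hasSum_marginal : HasSum (fun k => ρ.prob k • (ρ.cond k).op) ρ.marginal := by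
  have h : ρ.marginal = ∑' k, ρ.prob k • (ρ.cond k).op := tsum_congr fun k => ρ.block_op k
  rw [h]
  refine (Summable.of_norm_bounded (g := ρ.prob) ρ.hasSum_prob.summable fun k => ?_).hasSum
  rw [norm_smul, Real.norm_of_nonneg (ρ.prob_nonneg k)]
  exact mul_le_of_le_one_right (ρ.prob_nonneg k) (ρ.cond k).norm_le

theorem hasSum_quad_marginal (x : A) :
    HasSum (fun k => quad (ρ.prob k • (ρ.cond k).op) x) (quad ρ.marginal x) := by
  let Φ : (A →L[ℂ] A) →+ ℝ :=
    { toFun := fun T => quad T x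
      map_zero' := by simp [quad]
      map_add' := fun S T => quad_add S T x }
  have hc : Continuous Φ := by
    change Continuous fun T => quad T x
    unfold quad
    fun_prop
  exact ρ.hasSum_marginal.map Φ hc

theorem isPositive_marginal : ρ.marginal.IsPositive := by
  rw [ContinuousLinearMap.isPositive_def']
  refine ⟨?_, fun x => ?_⟩
  · have h1 := ρ.hasSum_marginal.star
    refine h1.unique ?_
    convert ρ.hasSum_marginal using 2 with k
    exact (ρ.isPositive_smul_cond k).isSelfAdjoint.star_eq
  · have h := (ρ.hasSum_quad_marginal x).nonneg fun k => quad_nonneg (ρ.isPositive_smul_cond k) x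
    rw [ContinuousLinearMap.reApplyInnerSelf_apply, inner_re_symm]
    exact h

theorem ofReal_quad_marginal (x : A) :
    ENNReal.ofReal (quad ρ.marginal x) =
      ∑' k, ENNReal.ofReal (quad (ρ.prob k • (ρ.cond k).op) x) :=
  (tsum_ofReal_of_hasSum (fun k => quad_nonneg (ρ.isPositive_smul_cond k) x)
    (ρ.hasSum_quad_marginal x)).symm

theorem exists_block_le (ρ σ : QCState A e) :
    ∃ Q : κ → A →L[ℂ] A, (∀ k, (Q k).IsPositive) ∧
      (∀ k, ρ.prob k • (ρ.cond k).op ≤ σ.prob k • (σ.cond k).op + Q k) ∧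
      ∑' k, opTrace (Q k) = traceDist ρ.toState σ.toState := by
  obtain ⟨P, N, hp, hn, hsplit, hP⟩ := ρ.toState.exists_le_add σ.toState
  refine ⟨fun k => block (e k) P, fun k => isPositive_block _ hp, fun k => ?_, ?_⟩
  · rw [← ρ.block_op, ← σ.block_op, ← block_add, ← hsplit, block_add, ContinuousLinearMap.le_def]
    simpa using isPositive_block (e k) hn
  · rw [← opTrace_eq_tsum_block e hp, hP]

/-- The semicontinuity estimate for the conditional entropy in terms of a classical remainder. -/
theorem condEntropy_le_add {A : Type u} [NormedAddCommGroup A] [InnerProductSpace ℂ A]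
    [CompleteSpace A] (ρ σ : QCState A e) {ε : ℝ} (hε0 : 0 ≤ ε) (hε1 : ε ≤ 1)
    (hε : traceDist ρ.toState σ.toState ≤ ENNReal.ofReal ε)
    {ι : κ → Type*} (b : ∀ k, HilbertBasis (ι k) ℂ A) {r : ∀ k, ι k → ℝ}
    (hr : ∀ k i, 0 ≤ r k i) (hb : ∀ k i, (ρ.cond k).op (b k i) = (r k i : ℂ) • b k i) :
    ∃ (t : ∀ k, ι k → ℝ) (T : κ → ℝ) (s : ℝ), (∀ k i, 0 ≤ t k i) ∧
      (∀ k i, t k i ≤ ρ.prob k * r k i) ∧ (∀ k, HasSum (t k) (T k)) ∧ HasSum T s ∧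
      0 ≤ s ∧ s ≤ ε ∧
      ρ.condEntropy ≤ σ.condEntropy + ∑' k, homEnt (t k) (T k) +
        ENNReal.ofReal (Real.binEntropy s) := by
  obtain ⟨Q, hQ, hle, hQs⟩ := exists_block_le ρ σ
  have hQt : ∀ k, opTrace (Q k) ≠ ∞ := fun k => by
    refine ne_top_of_le_ne_top ENNReal.ofReal_ne_top (le_trans ?_ hε)
    rw [← hQs]; exact ENNReal.le_tsum k
  choose ι' c q hq hc using fun k => exists_eigenbasis (σ.cond k).isPositive
    (by rw [(σ.cond k).trace_eq_one]; exact ENNReal.one_ne_top)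
  -- The lowering is done inside each block, on the eigenvalues of the unnormalized operators, so
  -- the removed masses add up over `k` to at most the trace distance.
  have key := fun k => exists_lowering (ρ.isPositive_smul_cond k) (σ.isPositive_smul_cond k)
    (hQ k) (hle k) (by rw [opTrace_smul_cond]; exact ENNReal.ofReal_ne_top)
    (by rw [opTrace_smul_cond]; exact ENNReal.ofReal_ne_top) (hQt k) (b k)
    (r := fun i => ρ.prob k * r k i) (fun i => mul_nonneg (ρ.prob_nonneg k) (hr k i))
    (fun i => by rw [smul_apply, hb, ← Complex.coe_smul, smul_smul]; simp)
    (c k) (s := fun i => σ.prob k * q k i) (fun i => mul_nonneg (σ.prob_nonneg k) (hq k i))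
    (fun i => by rw [smul_apply, hc, ← Complex.coe_smul, smul_smul]; simp)
  choose t ht0 htr htQ hent using key
  have hsR : ∀ k, HasSum (fun i => ρ.prob k * r k i) (ρ.prob k) := fun k => by
    simpa using ((ρ.cond k).hasSum_eigenvalues (b k) (hr k) (hb k)).mul_left (ρ.prob k)
  have hsS : ∀ k, HasSum (fun i => σ.prob k * q k i) (σ.prob k) := fun k => by
    simpa using ((σ.cond k).hasSum_eigenvalues (c k) (hq k) (hc k)).mul_left (σ.prob k)
  have hst : ∀ k, Summable (t k) := fun k =>
    Summable.of_nonneg_of_le (ht0 k) (htr k) (hsR k).summable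
  set T : κ → ℝ := fun k => ∑' i, t k i with hT
  have hT0 : ∀ k, 0 ≤ T k := fun k => tsum_nonneg (ht0 k)
  have hTsum : ∑' k, ENNReal.ofReal (T k) ≤ ENNReal.ofReal ε := by
    refine le_trans ?_ hε
    rw [← hQs]
    refine ENNReal.tsum_le_tsum fun k => ?_
    rw [← tsum_ofReal_of_hasSum (ht0 k) (hst k).hasSum]
    exact htQ k
  have hTS := summable_of_tsum_ofReal hT0 (ne_top_of_le_ne_top ENNReal.ofReal_ne_top hTsum)
  have hs0 : 0 ≤ ∑' k, T k := tsum_nonneg hT0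
  have hsε : ∑' k, T k ≤ ε := by
    rw [tsum_ofReal_of_hasSum hT0 hTS.hasSum] at hTsum
    exact (ENNReal.ofReal_le_ofReal_iff hε0).1 hTsum
  refine ⟨t, T, ∑' k, T k, ht0, htr, fun k => (hst k).hasSum, hTS.hasSum, hs0, hsε, ?_⟩
  set s := ∑' k, T k with hs
  set M : κ → ℝ := fun k => ρ.prob k - T k with hM
  have hMsum : ∀ k, HasSum (fun i => ρ.prob k * r k i - t k i) (M k) := fun k =>
    (hsR k).sub (hst k).hasSum
  have hM0 : ∀ k, 0 ≤ M k := fun k => (hMsum k).nonneg fun i => sub_nonneg.2 (htr k i)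
  have hMs : HasSum M (1 - s) := ρ.hasSum_prob.sub hTS.hasSum
  have hρ : ρ.condEntropy = ∑' k, homEnt (fun i => ρ.prob k * r k i) (ρ.prob k) :=
    tsum_congr fun k => (ρ.cond k).ofReal_mul_entropy (b k) (hr k) (hb k) (ρ.prob_nonneg k)
  have hσ : σ.condEntropy = ∑' k, homEnt (fun i => σ.prob k * q k i) (σ.prob k) :=
    tsum_congr fun k => (σ.cond k).ofReal_mul_entropy (c k) (hq k) (hc k) (σ.prob_nonneg k)
  have hk : ∀ k, homEnt (fun i => ρ.prob k * r k i) (ρ.prob k) ≤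
      homEnt (fun i => σ.prob k * q k i) (σ.prob k) + homEnt (t k) (T k) +
      (ENNReal.ofReal (relEnt (M k) (ρ.prob k)) + ENNReal.ofReal (relEnt (T k) (ρ.prob k))) := by
    intro k
    have h1 := homEnt_add_le (fun i => sub_nonneg.2 (htr k i)) (ht0 k) (hMsum k) (hst k).hasSum
    simp only [sub_add_cancel] at h1
    have h2 : M k + ∑' i, t k i = ρ.prob k := by simp [hM, hT]
    rw [h2] at h1
    refine h1.trans ?_
    gcongr
    exact hent k _ _ (hMsum k) (hsS k)
  have hp1 : ∑' k, ENNReal.ofReal (ρ.prob k) ≤ ENNReal.ofReal 1 :=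
    (tsum_ofReal_of_hasSum ρ.prob_nonneg ρ.hasSum_prob).le
  -- The log sum inequality against the weights `p_k` merges the splitting costs of all blocks;
  -- together with `e2` this is the single term `h(s)`.
  have e1 : ∑' k, ENNReal.ofReal (relEnt (M k) (ρ.prob k)) ≤ ENNReal.ofReal (relEnt (1 - s) 1) :=
    tsum_relEnt_le hM0 (fun k => sub_le_self _ (hT0 k)) (by linarith)
      (tsum_ofReal_of_hasSum hM0 hMs) zero_le_one hp1
  have e2 : ∑' k, ENNReal.ofReal (relEnt (T k) (ρ.prob k)) ≤ ENNReal.ofReal (relEnt s 1) :=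
    tsum_relEnt_le hT0 (fun k => sub_nonneg.1 (hM0 k)) hs0
      (tsum_ofReal_of_hasSum hT0 hTS.hasSum) zero_le_one hp1
  rw [hρ, hσ, binEntropy_eq_relEnt, ENNReal.ofReal_add
    (relEnt_nonneg (by linarith) (by linarith)) (relEnt_nonneg hs0 (by linarith))]
  refine (ENNReal.tsum_le_tsum hk).trans ?_
  rw [ENNReal.tsum_add, ENNReal.tsum_add, ENNReal.tsum_add]
  gcongr

end QCState

/-! ### The resolvent and functions of the unbounded operator -/

section Resolvent

variable {V : Type*} [NormedAddCommGroup V] [InnerProductSpace ℂ V] [CompleteSpace V]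
  (H : PositiveOperator V)

namespace PositiveOperator

/-- Without a dense domain, `v` equals `x + H x` only after projection to the closed domain, so the
identity is tested against vectors from there. -/
theorem exists_resolvent_eq (v : V) : ∃ x : H.op.domain, H.resolvent v = x ∧
    ∀ u ∈ H.closedDomain, inner ℂ u v = inner ℂ u ((x : V) + H.op x) := by
  refine ⟨H.oneAddEquiv.symm (H.closedDomain.orthogonalProjectionOnto v), rfl, fun u hu => ?_⟩
  rw [← coe_oneAddEquiv, LinearEquiv.apply_symm_apply]
  exact (H.closedDomain.inner_orthogonalProjectionOnto_eq_of_mem_left ⟨u, hu⟩ v).symm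

theorem isPositive_resolvent : H.resolvent.IsPositive := by
  rw [ContinuousLinearMap.isPositive_def]
  refine ⟨fun u v => ?_, fun v => ?_⟩
  · obtain ⟨x, hx, hx'⟩ := H.exists_resolvent_eq u
    obtain ⟨y, hy, hy'⟩ := H.exists_resolvent_eq v
    change inner ℂ (H.resolvent u) v = inner ℂ u (H.resolvent v)
    rw [hx, hy, hy' _ (H.op.domain.le_topologicalClosure x.2), ← inner_conj_symm u,
      hx' _ (H.op.domain.le_topologicalClosure y.2), inner_conj_symm, inner_add_left,
      inner_add_right]
    congr 1
    exact (H.symmetric x y).symm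
  · obtain ⟨x, hx, hx'⟩ := H.exists_resolvent_eq v
    rw [ContinuousLinearMap.reApplyInnerSelf_apply, hx,
      hx' _ (H.op.domain.le_topologicalClosure x.2), inner_add_right, map_add]
    exact add_nonneg inner_self_nonneg (H.nonneg x)

theorem norm_resolvent_le : ‖H.resolvent‖ ≤ 1 :=
  LinearMap.mkContinuous_norm_le _ zero_le_one _

end PositiveOperator

/-- As `r → 0⁺` the energy `1/r - 1` tends to infinity, so the limit `c` of `g` is the value that
makes the function continuous at 0. -/
theorem continuous_ite_comp_inv {g : ℝ → ℝ} {c : ℝ} (hg : Continuous g)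
    (hc : Filter.Tendsto g Filter.atTop (𝓝 c)) :
    Continuous fun r : ℝ => if r ≤ 0 then c else g (1 / r - 1) := by
  rw [continuous_iff_continuousAt]
  intro r
  rcases lt_trichotomy r 0 with h | rfl | h
  · refine (continuousAt_const (y := c)).congr ?_
    filter_upwards [Iio_mem_nhds h] with x hx
    rw [if_pos (le_of_lt hx)]
  · rw [ContinuousAt, if_pos le_rfl, ← nhdsLE_sup_nhdsGT, Filter.tendsto_sup]
    constructor
    · refine tendsto_const_nhds.congr' ?_
      filter_upwards [self_mem_nhdsWithin] with x hx
      rw [if_pos (show x ≤ 0 from hx)]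
    · have h1 : Filter.Tendsto (fun r : ℝ => 1 / r - 1) (𝓝[>] 0) Filter.atTop := by
        simp_rw [one_div, sub_eq_add_neg]
        exact Filter.tendsto_atTop_add_const_right _ _ tendsto_inv_nhdsGT_zero
      refine (hc.comp h1).congr' ?_
      filter_upwards [self_mem_nhdsWithin] with x hx
      rw [if_neg (not_le.2 hx)]; rfl
  · have h1 : ContinuousAt (fun r : ℝ => g (1 / r - 1)) r := by
      refine hg.continuousAt.comp ?_
      exact (continuousAt_const.div continuousAt_id h.ne').sub continuousAt_const
    refine h1.congr ?_
    filter_upwards [Ioi_mem_nhds h] with x hx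
    rw [if_neg (not_le.2 hx)]

theorem continuousOn_ite_inv_one_sub_log :
    ContinuousOn (fun y : ℝ => if y ≤ 0 then 0 else (1 - Real.log y)⁻¹) (Set.Icc 0 1) := by
  intro y hy
  rcases hy.1.eq_or_lt with rfl | hpos
  · have h0 : Set.Icc (0 : ℝ) 1 = insert 0 (Set.Ioc 0 1) := by
      ext x
      simp only [Set.mem_Icc, Set.mem_insert_iff, Set.mem_Ioc]
      constructor
      · rintro ⟨h1, h2⟩
        rcases h1.eq_or_lt with h | h
        · exact Or.inl h.symm
        · exact Or.inr ⟨h, h2⟩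
      · rintro (rfl | ⟨h1, h2⟩)
        · exact ⟨le_rfl, zero_le_one⟩
        · exact ⟨h1.le, h2⟩
    rw [h0, continuousWithinAt_insert_self, ContinuousWithinAt, if_pos le_rfl]
    have h1 : Filter.Tendsto (fun y : ℝ => (1 - Real.log y)⁻¹) (𝓝[>] 0) (𝓝 0) := by
      refine Filter.Tendsto.inv_tendsto_atTop ?_
      simp_rw [sub_eq_add_neg]
      exact Filter.tendsto_atTop_add_const_left _ _
        (Filter.tendsto_neg_atBot_atTop.comp Real.tendsto_log_nhdsGT_zero)
    refine (h1.mono_left (nhdsWithin_mono _ Set.Ioc_subset_Ioi_self)).congr' ?_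
    filter_upwards [self_mem_nhdsWithin] with x hx
    rw [if_neg (not_le.2 hx.1)]
  · refine ContinuousAt.continuousWithinAt ?_
    have h1 : ContinuousAt (fun y : ℝ => (1 - Real.log y)⁻¹) y := by
      refine ContinuousAt.inv₀ (continuousAt_const.sub (Real.continuousAt_log hpos.ne')) ?_
      have := Real.log_nonpos hpos.le hy.2
      linarith
    refine h1.congr ?_
    filter_upwards [Ioi_mem_nhds hpos] with x hx
    rw [if_neg (not_le.2 hx)]

namespace PositiveOperator

theorem continuous_expNeg_aux {β : ℝ} (hβ : 0 < β) :
    Continuous fun r : ℝ => if r ≤ 0 then 0 else Real.exp (-(β * (1 / r - 1))) := by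
  refine continuous_ite_comp_inv (g := fun x => Real.exp (-(β * x))) (by fun_prop) ?_
  exact Real.tendsto_exp_neg_atTop_nhds_zero.comp
    (Filter.tendsto_id.const_mul_atTop hβ)

theorem continuous_truncation_aux (n : ℕ) :
    Continuous fun r : ℝ => if r ≤ 0 then (n : ℝ) else min (1 / r - 1) n := by
  refine continuous_ite_comp_inv (g := fun x => min x n) (by fun_prop) ?_
  refine tendsto_const_nhds.congr' ?_
  filter_upwards [Filter.eventually_ge_atTop (n : ℝ)] with x hx
  rw [min_eq_right hx]

theorem expNeg_eq (β : ℝ) : H.expNeg β =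
    cfc (fun r : ℝ => if r ≤ 0 then 0 else Real.exp (-(β * (1 / r - 1)))) H.resolvent := rfl

theorem truncation_eq (n : ℕ) : H.truncation n =
    cfc (fun r : ℝ => if r ≤ 0 then (n : ℝ) else min (1 / r - 1) n) H.resolvent := rfl

theorem isPositive_expNeg (β : ℝ) : (H.expNeg β).IsPositive := by
  rw [expNeg_eq]
  refine isPositive_cfc fun x _ => ?_
  split_ifs
  · exact le_rfl
  · exact (Real.exp_pos _).le

theorem isPositive_truncation (n : ℕ) : (H.truncation n).IsPositive := by
  rw [truncation_eq]
  refine isPositive_cfc fun x hx => ?_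
  split_ifs with h
  · exact n.cast_nonneg
  · refine le_min ?_ n.cast_nonneg
    have h1 := le_one_of_mem_spectrum H.norm_resolvent_le hx
    rw [sub_nonneg, le_div_iff₀ (not_le.1 h)]
    linarith

/-- If `y = e^{-(1/r - 1)}` then `r = (1 - ln y)⁻¹`. The Gibbs condition gives an eigenbasis of
`e^{-H}`; through this inversion it also diagonalizes the resolvent, hence all functions of `H`. -/
theorem cfc_expNeg_one :
    cfc (fun y : ℝ => if y ≤ 0 then 0 else (1 - Real.log y)⁻¹) (H.expNeg 1) = H.resolvent := by
  have hsa := H.isPositive_resolvent.isSelfAdjoint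
  have hc := (continuous_expNeg_aux one_pos).continuousOn (s := spectrum ℝ H.resolvent)
  rw [expNeg_eq, ← cfc_comp' _ _ _ (continuousOn_ite_inv_one_sub_log.mono ?_) hc hsa]
  · conv_rhs => rw [← cfc_id' ℝ H.resolvent hsa]
    refine cfc_congr fun r hr => ?_
    have h0 := nonneg_of_mem_spectrum H.isPositive_resolvent hr
    rcases h0.eq_or_lt with rfl | h
    · simp
    · have h2 : ¬ r ≤ 0 := not_le.2 h
      have h3 : ¬ Real.exp (-(1 * (1 / r - 1))) ≤ 0 := not_le.2 (Real.exp_pos _)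
      simp only [if_neg h2, if_neg h3, Real.log_exp]
      field_simp
      ring
  · rintro _ ⟨r, hr, rfl⟩
    have h1 := le_one_of_mem_spectrum H.norm_resolvent_le hr
    beta_reduce
    split_ifs with h
    · exact ⟨le_rfl, zero_le_one⟩
    · refine ⟨(Real.exp_pos _).le, Real.exp_le_one_iff.2 ?_⟩
      have : 1 ≤ 1 / r := by rw [le_div_iff₀ (not_le.1 h)]; linarith
      linarith

end PositiveOperator

end Resolvent

/-! ### The energy eigenbasis -/

section EnergyBasis

/-- Monotone convergence for the truncations `min (H, n)` in the definition of the mean energy;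
infinite levels are allowed. -/
theorem tsum_iSup_min_mul {J : Type*} (E q : J → ℝ≥0∞) :
    ⨆ n : ℕ, ∑' j, min (E j) n * q j = ∑' j, E j * q j := by
  have hE : ∀ j, ⨆ n : ℕ, min (E j) n * q j = E j * q j := fun j => by
    rw [← ENNReal.iSup_mul]
    congr 1
    refine le_antisymm (iSup_le fun n => min_le_left _ _) ?_
    have h1 : ⨆ n : ℕ, ((n : ℕ) : ℝ≥0∞) = ∞ := ENNReal.iSup_natCast
    rw [← inf_iSup_eq, h1, inf_top_eq]
  refine le_antisymm (iSup_le fun n => ENNReal.tsum_le_tsum fun j =>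
    mul_le_mul_left (min_le_left _ _) _) ?_
  rw [ENNReal.tsum_eq_iSup_sum]
  refine iSup_le fun F => ?_
  simp_rw [← hE]
  rw [ENNReal.finsetSum_iSup_of_monotone]
  · exact iSup_mono fun n => ENNReal.sum_le_tsum F
  · intro j m n hmn
    exact mul_le_mul_left (min_le_min le_rfl (by exact_mod_cast hmn)) _

/-- The Boltzmann weight `e^{-βE}` of an energy `E ∈ [0, ∞]`. -/
def boltzmann (β : ℝ) (E : ℝ≥0∞) : ℝ≥0∞ :=
  if E = ∞ then 0 else ENNReal.ofReal (Real.exp (-(β * E.toReal)))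

variable {V : Type u} [NormedAddCommGroup V] [InnerProductSpace ℂ V] [CompleteSpace V]

theorem opTrace_sqrt_mul_mul_sqrt {J : Type*} {ω M : V →L[ℂ] V} (hω : ω.IsPositive)
    (hM : M.IsPositive) (φ : HilbertBasis J ℂ V) {m : J → ℝ} (hm : ∀ j, 0 ≤ m j)
    (h : ∀ j, M (φ j) = (m j : ℂ) • φ j) :
    opTrace (CFC.sqrt ω * M * CFC.sqrt ω) =
      ∑' j, ENNReal.ofReal (m j) * ENNReal.ofReal (quad ω (φ j)) := by
  obtain ⟨w, b, -⟩ := exists_hilbertBasis ℂ V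
  have h0 : 0 ≤ ω := (ContinuousLinearMap.nonneg_iff_isPositive ω).2 hω
  have hsa : ContinuousLinearMap.adjoint (CFC.sqrt ω) = CFC.sqrt ω :=
    (IsSelfAdjoint.of_nonneg (CFC.sqrt_nonneg ω)).adjoint_eq
  have hconj : CFC.sqrt ω * M * CFC.sqrt ω =
      ContinuousLinearMap.adjoint (CFC.sqrt ω) ∘L M ∘L CFC.sqrt ω := by
    rw [hsa]; rfl
  have hsq : ω = ContinuousLinearMap.adjoint (CFC.sqrt ω) ∘L CFC.sqrt ω := by
    rw [hsa]; exact (CFC.sqrt_mul_sqrt_self ω).symm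
  have hpos : (CFC.sqrt ω * M * CFC.sqrt ω).IsPositive := by
    rw [hconj]; exact hM.adjoint_conj _
  rw [opTrace_eq hpos b, hconj]
  simp_rw [quad_conj, ofReal_quad_eigenbasis hM φ hm h]
  rw [ENNReal.tsum_comm]
  refine tsum_congr fun j => ?_
  rw [ENNReal.tsum_mul_left]
  congr 1
  conv_rhs => rw [hsq]
  rw [quad_adjoint_comp, ← tsum_normSq_inner b]
  refine tsum_congr fun i => ?_
  rw [← ContinuousLinearMap.adjoint_inner_left, hsa, norm_inner_symm]

namespace PositiveOperator

variable (H : PositiveOperator V)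

/-- An operator satisfying the Gibbs condition has an orthonormal basis of eigenvectors, with
energies in `[0, ∞]` (the value `∞` being taken on the complement of the domain). -/
theorem exists_energyBasis (hG : H.Gibbs) :
    ∃ (J : Type u) (φ : HilbertBasis J ℂ V) (E : J → ℝ≥0∞),
      (∀ ω : V →L[ℂ] V, ω.IsPositive →
        H.meanEnergy ω = ∑' j, E j * ENNReal.ofReal (quad ω (φ j))) ∧
      (∀ β : ℝ, 0 < β → ∑' j, boltzmann β (E j) ≠ ∞) ∧
      (H.GroundEnergyZero → ∃ j, E j = 0) ∧
      (1 < Module.rank ℂ H.op.domain → ∃ i j, i ≠ j ∧ E i ≠ ∞ ∧ E j ≠ ∞) := by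
  have hR := H.isPositive_resolvent
  obtain ⟨J, φ, g, hg, hφ⟩ := exists_eigenbasis (H.isPositive_expNeg 1) (hG 1 one_pos).ne
  have hspec : spectrum ℝ (H.expNeg 1) ⊆ Set.Icc 0 1 := by
    rw [expNeg_eq, cfc_map_spectrum _ _ hR.isSelfAdjoint (continuous_expNeg_aux one_pos).continuousOn]
    rintro _ ⟨r, hr, rfl⟩
    have h1 := le_one_of_mem_spectrum H.norm_resolvent_le hr
    beta_reduce
    split_ifs with h
    · exact ⟨le_rfl, zero_le_one⟩
    · refine ⟨(Real.exp_pos _).le, Real.exp_le_one_iff.2 ?_⟩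
      have : 1 ≤ 1 / r := by rw [le_div_iff₀ (not_le.1 h)]; linarith
      linarith
  set r : J → ℝ := fun j => if g j ≤ 0 then 0 else (1 - Real.log (g j))⁻¹ with hr
  have hRφ : ∀ j, H.resolvent (φ j) = (r j : ℂ) • φ j := fun j => by
    rw [← H.cfc_expNeg_one]
    exact cfc_apply_eigenvector (H.isPositive_expNeg 1).isSelfAdjoint (hφ j) _
      (continuousOn_ite_inv_one_sub_log.mono hspec)
  have hφ0 : ∀ j, φ j ≠ 0 := fun j h => by
    have := φ.orthonormal.1 j
    rw [h] at this; simp at this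
  have hr0 : ∀ j, 0 ≤ r j := fun j =>
    nonneg_of_mem_spectrum hR (mem_spectrum_of_apply_eq (hφ0 j) (hRφ j))
  have hr1 : ∀ j, r j ≤ 1 := fun j =>
    le_one_of_mem_spectrum H.norm_resolvent_le (mem_spectrum_of_apply_eq (hφ0 j) (hRφ j))
  -- From `H = R⁻¹ - 1`; the kernel of the resolvent is the complement of the domain, where the
  -- energy is infinite.
  set E : J → ℝ≥0∞ := fun j => if r j ≤ 0 then ∞ else ENNReal.ofReal (1 / r j - 1) with hE
  have hEtop : ∀ j, E j = ∞ ↔ r j ≤ 0 := fun j => by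
    simp only [hE]; split_ifs with h <;> simp [h]
  have hnn : ∀ j, ¬ r j ≤ 0 → 0 ≤ 1 / r j - 1 := fun j h => by
    rw [sub_nonneg, le_div_iff₀ (not_le.1 h)]; linarith [hr1 j]
  have hboltz : ∀ β, 0 < β → ∑' j, boltzmann β (E j) ≠ ∞ := by
    intro β hβ
    have h1 := (hG β hβ).ne
    rw [opTrace_eigenbasis (H.isPositive_expNeg β) φ fun j =>
      cfc_apply_eigenvector hR.isSelfAdjoint (hRφ j) _ (continuous_expNeg_aux hβ).continuousOn] at h1
    convert h1 using 4 with j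
    simp only [boltzmann, hEtop]
    by_cases h : r j ≤ 0
    · simp [h]
    · simp only [hE, if_neg h, ENNReal.toReal_ofReal (hnn j h)]
  have hinner : ∀ j y, inner ℂ (φ j) (H.resolvent y) = (r j : ℂ) * inner ℂ (φ j) y := fun j y => by
    rw [← ContinuousLinearMap.adjoint_inner_left, hR.isSelfAdjoint.adjoint_eq, hRφ,
      inner_smul_left, Complex.conj_ofReal]
  refine ⟨J, φ, E, ?_, hboltz, ?_, ?_⟩
  · intro ω hω
    rw [← tsum_iSup_min_mul]
    refine iSup_congr fun n => ?_
    rw [opTrace_sqrt_mul_mul_sqrt hω (H.isPositive_truncation n) φ (fun j => ?_) fun j =>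
      cfc_apply_eigenvector hR.isSelfAdjoint (hRφ j) _ (continuous_truncation_aux n).continuousOn]
    · refine tsum_congr fun j => ?_
      congr 1
      by_cases h : r j ≤ 0
      · simp [hE, h]
      · simp only [hE, if_neg h]
        rw [ENNReal.ofReal_min, ENNReal.ofReal_natCast]
    · split_ifs with h
      · exact n.cast_nonneg
      · exact le_min (hnn j h) n.cast_nonneg
  · intro h0
    by_contra hcon
    push Not at hcon
    have hlt : ∀ j, r j < 1 := fun j => lt_of_le_of_ne (hr1 j) fun h => hcon j (by simp [hE, h])
    -- Without a zero level every `r j` is below 1. Since only finitely many exceed 1/2, they are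
    -- bounded by some `c < 1`, which would force a positive ground energy.
    have hfin : {j | 1 / 2 < r j}.Finite := by
      have h1 := ENNReal.finite_const_le_of_tsum_ne_top (hboltz 1 one_pos)
        (ε := ENNReal.ofReal (Real.exp (-1))) (by simpa using Real.exp_pos _)
      refine h1.subset fun j hj => ?_
      have hj' : 1 / 2 < r j := hj
      have h2 : ¬ r j ≤ 0 := by linarith
      change _ ≤ boltzmann 1 (E j)
      rw [boltzmann, if_neg (by rwa [hEtop])]
      refine ENNReal.ofReal_le_ofReal (Real.exp_le_exp.2 ?_)
      simp only [hE, if_neg h2, ENNReal.toReal_ofReal (hnn j h2)]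
      have : 1 / r j ≤ 2 := by rw [div_le_iff₀ (by linarith)]; linarith
      linarith
    obtain ⟨c, hc0, hc1, hc⟩ : ∃ c : ℝ, 0 < c ∧ c < 1 ∧ ∀ j, r j ≤ c := by
      refine ⟨(insert (1 / 2) (hfin.toFinset.image r)).max' ⟨_, Finset.mem_insert_self _ _⟩,
        ?_, ?_, fun j => ?_⟩
      · exact lt_of_lt_of_le (by norm_num) (Finset.le_max' _ (1 / 2) (Finset.mem_insert_self _ _))
      · refine (Finset.max'_lt_iff _ _).2 fun y hy => ?_
        rcases Finset.mem_insert.1 hy with rfl | hy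
        · norm_num
        · obtain ⟨j, -, rfl⟩ := Finset.mem_image.1 hy
          exact hlt j
      · by_cases hj : 1 / 2 < r j
        · refine Finset.le_max' _ _ (Finset.mem_insert_of_mem (Finset.mem_image_of_mem _ ?_))
          simpa using hj
        · exact (not_lt.1 hj).trans (Finset.le_max' _ _ (Finset.mem_insert_self _ _))
    have hlb : 1 / c - 1 ∈ lowerBounds
        {t : ℝ | ∃ φ : H.op.domain, ‖(φ : V)‖ = 1 ∧ t = (inner ℂ (φ : V) (H.op φ)).re} := by
      rintro _ ⟨x, hx, rfl⟩
      set y : V := (x : V) + H.op x with hy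
      have hRy : H.resolvent y = x := H.resolvent_add x
      have h1 : quad H.resolvent y = 1 + (inner ℂ (x : V) (H.op x)).re := by
        have hsym : inner ℂ (H.op x) (x : V) = inner ℂ (x : V) (H.op x) := H.symmetric x x
        rw [quad, hRy, hy, inner_add_left, hsym, Complex.add_re, inner_self_eq_norm_sq_to_K, hx]
        simp
      -- This is `R² ≤ cR` at `y = x + H x`, where `R y = x`; it reads `1 ≤ c (1 + ⟨x, H x⟩)`.
      have h2 : ‖(x : V)‖ ^ 2 ≤ c * quad H.resolvent y := by
        refine hasSum_le (fun j => ?_) (hasSum_normSq_inner φ (x : V))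
          ((hasSum_quad_eigenbasis hR φ hRφ y).mul_left c)
        rw [← hRy, hinner, norm_mul, mul_pow, Complex.norm_real, Real.norm_of_nonneg (hr0 j)]
        have := mul_le_mul_of_nonneg_right (mul_le_mul_of_nonneg_right (hc j) (hr0 j))
          (sq_nonneg ‖inner ℂ (φ j) y‖)
        nlinarith
      rw [hx, h1] at h2
      rw [sub_le_iff_le_add, div_le_iff₀ hc0]
      nlinarith
    have := h0.2 hlb
    have h3 : 1 < 1 / c := by rw [lt_div_iff₀ hc0]; linarith
    linarith
  · intro hrank
    by_contra hcon
    push Not at hcon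
    have hcon' : ∀ i j, i ≠ j → 0 < r i → r j ≤ 0 := fun i j hij hi =>
      (hEtop j).1 (hcon i j hij (by rw [Ne, hEtop]; exact not_le.2 hi))
    -- The domain is the range of the resolvent on such vectors, hence orthogonal to every level of
    -- infinite energy. With at most one finite level it lies in a line.
    have hzero : ∀ (x : H.op.domain) j, r j ≤ 0 → inner ℂ (φ j) (x : V) = 0 := fun x j hj => by
      rw [← H.resolvent_add x, hinner, le_antisymm hj (hr0 j)]; simp
    refine absurd hrank (not_lt.2 ?_)
    rw [rank_submodule_le_one_iff']
    by_cases hex : ∃ i, 0 < r i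
    · obtain ⟨i, hi⟩ := hex
      refine ⟨φ i, fun x hx => ?_⟩
      rw [Submodule.mem_span_singleton]
      refine ⟨inner ℂ (φ i) x, ?_⟩
      rw [← sub_eq_zero]
      refine eq_zero_of_inner_basis φ fun j => ?_
      classical
      rw [inner_sub_right, inner_smul_right, orthonormal_iff_ite.1 φ.orthonormal]
      by_cases hij : j = i
      · simp [hij]
      · rw [if_neg hij, hzero ⟨x, hx⟩ j (hcon' i j (Ne.symm hij) hi)]; simp
    · push Not at hex
      refine ⟨0, fun x hx => ?_⟩
      have : x = 0 := eq_zero_of_inner_basis φ fun j => hzero ⟨x, hx⟩ j (hex j)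
      simp [this]

end PositiveOperator

end EnergyBasis

/-! ### Dephasing in a basis and diagonal states -/

section Peierls

variable {V : Type u} [NormedAddCommGroup V] [InnerProductSpace ℂ V] [CompleteSpace V]
  {J κ : Type*} {ι : κ → Type*} (φ : HilbertBasis J ℂ V)

/-- The diagonal, in the basis `φ`, of the sum over `k` of the operators with the eigenvalues `t k i`
and the eigenvectors `b k i`. -/
def diagonalSum (b : ∀ k, HilbertBasis (ι k) ℂ V) (t : ∀ k, ι k → ℝ) (j : J) : ℝ≥0∞ :=
  ∑' k, ∑' i, ENNReal.ofReal (t k i) * ENNReal.ofReal (‖inner ℂ (b k i) (φ j)‖ ^ 2)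

variable {φ} {b : ∀ k, HilbertBasis (ι k) ℂ V} {t : ∀ k, ι k → ℝ} {T : κ → ℝ} {s : ℝ}

theorem tsum_normSq_inner_basis {ι : Type*} (b : HilbertBasis ι ℂ V) (j : J) :
    ∑' i, ENNReal.ofReal (‖inner ℂ (b i) (φ j)‖ ^ 2) = 1 := by
  rw [tsum_normSq_inner, φ.orthonormal.1]; simp

theorem tsum_diagonalSum (ht : ∀ k i, 0 ≤ t k i) (hT : ∀ k, HasSum (t k) (T k))
    (hs : HasSum T s) : ∑' j, diagonalSum φ b t j = ENNReal.ofReal s := by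
  have hT0 : ∀ k, 0 ≤ T k := fun k => (hT k).nonneg (ht k)
  simp only [diagonalSum]
  rw [ENNReal.tsum_comm, ← tsum_ofReal_of_hasSum hT0 hs]
  refine tsum_congr fun k => ?_
  rw [ENNReal.tsum_comm, ← tsum_ofReal_of_hasSum (ht k) (hT k)]
  refine tsum_congr fun i => ?_
  rw [ENNReal.tsum_mul_left]
  simp_rw [norm_inner_symm (b k i)]
  rw [tsum_normSq_inner_basis φ (φ := b k) i, mul_one]

/-- The entropy does not decrease under dephasing and mixing. -/
theorem tsum_homEnt_le (ht : ∀ k i, 0 ≤ t k i) (hT : ∀ k, HasSum (t k) (T k))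
    (hs : HasSum T s) : ∑' k, homEnt (t k) (T k) ≤
      ∑' j, ENNReal.ofReal (relEnt (diagonalSum φ b t j).toReal s) := by
  have hT0 : ∀ k, 0 ≤ T k := fun k => (hT k).nonneg (ht k)
  have hs0 : 0 ≤ s := hs.nonneg hT0
  have htT : ∀ k i, t k i ≤ T k := fun k i => le_hasSum (hT k) i fun j _ => ht k j
  have hfin : ∀ j, diagonalSum φ b t j ≠ ∞ := fun j =>
    ne_top_of_le_ne_top ENNReal.ofReal_ne_top
      ((ENNReal.le_tsum j).trans (tsum_diagonalSum ht hT hs).le)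
  -- The factor `1 = ∑_j |⟨b_{k,i}, φ_j⟩|²` is inserted and absorbed by homogeneity; then the log
  -- sum inequality over all pairs `(k, i)` applies at each fixed `j`.
  have h1 : ∑' k, homEnt (t k) (T k) = ∑' j, ∑' p : Σ k, ι k,
      ENNReal.ofReal (relEnt (‖inner ℂ (b p.1 p.2) (φ j)‖ ^ 2 * t p.1 p.2)
        (‖inner ℂ (b p.1 p.2) (φ j)‖ ^ 2 * T p.1)) := by
    rw [ENNReal.tsum_comm, ENNReal.tsum_sigma']
    refine tsum_congr fun k => tsum_congr fun i => ?_
    simp_rw [relEnt_mul (ht k i) (htT k i), ENNReal.ofReal_mul (sq_nonneg _)]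
    rw [ENNReal.tsum_mul_right]
    simp_rw [norm_inner_symm (b k i)]
    rw [tsum_normSq_inner_basis φ (φ := b k) i, one_mul]
  rw [h1]
  refine ENNReal.tsum_le_tsum fun j => ?_
  refine tsum_relEnt_le (fun p => mul_nonneg (sq_nonneg _) (ht _ _))
    (fun p => mul_le_mul_of_nonneg_left (htT _ _) (sq_nonneg _)) ENNReal.toReal_nonneg ?_ hs0 ?_
  · rw [ENNReal.ofReal_toReal (hfin j), ENNReal.tsum_sigma']
    refine tsum_congr fun k => tsum_congr fun i => ?_
    rw [mul_comm, ENNReal.ofReal_mul (ht k i)]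
  · rw [ENNReal.tsum_sigma', ← tsum_ofReal_of_hasSum hT0 hs]
    refine ENNReal.tsum_le_tsum fun k => ?_
    simp_rw [ENNReal.ofReal_mul (sq_nonneg _)]
    rw [ENNReal.tsum_mul_right, tsum_normSq_inner_basis, one_mul]

theorem State.hasSum_quad (ω : State V) (φ : HilbertBasis J ℂ V) :
    HasSum (fun j => quad ω.op (φ j)) 1 := by
  refine hasSum_of_tsum_ofReal (fun j => quad_nonneg ω.isPositive _) zero_le_one ?_
  rw [← opTrace_eq ω.isPositive, ω.trace_eq_one, ENNReal.ofReal_one]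

theorem State.entropy_le (ω : State V) (φ : HilbertBasis J ℂ V) :
    ω.entropy ≤ ∑' j, ENNReal.ofReal (Real.negMulLog (quad ω.op (φ j))) := by
  obtain ⟨ι, b, r, hr, hb⟩ := exists_eigenbasis ω.isPositive
    (by rw [ω.trace_eq_one]; exact ENNReal.one_ne_top)
  have h1 := ω.ofReal_mul_entropy b hr hb zero_le_one
  simp only [ENNReal.ofReal_one, one_mul] at h1
  have h2 := tsum_homEnt_le (φ := φ) (b := fun _ : Unit => b) (t := fun _ => r) (T := fun _ => 1)
    (s := 1) (fun _ => hr) (fun _ => ω.hasSum_eigenvalues b hr hb) (by simp)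
  have h3 : ∀ j, diagonalSum φ (fun _ : Unit => b) (fun _ => r) j =
      ENNReal.ofReal (quad ω.op (φ j)) := fun j => by
    simp [diagonalSum, ofReal_quad_eigenbasis ω.isPositive b hr hb]
  simp_rw [h3, ENNReal.toReal_ofReal (quad_nonneg ω.isPositive _), relEnt_one_right] at h2
  rw [h1]
  simpa using h2

theorem exists_diagonal_state (φ : HilbertBasis J ℂ V) {q : J → ℝ} (hq : ∀ j, 0 ≤ q j)
    (hs : HasSum q 1) : ∃ ω : State V, ∀ j, ω.op (φ j) = (q j : ℂ) • φ j := by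
  classical
  have hsum : Summable fun j => q j • (InnerProductSpace.rankOne ℂ (φ j) (φ j) : V →L[ℂ] V) := by
    refine Summable.of_norm_bounded hs.summable fun j => ?_
    rw [norm_smul, Real.norm_of_nonneg (hq j), InnerProductSpace.norm_rankOne, φ.orthonormal.1]
    simp
  set S := ∑' j, q j • (InnerProductSpace.rankOne ℂ (φ j) (φ j) : V →L[ℂ] V) with hS
  have hSs := hsum.hasSum
  have happ : ∀ x, HasSum (fun j => q j • (inner ℂ (φ j) x • φ j)) (S x) := fun x => by
    have := (ContinuousLinearMap.apply ℂ V x).hasSum hSs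
    simpa using this
  have hSφ : ∀ j, S (φ j) = (q j : ℂ) • φ j := fun j => by
    refine (happ (φ j)).unique ?_
    have h2 := hasSum_ite_eq j ((q j : ℂ) • φ j)
    convert h2 using 2 with i
    rw [orthonormal_iff_ite.1 φ.orthonormal]
    split_ifs with h
    · rw [h]; simp
    · simp
  have hpos : S.IsPositive := by
    rw [ContinuousLinearMap.isPositive_def']
    constructor
    · refine hSs.star.unique ?_
      convert hSs using 2 with j
      exact (IsPositive.real_smul (InnerProductSpace.isPositive_rankOne_self (𝕜 := ℂ) (φ j))
        (hq j)).isSelfAdjoint.star_eq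
    · intro x
      rw [ContinuousLinearMap.reApplyInnerSelf_apply, inner_re_symm]
      have h1 := Complex.hasSum_re ((innerSL ℂ x).hasSum (happ x))
      refine h1.nonneg fun j => ?_
      rw [innerSL_apply_apply, ← Complex.coe_smul, inner_smul_right,
        inner_smul_right, ← inner_conj_symm x (φ j), Complex.mul_conj, ← Complex.ofReal_mul,
        Complex.ofReal_re]
      exact mul_nonneg (hq j) (Complex.normSq_nonneg _)
  refine ⟨⟨S, hpos, ?_⟩, hSφ⟩
  rw [opTrace_eigenbasis hpos φ hSφ, tsum_ofReal_of_hasSum hq hs, ENNReal.ofReal_one]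

end Peierls

/-! ### Pointwise bounds by energy and Boltzmann weight -/

section Boltzmann

theorem exists_pos_mul_le {e δ : ℝ≥0∞} (he : e ≠ ∞) (hδ : 0 < δ) :
    ∃ β : ℝ, 0 < β ∧ ENNReal.ofReal β * e ≤ δ := by
  have h1 : Filter.Tendsto (fun β : ℝ => ENNReal.ofReal β * e) (𝓝[>] 0) (𝓝 0) := by
    have h2 : Filter.Tendsto (fun β : ℝ => ENNReal.ofReal β) (𝓝[>] 0) (𝓝 0) := by
      simpa using (ENNReal.continuous_ofReal.tendsto 0).mono_left nhdsWithin_le_nhds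
    simpa using ENNReal.Tendsto.mul_const h2 (Or.inr he)
  obtain ⟨β, h3, h4⟩ := (((ENNReal.tendsto_nhds_zero.1 h1) δ hδ).and self_mem_nhdsWithin).exists
  exact ⟨β, h4, h3⟩

/-- The Gibbs variational inequality for one level: `ln u ≤ u - 1` at `u = e^{-βE} / q`. For
infinite energy and `q > 0` the right side is infinite. -/
theorem ofReal_negMulLog_le {β q : ℝ} (hβ : 0 < β) (hq : 0 ≤ q) (E : ℝ≥0∞) :
    ENNReal.ofReal (Real.negMulLog q) ≤
      ENNReal.ofReal β * (E * ENNReal.ofReal q) + boltzmann β E := by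
  rcases hq.eq_or_lt with rfl | hq
  · simp
  by_cases hE : E = ∞
  · rw [hE, ENNReal.top_mul (by simpa using hq), ENNReal.mul_top (by simpa using hβ)]
    simp
  rw [boltzmann, if_neg hE]
  conv_rhs => rw [← ENNReal.ofReal_toReal hE]
  rw [ENNReal.toReal_ofReal ENNReal.toReal_nonneg, ← ENNReal.ofReal_mul ENNReal.toReal_nonneg,
    ← ENNReal.ofReal_mul hβ.le, ← ENNReal.ofReal_add (by positivity) (Real.exp_pos _).le]
  refine ENNReal.ofReal_le_ofReal ?_
  set x := E.toReal
  have h1 := Real.log_le_sub_one_of_pos (x := Real.exp (-(β * x)) / q)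
    (div_pos (Real.exp_pos _) hq)
  rw [Real.log_div (Real.exp_pos _).ne' hq.ne', Real.log_exp] at h1
  have h2 := mul_le_mul_of_nonneg_left h1 hq.le
  have h3 : q * (Real.exp (-(β * x)) / q - 1) = Real.exp (-(β * x)) - q := by field_simp
  rw [h3] at h2
  unfold Real.negMulLog
  nlinarith

/-- If `βE ≥ 1` the energy term suffices, and otherwise `e · e^{-βE} ≥ 1`. This provides tightness:
bounded energy prevents mass from escaping to high levels. -/
theorem ofReal_le_boltzmann {β q : ℝ} (hβ : 0 < β) (hq : 0 ≤ q) (hq1 : q ≤ 1) (E : ℝ≥0∞) :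
    ENNReal.ofReal q ≤ ENNReal.ofReal β * (E * ENNReal.ofReal q) +
      ENNReal.ofReal (Real.exp 1) * boltzmann β E := by
  rcases hq.eq_or_lt with rfl | hq
  · simp
  by_cases hE : E = ∞
  · rw [hE, ENNReal.top_mul (by simpa using hq), ENNReal.mul_top (by simpa using hβ)]
    simp
  rw [boltzmann, if_neg hE]
  conv_rhs => rw [← ENNReal.ofReal_toReal hE]
  rw [ENNReal.toReal_ofReal ENNReal.toReal_nonneg, ← ENNReal.ofReal_mul ENNReal.toReal_nonneg,
    ← ENNReal.ofReal_mul hβ.le, ← ENNReal.ofReal_mul (Real.exp_pos _).le, ← Real.exp_add,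
    ← ENNReal.ofReal_add (by positivity) (Real.exp_pos _).le]
  refine ENNReal.ofReal_le_ofReal ?_
  set x := E.toReal
  have hx : 0 ≤ x := ENNReal.toReal_nonneg
  rcases le_total 1 (β * x) with h | h
  · have := Real.exp_pos (1 + -(β * x))
    nlinarith
  · have h1 : 1 ≤ Real.exp (1 + -(β * x)) := Real.one_le_exp (by linarith)
    have : 0 ≤ β * (x * q) := by positivity
    linarith

end Boltzmann

/-! ### The maximal entropy function -/

section MaxEntropy

variable {V : Type u} [NormedAddCommGroup V] [InnerProductSpace ℂ V] [CompleteSpace V]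
  {H : PositiveOperator V} {J : Type*} {φ : HilbertBasis J ℂ V} {E : J → ℝ≥0∞}

namespace PositiveOperator

theorem maxEntropy_mono {E E' : ℝ≥0∞} (h : E ≤ E') : H.maxEntropy E ≤ H.maxEntropy E' :=
  iSup_mono fun _ => iSup_const_mono fun h' => h'.trans h

theorem maxEntropy_le
    (hH : ∀ ω : V →L[ℂ] V, ω.IsPositive →
      H.meanEnergy ω = ∑' j, E j * ENNReal.ofReal (quad ω (φ j)))
    {β : ℝ} (hβ : 0 < β) (e : ℝ≥0∞) :
    H.maxEntropy e ≤ ENNReal.ofReal β * e + ∑' j, boltzmann β (E j) := by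
  refine iSup₂_le fun ω hω => (ω.entropy_le φ).trans ?_
  rw [hH _ ω.isPositive] at hω
  calc _ ≤ ∑' j, (ENNReal.ofReal β * (E j * ENNReal.ofReal (quad ω.op (φ j))) +
        boltzmann β (E j)) := ENNReal.tsum_le_tsum fun j =>
          ofReal_negMulLog_le hβ (quad_nonneg ω.isPositive _) _
    _ ≤ _ := by
      rw [ENNReal.tsum_add, ENNReal.tsum_mul_left]
      gcongr

/-- By `maxEntropy_le` the quantity is at most `βe + ε ∑_j e^{-βE_j}`; first `β` is chosen small,
then `ε`. -/
theorem tendsto_mul_maxEntropy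
    (hH : ∀ ω : V →L[ℂ] V, ω.IsPositive →
      H.meanEnergy ω = ∑' j, E j * ENNReal.ofReal (quad ω (φ j)))
    (hZ : ∀ β : ℝ, 0 < β → ∑' j, boltzmann β (E j) ≠ ∞) {e : ℝ≥0∞} (he : e ≠ ∞) :
    Filter.Tendsto (fun ε : ℝ => ENNReal.ofReal ε * H.maxEntropy (e / ENNReal.ofReal ε))
      (𝓝[>] 0) (𝓝 0) := by
  rw [ENNReal.tendsto_nhds_zero]
  intro δ hδ
  obtain ⟨β, hβ, hβe⟩ := exists_pos_mul_le he (ENNReal.half_pos hδ.ne')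
  have h1 : Filter.Tendsto (fun ε : ℝ => ENNReal.ofReal ε * ∑' j, boltzmann β (E j))
      (𝓝[>] 0) (𝓝 0) := by
    have h2 : Filter.Tendsto (fun β : ℝ => ENNReal.ofReal β) (𝓝[>] 0) (𝓝 0) := by
      simpa using (ENNReal.continuous_ofReal.tendsto 0).mono_left nhdsWithin_le_nhds
    simpa using ENNReal.Tendsto.mul_const h2 (Or.inr (hZ β hβ))
  filter_upwards [(ENNReal.tendsto_nhds_zero.1 h1) (δ / 2) (ENNReal.half_pos hδ.ne'),
    self_mem_nhdsWithin] with ε h3 h4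
  have hε : ENNReal.ofReal ε ≠ 0 := by
    have : (0 : ℝ) < ε := h4
    simpa using this
  calc _ ≤ ENNReal.ofReal ε * (ENNReal.ofReal β * (e / ENNReal.ofReal ε) +
        ∑' j, boltzmann β (E j)) := mul_le_mul_right (maxEntropy_le hH hβ _) _
    _ = ENNReal.ofReal β * e + ENNReal.ofReal ε * ∑' j, boltzmann β (E j) := by
      rw [mul_add, mul_left_comm, ENNReal.mul_div_cancel hε ENNReal.ofReal_ne_top]
    _ ≤ δ / 2 + δ / 2 := add_le_add hβe h3
    _ = δ := ENNReal.add_halves δ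

theorem exists_diagonal_state
    (hH : ∀ ω : V →L[ℂ] V, ω.IsPositive →
      H.meanEnergy ω = ∑' j, E j * ENNReal.ofReal (quad ω (φ j)))
    {q : J → ℝ} (hq : ∀ j, 0 ≤ q j) (hs : HasSum q 1) :
    ∃ ω : State V, (∀ j, ω.op (φ j) = (q j : ℂ) • φ j) ∧
      H.meanEnergy ω.op = ∑' j, E j * ENNReal.ofReal (q j) ∧
      ω.entropy = ∑' j, ENNReal.ofReal (Real.negMulLog (q j)) := by
  obtain ⟨ω, hω⟩ := QCEntropy.exists_diagonal_state φ hq hs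
  refine ⟨ω, hω, ?_, ω.entropy_eq φ hω⟩
  rw [hH _ ω.isPositive]
  simp_rw [quad_eigenvector (φ.orthonormal.1 _) (hω _)]

/-- The total entropy of a family of positive operators with total trace at most `ε` is bounded by
the maximal entropy at the total energy of the family. -/
theorem tsum_homEnt_le_mul_maxEntropy
    (hH : ∀ ω : V →L[ℂ] V, ω.IsPositive →
      H.meanEnergy ω = ∑' j, E j * ENNReal.ofReal (quad ω (φ j)))
    {j₀ : J} (hj₀ : E j₀ = 0) {κ : Type*} {ι : κ → Type*} (b : ∀ k, HilbertBasis (ι k) ℂ V)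
    {t : ∀ k, ι k → ℝ} {T : κ → ℝ} {s ε : ℝ} (ht : ∀ k i, 0 ≤ t k i)
    (hT : ∀ k, HasSum (t k) (T k)) (hs : HasSum T s) (hε : 0 < ε) (hsε : s ≤ ε) :
    ∑' k, homEnt (t k) (T k) ≤ ENNReal.ofReal ε *
      H.maxEntropy ((∑' j, E j * diagonalSum φ b t j) / ENNReal.ofReal ε) := by
  classical
  have hT0 : ∀ k, 0 ≤ T k := fun k => (hT k).nonneg (ht k)
  have hs0 : 0 ≤ s := hs.nonneg hT0
  have hsumQ := tsum_diagonalSum (φ := φ) (b := b) ht hT hs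
  have hfin : ∀ j, diagonalSum φ b t j ≠ ∞ := fun j =>
    ne_top_of_le_ne_top ENNReal.ofReal_ne_top ((ENNReal.le_tsum j).trans hsumQ.le)
  set Q : J → ℝ := fun j => (diagonalSum φ b t j).toReal with hQ
  have hQ0 : ∀ j, 0 ≤ Q j := fun j => ENNReal.toReal_nonneg
  have hQof : ∀ j, ENNReal.ofReal (Q j) = diagonalSum φ b t j := fun j =>
    ENNReal.ofReal_toReal (hfin j)
  have hQs : HasSum Q s := hasSum_of_tsum_ofReal hQ0 hs0 (by simp_rw [hQof]; exact hsumQ)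
  -- The missing mass `ε - s` goes to a level of zero energy, so that `Q' / ε` is a distribution
  -- with energy bounded as required.
  set Q' : J → ℝ := fun j => Q j + if j = j₀ then ε - s else 0 with hQ'
  have hadd : ∀ j, 0 ≤ (if j = j₀ then ε - s else 0) := fun j => by
    split_ifs
    · linarith
    · exact le_rfl
  have hadd' : ∀ j, (if j = j₀ then ε - s else 0) ≤ ε - s := fun j => by
    split_ifs
    · exact le_rfl
    · linarith
  have hQ'0 : ∀ j, 0 ≤ Q' j := fun j => add_nonneg (hQ0 j) (hadd j)
  have hQ's : HasSum Q' ε := by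
    have := hQs.add (hasSum_ite_eq j₀ (ε - s))
    rwa [add_sub_cancel] at this
  obtain ⟨ω, -, hωE, hωS⟩ := exists_diagonal_state hH (q := fun j => Q' j / ε)
    (fun j => div_nonneg (hQ'0 j) hε.le)
    (by have := hQ's.div_const ε; rwa [div_self hε.ne'] at this)
  have hmem : H.meanEnergy ω.op ≤ (∑' j, E j * diagonalSum φ b t j) / ENNReal.ofReal ε := by
    rw [hωE, div_eq_mul_inv, ← ENNReal.tsum_mul_right]
    refine ENNReal.tsum_le_tsum fun j => ?_
    by_cases hj : j = j₀
    · simp [hj, hj₀]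
    · simp only [hQ', if_neg hj, add_zero]
      rw [ENNReal.ofReal_div_of_pos hε, hQof, div_eq_mul_inv, mul_assoc]
  refine (tsum_homEnt_le (φ := φ) (b := b) ht hT hs).trans ?_
  refine le_trans ?_ (mul_le_mul_right (le_iSup₂ (f := fun (ω : State V)
    (_ : H.meanEnergy ω.op ≤ _) => ω.entropy) ω hmem) _)
  rw [hωS, ← ENNReal.tsum_mul_left]
  refine ENNReal.tsum_le_tsum fun j => ?_
  have hle : Q' j ≤ ε := le_hasSum hQ's j fun i _ => hQ'0 i
  have e1 : ε * Real.negMulLog (Q' j / ε) = relEnt (Q' j) ε := by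
    rw [← relEnt_mul_self (div_nonneg (hQ'0 j) hε.le) ((div_le_one hε).2 hle),
      mul_div_cancel₀ _ hε.ne']
  rw [← ENNReal.ofReal_mul hε.le, e1]
  -- Padding raises each entry by at most `ε - s`, exactly the growth of the total, so no term
  -- decreases.
  refine ENNReal.ofReal_le_ofReal (relEnt_mono (hQ0 j) (le_hasSum hQs j fun i _ => hQ0 i) ?_ ?_)
  · exact le_add_of_nonneg_right (hadd j)
  · simp only [hQ']
    linarith [hadd' j]

end PositiveOperator

end MaxEntropy

/-! ### Compactness and continuity under an energy bound -/

section Compactness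

variable {J : Type*} {E : J → ℝ≥0∞} {e : ℝ≥0∞}

/-- The families in `[0, 1]` whose total energy is at most `e`. -/
def energyBall (E : J → ℝ≥0∞) (e : ℝ≥0∞) : Set (J → ℝ) :=
  {q | (∀ j, q j ∈ Set.Icc (0 : ℝ) 1) ∧ ∑' j, E j * ENNReal.ofReal (q j) ≤ e}

/-- A closed subset of a product of intervals: the energy is a supremum of finite sums with
truncated levels, each continuous even where `E j` is infinite. -/
theorem isCompact_energyBall : IsCompact (energyBall E e) := by
  refine (isCompact_univ_pi fun _ : J => isCompact_Icc (a := (0 : ℝ)) (b := 1)).of_isClosed_subset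
    ?_ fun q hq j _ => hq.1 j
  have h : energyBall E e = (⋂ j, {q : J → ℝ | q j ∈ Set.Icc (0 : ℝ) 1}) ∩
      ⋂ (n : ℕ) (F : Finset J), {q | ∑ j ∈ F, min (E j) n * ENNReal.ofReal (q j) ≤ e} := by
    ext q
    simp only [energyBall, Set.mem_inter_iff, Set.mem_iInter, Set.mem_ofPred_eq]
    refine and_congr_right fun _ => ?_
    rw [← tsum_iSup_min_mul, iSup_le_iff]
    simp_rw [ENNReal.tsum_eq_iSup_sum, iSup_le_iff]
  rw [h]
  refine (isClosed_iInter fun j => isClosed_Icc.preimage (continuous_apply j)).inter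
    (isClosed_iInter fun n => isClosed_iInter fun F => isClosed_le ?_ continuous_const)
  refine continuous_finsetSum _ fun j _ => ?_
  refine (ENNReal.continuous_const_mul ?_).comp
    (ENNReal.continuous_ofReal.comp (continuous_apply j))
  exact ne_top_of_le_ne_top (ENNReal.natCast_ne_top n) (min_le_right _ _)

variable {f : ℝ → ℝ} {C : ℝ≥0∞}

theorem tsum_ofReal_comp_le
    (hf : ∀ β : ℝ, 0 < β → ∀ q ∈ Set.Icc (0 : ℝ) 1, ∀ x : ℝ≥0∞, ENNReal.ofReal (f q) ≤
      ENNReal.ofReal β * (x * ENNReal.ofReal q) + C * boltzmann β x)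
    {q : J → ℝ} (hq : q ∈ energyBall E e) {β : ℝ} (hβ : 0 < β) (F : Finset J) :
    ∑' j : {j // j ∉ F}, ENNReal.ofReal (f (q j)) ≤
      ENNReal.ofReal β * e + ∑' j : {j // j ∉ F}, C * boltzmann β (E j) := by
  refine (ENNReal.tsum_le_tsum fun j : {j // j ∉ F} => hf β hβ (q j) (hq.1 j) (E j)).trans ?_
  rw [ENNReal.tsum_add, ENNReal.tsum_mul_left]
  gcongr
  exact (ENNReal.tsum_comp_le_tsum_of_injective Subtype.val_injective _).trans hq.2

theorem summable_comp_of_mem_energyBall (he : e ≠ ∞) (hC : C ≠ ∞)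
    (hZ : ∀ β : ℝ, 0 < β → ∑' j, boltzmann β (E j) ≠ ∞)
    (hf0 : ∀ q ∈ Set.Icc (0 : ℝ) 1, 0 ≤ f q)
    (hf : ∀ β : ℝ, 0 < β → ∀ q ∈ Set.Icc (0 : ℝ) 1, ∀ x : ℝ≥0∞, ENNReal.ofReal (f q) ≤
      ENNReal.ofReal β * (x * ENNReal.ofReal q) + C * boltzmann β x)
    {q : J → ℝ} (hq : q ∈ energyBall E e) : Summable fun j => f (q j) := by
  refine summable_of_tsum_ofReal (fun j => hf0 _ (hq.1 j)) ?_
  refine ne_top_of_le_ne_top ?_ (ENNReal.tsum_le_tsum fun j => hf 1 one_pos (q j) (hq.1 j) (E j))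
  rw [ENNReal.tsum_add, ENNReal.tsum_mul_left, ENNReal.tsum_mul_left]
  exact ENNReal.add_ne_top.2 ⟨ENNReal.mul_ne_top ENNReal.ofReal_ne_top
    (ne_top_of_le_ne_top he hq.2), ENNReal.mul_ne_top hC (hZ 1 one_pos)⟩

/-- The tails are uniformly small, being at most `βe` plus a tail of a convergent Boltzmann sum. It
serves twice: for the entropy, and for the total mass. -/
theorem continuousOn_tsum_energyBall (he : e ≠ ∞) (hC : C ≠ ∞)
    (hZ : ∀ β : ℝ, 0 < β → ∑' j, boltzmann β (E j) ≠ ∞) (hfc : Continuous f)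
    (hf0 : ∀ q ∈ Set.Icc (0 : ℝ) 1, 0 ≤ f q)
    (hf : ∀ β : ℝ, 0 < β → ∀ q ∈ Set.Icc (0 : ℝ) 1, ∀ x : ℝ≥0∞, ENNReal.ofReal (f q) ≤
      ENNReal.ofReal β * (x * ENNReal.ofReal q) + C * boltzmann β x) :
    ContinuousOn (fun q : J → ℝ => ∑' j, f (q j)) (energyBall E e) := by
  have hu : TendstoUniformlyOn (fun (F : Finset J) (q : J → ℝ) => ∑ j ∈ F, f (q j))
      (fun q => ∑' j, f (q j)) Filter.atTop (energyBall E e) := by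
    rw [Metric.tendstoUniformlyOn_iff]
    intro δ hδ
    have hδ' : 0 < ENNReal.ofReal (δ / 2) := by simpa using hδ
    obtain ⟨β, hβ, hβe⟩ := exists_pos_mul_le he (ENNReal.half_pos hδ'.ne')
    have htop : ∑' j, C * boltzmann β (E j) ≠ ∞ := by
      rw [ENNReal.tsum_mul_left]; exact ENNReal.mul_ne_top hC (hZ β hβ)
    filter_upwards [(ENNReal.tendsto_nhds_zero.1 (ENNReal.tendsto_tsum_compl_atTop_zero htop)) _
      (ENNReal.half_pos hδ'.ne')] with F hF q hq
    have hsum := summable_comp_of_mem_energyBall he hC hZ hf0 hf hq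
    have h1 := hsum.sum_add_tsum_subtype_compl F
    have hnn : 0 ≤ ∑' j : {j // j ∉ F}, f (q j) := tsum_nonneg fun j => hf0 _ (hq.1 j)
    rw [← h1, Real.dist_eq, add_sub_cancel_left, abs_of_nonneg hnn]
    have h2 : ENNReal.ofReal (∑' j : {j // j ∉ F}, f (q j)) ≤ ENNReal.ofReal (δ / 2) := by
      have hs' : Summable fun j : {j // j ∉ F} => f (q j) := hsum.subtype _
      rw [← tsum_ofReal_of_hasSum (fun j : {j // j ∉ F} => hf0 _ (hq.1 j)) hs'.hasSum]
      exact ((tsum_ofReal_comp_le hf hq hβ F).trans (add_le_add hβe hF)).trans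
        (ENNReal.add_halves _).le
    rw [ENNReal.ofReal_le_ofReal_iff (by linarith)] at h2
    linarith
  refine hu.continuousOn (Filter.Eventually.of_forall fun F => Continuous.continuousOn ?_).frequently
  exact continuous_finsetSum _ fun j _ => hfc.comp (continuous_apply j)

end Compactness

/-! ### Maximizers and their mixtures with the ground level -/

section Attainment

variable {V : Type u} [NormedAddCommGroup V] [InnerProductSpace ℂ V] [CompleteSpace V]
  {H : PositiveOperator V} {J : Type*} {φ : HilbertBasis J ℂ V} {E : J → ℝ≥0∞}

/-- The maximal entropy under an energy constraint is attained at a probability distribution over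
the energy levels. -/
theorem PositiveOperator.exists_maxEntropy_le
    (hH : ∀ ω : V →L[ℂ] V, ω.IsPositive →
      H.meanEnergy ω = ∑' j, E j * ENNReal.ofReal (quad ω (φ j)))
    (hZ : ∀ β : ℝ, 0 < β → ∑' j, boltzmann β (E j) ≠ ∞)
    {j₀ : J} (hj₀ : E j₀ = 0) {e : ℝ≥0∞} (he : e ≠ ∞) :
    ∃ q : J → ℝ, (∀ j, 0 ≤ q j) ∧ HasSum q 1 ∧ ∑' j, E j * ENNReal.ofReal (q j) ≤ e ∧
      H.maxEntropy e ≤ ∑' j, ENNReal.ofReal (Real.negMulLog (q j)) ∧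
      ∑' j, ENNReal.ofReal (Real.negMulLog (q j)) ≠ ∞ := by
  classical
  have hf0 : ∀ q ∈ Set.Icc (0 : ℝ) 1, 0 ≤ Real.negMulLog q := fun q hq =>
    Real.negMulLog_nonneg hq.1 hq.2
  have hf : ∀ β : ℝ, 0 < β → ∀ q ∈ Set.Icc (0 : ℝ) 1, ∀ x : ℝ≥0∞,
      ENNReal.ofReal (Real.negMulLog q) ≤
      ENNReal.ofReal β * (x * ENNReal.ofReal q) + 1 * boltzmann β x := fun β hβ q hq x => by
    rw [one_mul]; exact ofReal_negMulLog_le hβ hq.1 x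
  have hg : ∀ β : ℝ, 0 < β → ∀ q ∈ Set.Icc (0 : ℝ) 1, ∀ x : ℝ≥0∞, ENNReal.ofReal q ≤
      ENNReal.ofReal β * (x * ENNReal.ofReal q) + ENNReal.ofReal (Real.exp 1) * boltzmann β x :=
    fun β hβ q hq x => ofReal_le_boltzmann hβ hq.1 hq.2 x
  have hcS := continuousOn_tsum_energyBall he ENNReal.one_ne_top hZ Real.continuous_negMulLog hf0 hf
  have hcN := continuousOn_tsum_energyBall he ENNReal.ofReal_ne_top hZ (f := fun x => x)
    continuous_id (fun q hq => hq.1) hg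
  -- Normalization is not closed for pointwise convergence in general; it is here because the total
  -- mass is continuous on the energy ball.
  set K : Set (J → ℝ) := energyBall E e ∩ (fun q : J → ℝ => ∑' j, q j) ⁻¹' {1} with hK
  have hKc : IsCompact K := isCompact_energyBall.of_isClosed_subset
    (hcN.preimage_isClosed_of_isClosed isCompact_energyBall.isClosed isClosed_singleton)
    Set.inter_subset_left
  have hKne : K.Nonempty := by
    refine ⟨fun j => if j = j₀ then 1 else 0, ⟨fun j => ?_, ?_⟩, ?_⟩
    · beta_reduce; split_ifs <;> simp
    · refine le_trans (le_of_eq ?_) bot_le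
      refine ENNReal.tsum_eq_zero.2 fun j => ?_
      by_cases h : j = j₀
      · simp [h, hj₀]
      · simp [h]
    · change ∑' j, (if j = j₀ then (1 : ℝ) else 0) = 1
      exact tsum_ite_eq j₀ _
  obtain ⟨q, hqK, hmax⟩ := hKc.exists_isMaxOn hKne (hcS.mono Set.inter_subset_left)
  have hsumS : ∀ p ∈ K, Summable fun j => Real.negMulLog (p j) := fun p hp =>
    summable_comp_of_mem_energyBall he ENNReal.one_ne_top hZ hf0 hf hp.1
  have hsumN : ∀ p ∈ K, Summable p := fun p hp =>
    summable_comp_of_mem_energyBall he ENNReal.ofReal_ne_top hZ (f := fun x => x)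
      (fun q hq => hq.1) hg hp.1
  have hof : ∀ p ∈ K, ∑' j, ENNReal.ofReal (Real.negMulLog (p j)) =
      ENNReal.ofReal (∑' j, Real.negMulLog (p j)) := fun p hp =>
    tsum_ofReal_of_hasSum (fun j => hf0 _ (hp.1.1 j)) (hsumS p hp).hasSum
  refine ⟨q, fun j => (hqK.1.1 j).1, ?_, hqK.1.2, ?_, ?_⟩
  · have h1 : ∑' j, q j = 1 := hqK.2
    rw [← h1]; exact (hsumN q hqK).hasSum
  · refine iSup₂_le fun ω hω => (ω.entropy_le φ).trans ?_
    have hs := ω.hasSum_quad φ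
    have hmem : (fun j => quad ω.op (φ j)) ∈ K := by
      refine ⟨⟨fun j => ⟨quad_nonneg ω.isPositive _, ?_⟩, ?_⟩, hs.tsum_eq⟩
      · exact le_hasSum hs j fun i _ => quad_nonneg ω.isPositive _
      · rw [← hH _ ω.isPositive]; exact hω
    rw [hof _ hqK, hof _ hmem]
    exact ENNReal.ofReal_le_ofReal (hmax hmem)
  · rw [hof _ hqK]; exact ENNReal.ofReal_ne_top

/-- Mixing an entropy maximizer with the ground state strictly increases the entropy above the
corresponding fraction of the maximal entropy. -/
theorem exists_mixture_entropy_gt [DecidableEq J]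
    (hH : ∀ ω : V →L[ℂ] V, ω.IsPositive →
      H.meanEnergy ω = ∑' j, E j * ENNReal.ofReal (quad ω (φ j)))
    (hZ : ∀ β : ℝ, 0 < β → ∑' j, boltzmann β (E j) ≠ ∞)
    {j₀ j₁ : J} (hj₀ : E j₀ = 0) (hj : j₁ ≠ j₀) (hj₁ : E j₁ ≠ ∞) {e : ℝ≥0∞} (he0 : e ≠ 0)
    (he : e ≠ ∞) {ε : ℝ} (hε0 : 0 < ε) (hε1 : ε ≤ 1) :
    ∃ q : J → ℝ, (∀ j, 0 ≤ q j) ∧ HasSum q 1 ∧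
      ∑' j, E j * ENNReal.ofReal (q j) ≤ ENNReal.ofReal ε * e ∧
      ∑' j, ENNReal.ofReal |q j - if j = j₀ then 1 else 0| ≤ 2 * ENNReal.ofReal ε ∧
      ENNReal.ofReal ε * H.maxEntropy e ≤ ∑' j, ENNReal.ofReal (Real.negMulLog (q j)) ∧
      (ε < 1 → ENNReal.ofReal ε * H.maxEntropy e <
        ∑' j, ENNReal.ofReal (Real.negMulLog (q j))) := by
  obtain ⟨p, hp0, hps, hpE, hpS, hpfin⟩ := H.exists_maxEntropy_le hH hZ hj₀ he
  have hp1 : ∀ j, p j ≤ 1 := fun j => le_hasSum hps j fun i _ => hp0 i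
  set δ : J → ℝ := fun j => if j = j₀ then 1 else 0 with hδ
  have hδs : HasSum δ 1 := hasSum_ite_eq j₀ 1
  have hδ0 : ∀ j, 0 ≤ δ j := fun j => by simp only [hδ]; split_ifs <;> norm_num
  set q : J → ℝ := fun j => ε * p j + (1 - ε) * δ j with hq
  have hqδ : ∀ j, j ≠ j₀ → q j = ε * p j := fun j h => by simp [hq, hδ, h]
  have hq0 : q j₀ = ε * p j₀ + (1 - ε) := by simp [hq, hδ]
  have hη : ∀ x, 0 ≤ x → x ≤ 1 → ε * Real.negMulLog x ≤ Real.negMulLog (ε * x) := by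
    intro x hx _
    rw [Real.negMulLog_mul]
    have := mul_nonneg hx (Real.negMulLog_nonneg hε0.le hε1)
    linarith
  have hle : ∀ j, ε * Real.negMulLog (p j) ≤ Real.negMulLog (q j) := by
    intro j
    by_cases h : j = j₀
    · rw [h, hq0]
      -- At the ground level `q` is a convex combination of `p j₀` and 1, where `-x ln x` vanishes.
      have := Real.concaveOn_negMulLog.2 (x := p j₀) (Set.mem_Ici.2 (hp0 _)) (y := 1)
        (Set.mem_Ici.2 zero_le_one) hε0.le (sub_nonneg.2 hε1) (by ring)
      simpa using this
    · rw [hqδ j h]; exact hη _ (hp0 j) (hp1 j)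
  have hqpos : ∀ j, 0 ≤ q j := fun j =>
    add_nonneg (mul_nonneg hε0.le (hp0 j)) (mul_nonneg (sub_nonneg.2 hε1) (hδ0 j))
  have hsplit : ENNReal.ofReal ε * ∑' j, ENNReal.ofReal (Real.negMulLog (p j)) =
      ∑' j, ENNReal.ofReal (ε * Real.negMulLog (p j)) := by
    rw [← ENNReal.tsum_mul_left]
    simp_rw [ENNReal.ofReal_mul hε0.le]
  refine ⟨q, hqpos, ?_, ?_, ?_, ?_, ?_⟩
  · have := (hps.mul_left ε).add (hδs.mul_left (1 - ε))
    simpa using this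
  · refine le_trans ?_ (mul_le_mul_right hpE _)
    rw [← ENNReal.tsum_mul_left]
    refine ENNReal.tsum_le_tsum fun j => ?_
    by_cases h : j = j₀
    · simp [h, hj₀]
    · rw [hqδ j h, ENNReal.ofReal_mul hε0.le, mul_left_comm]
  · have h1 : ∀ j, ENNReal.ofReal |q j - δ j| ≤
        ENNReal.ofReal ε * (ENNReal.ofReal (p j) + ENNReal.ofReal (δ j)) := fun j => by
      rw [← ENNReal.ofReal_add (hp0 j) (hδ0 j), ← ENNReal.ofReal_mul hε0.le]
      refine ENNReal.ofReal_le_ofReal ?_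
      have : q j - δ j = ε * (p j - δ j) := by simp only [hq]; ring
      rw [this, abs_mul, abs_of_pos hε0]
      refine mul_le_mul_of_nonneg_left (abs_le.2 ⟨?_, ?_⟩) hε0.le
      · linarith [hp0 j]
      · linarith [hδ0 j]
    refine (ENNReal.tsum_le_tsum h1).trans (le_of_eq ?_)
    rw [ENNReal.tsum_mul_left, ENNReal.tsum_add, tsum_ofReal_of_hasSum hp0 hps,
      tsum_ofReal_of_hasSum hδ0 hδs, ENNReal.ofReal_one, one_add_one_eq_two, mul_comm]
  · refine (mul_le_mul_right hpS _).trans ?_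
    rw [hsplit]
    exact ENNReal.tsum_le_tsum fun j => ENNReal.ofReal_le_ofReal (hle j)
  · intro hε
    refine (mul_le_mul_right hpS _).trans_lt ?_
    rw [hsplit]
    -- If the maximizer sat wholly on `j₀`, the maximal entropy would be zero. But a small weight
    -- `y` on `j₁`, with `y E_{j₁} ≤ e`, gives an admissible state of positive entropy.
    obtain ⟨j, hjne, hjpos⟩ : ∃ j, j ≠ j₀ ∧ 0 < p j := by
      by_contra hcon
      push Not at hcon
      have hz : ∀ j, j ≠ j₀ → p j = 0 := fun j h => le_antisymm (hcon j h) (hp0 j)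
      have hone : p j₀ = 1 := (hasSum_single j₀ hz).unique hps
      have hSz : H.maxEntropy e ≤ 0 := by
        refine hpS.trans (le_of_eq (ENNReal.tsum_eq_zero.2 fun j => ?_))
        by_cases h : j = j₀
        · simp [h, hone]
        · simp [hz j h]
      obtain ⟨x, hx0, hx⟩ := exists_pos_mul_le hj₁ (pos_iff_ne_zero.2 he0)
      set y := min x (1 / 2) with hy
      have hy0 : 0 < y := lt_min hx0 (by norm_num)
      have hy1 : y < 1 := lt_of_le_of_lt (min_le_right _ _) (by norm_num)
      set r : J → ℝ := fun j => (1 - y) * δ j + y * (if j = j₁ then 1 else 0) with hr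
      have hrs : HasSum r 1 := by
        have := (hδs.mul_left (1 - y)).add ((hasSum_ite_eq j₁ (1 : ℝ)).mul_left y)
        rw [mul_one, mul_one, sub_add_cancel] at this
        exact this
      have hr0 : ∀ j, 0 ≤ r j := fun j => by
        refine add_nonneg (mul_nonneg (by linarith) (hδ0 j)) (mul_nonneg hy0.le ?_)
        split_ifs <;> norm_num
      have hr1 : r j₁ = y := by simp [hr, hδ, hj]
      obtain ⟨ω, -, hωE, hωS⟩ := PositiveOperator.exists_diagonal_state hH hr0 hrs
      have hωe : H.meanEnergy ω.op ≤ e := by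
        rw [hωE, tsum_eq_single j₁]
        · rw [hr1, mul_comm]
          exact le_trans (mul_le_mul_left (ENNReal.ofReal_le_ofReal (min_le_left _ _)) _) hx
        · intro j h
          by_cases h' : j = j₀
          · simp [h', hj₀]
          · simp [hr, hδ, h, h']
      have h2 : ω.entropy ≤ 0 := (le_iSup₂ (f := fun (ω : State V)
        (_ : H.meanEnergy ω.op ≤ e) => ω.entropy) ω hωe).trans hSz
      rw [hωS] at h2
      have h3 := (ENNReal.le_tsum j₁).trans h2
      rw [hr1, nonpos_iff_eq_zero, ENNReal.ofReal_eq_zero, Real.negMulLog] at h3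
      have := Real.log_neg hy0 hy1
      nlinarith
    refine ENNReal.tsum_lt_tsum (i := j) ?_ (fun j => ENNReal.ofReal_le_ofReal (hle j)) ?_
    · rw [← hsplit]; exact ENNReal.mul_ne_top ENNReal.ofReal_ne_top hpfin
    · rw [hqδ j hjne]
      -- Scaling gains `p j · (-ε ln ε)`, positive exactly because `0 < ε < 1` and `p j > 0`.
      have hlt : ε * Real.negMulLog (p j) < Real.negMulLog (ε * p j) := by
        rw [Real.negMulLog_mul]
        have h1 : 0 < Real.negMulLog ε := by
          rw [Real.negMulLog]
          nlinarith [Real.log_neg hε0 hε]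
        linarith [mul_pos hjpos h1]
      refine (ENNReal.ofReal_lt_ofReal_iff ?_).2 hlt
      exact lt_of_le_of_lt (mul_nonneg hε0.le (Real.negMulLog_nonneg (hp0 j) (hp1 j))) hlt

end Attainment

/-! ### Envelopes and limits of the bounds -/

section Envelope

theorem binEntropy_le_binEntropyUp {t x : ℝ} (ht : 0 ≤ t) (h : t ≤ x) :
    Real.binEntropy t ≤ binEntropyUp x := by
  rw [binEntropyUp]
  split_ifs with hx
  · rw [one_div] at hx
    exact Real.binEntropy_strictMonoOn.monotoneOn ⟨ht, h.trans hx⟩ ⟨ht.trans h, hx⟩ h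
  · exact Real.binEntropy_le_log_two

theorem tendsto_binEntropyUp : Filter.Tendsto binEntropyUp (𝓝[>] 0) (𝓝 0) := by
  have h1 : Filter.Tendsto Real.binEntropy (𝓝[>] 0) (𝓝 0) := by
    simpa using (Real.binEntropy_continuous.tendsto 0).mono_left nhdsWithin_le_nhds
  refine h1.congr' ?_
  filter_upwards [nhdsWithin_le_nhds (Iio_mem_nhds (show (0 : ℝ) < 1 / 2 by norm_num))] with x hx
  rw [binEntropyUp, if_pos (le_of_lt hx)]

variable (d : ℕ)

theorem mul_log_add_binEntropy_le {t x : ℝ} (ht : t ∈ Set.Icc 0 x) :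
    t * Real.log d + Real.binEntropy t ≤ x * Real.log d + binEntropyUp x :=
  add_le_add (mul_le_mul_of_nonneg_right ht.2 (Real.log_natCast_nonneg d))
    (binEntropy_le_binEntropyUp ht.1 ht.2)

theorem upperEnvelope_le {x : ℝ} (hx : 0 ≤ x) :
    upperEnvelope (fun t => t * Real.log d + Real.binEntropy t) x ≤
      x * Real.log d + binEntropyUp x := by
  refine csSup_le ((Set.nonempty_Icc.2 hx).image _) ?_
  rintro _ ⟨t, ht, rfl⟩
  exact mul_log_add_binEntropy_le d ht

theorem le_upperEnvelope {t x : ℝ} (ht : t ∈ Set.Icc 0 x) :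
    t * Real.log d + Real.binEntropy t ≤
      upperEnvelope (fun t => t * Real.log d + Real.binEntropy t) x := by
  refine le_csSup ⟨x * Real.log d + binEntropyUp x, ?_⟩ ⟨t, ht, rfl⟩
  rintro _ ⟨t, ht, rfl⟩
  exact mul_log_add_binEntropy_le d ht

theorem upperEnvelope_nonneg {x : ℝ} (hx : 0 ≤ x) :
    0 ≤ upperEnvelope (fun t => t * Real.log d + Real.binEntropy t) x := by
  simpa using le_upperEnvelope d (t := 0) ⟨le_rfl, hx⟩

theorem tendsto_mul_log_add_binEntropyUp :
    Filter.Tendsto (fun x : ℝ => x * Real.log d + binEntropyUp x) (𝓝[>] 0) (𝓝 0) := by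
  have h1 : Filter.Tendsto (fun x : ℝ => x * Real.log d) (𝓝[>] 0) (𝓝 0) := by
    have : Continuous fun x : ℝ => x * Real.log d := by fun_prop
    simpa using (this.tendsto 0).mono_left nhdsWithin_le_nhds
  simpa using h1.add tendsto_binEntropyUp

theorem tendsto_upperEnvelope :
    Filter.Tendsto (upperEnvelope fun t => t * Real.log d + Real.binEntropy t) (𝓝[>] 0) (𝓝 0) := by
  refine tendsto_of_tendsto_of_tendsto_of_le_of_le' tendsto_const_nhds
    (tendsto_mul_log_add_binEntropyUp d) ?_ ?_
  · filter_upwards [self_mem_nhdsWithin] with x hx using upperEnvelope_nonneg d (le_of_lt hx)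
  · filter_upwards [self_mem_nhdsWithin] with x hx using upperEnvelope_le d (le_of_lt hx)

/-- If `b = ∞` the `EReal` difference is `⊥`, so a state σ of infinite conditional entropy needs no
separate treatment. -/
theorem coe_sub_le_of_le_add {a b c : ℝ≥0∞} (h : a ≤ b + c) :
    (a : EReal) - (b : EReal) ≤ (c : EReal) := by
  refine EReal.sub_le_of_le_add' ?_
  rw [← EReal.coe_ennreal_add]
  exact EReal.coe_ennreal_le_coe_ennreal_iff.2 h

end Envelope

/-! ### The rank-constrained bound -/

namespace QCState

variable {A : Type u} [NormedAddCommGroup A] [InnerProductSpace ℂ A] [CompleteSpace A]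
  {B : Type*} [NormedAddCommGroup B] [InnerProductSpace ℂ B] [CompleteSpace B] {κ : Type*}
  {e : HilbertBasis κ ℂ B} (ρ : QCState A e)

theorem exists_eigenbasis_cond : ∃ (ι : κ → Type u) (b : ∀ k, HilbertBasis (ι k) ℂ A)
    (r : ∀ k, ι k → ℝ), (∀ k i, 0 ≤ r k i) ∧
      ∀ k i, (ρ.cond k).op (b k i) = (r k i : ℂ) • b k i := by
  choose ι b r hr hb using fun k => exists_eigenbasis (ρ.cond k).isPositive
    (by rw [(ρ.cond k).trace_eq_one]; exact ENNReal.one_ne_top)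
  exact ⟨ι, b, r, hr, hb⟩

variable {ι : κ → Type*} {b : ∀ k, HilbertBasis (ι k) ℂ A} {r : ∀ k, ι k → ℝ}

theorem smul_cond_apply (hb : ∀ k i, (ρ.cond k).op (b k i) = (r k i : ℂ) • b k i) (k : κ)
    (i : ι k) : (ρ.prob k • (ρ.cond k).op) (b k i) = ((ρ.prob k * r k i : ℝ) : ℂ) • b k i := by
  rw [smul_apply, hb, ← Complex.coe_smul, smul_smul]; simp

theorem hasSum_prob_mul (hr : ∀ k i, 0 ≤ r k i)
    (hb : ∀ k i, (ρ.cond k).op (b k i) = (r k i : ℂ) • b k i) (k : κ) :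
    HasSum (fun i => ρ.prob k * r k i) (ρ.prob k) := by
  simpa using ((ρ.cond k).hasSum_eigenvalues (b k) (hr k) (hb k)).mul_left (ρ.prob k)

theorem condEntropy_eq (hr : ∀ k i, 0 ≤ r k i)
    (hb : ∀ k i, (ρ.cond k).op (b k i) = (r k i : ℂ) • b k i) :
    ρ.condEntropy = ∑' k, homEnt (fun i => ρ.prob k * r k i) (ρ.prob k) :=
  tsum_congr fun k => (ρ.cond k).ofReal_mul_entropy (b k) (hr k) (hb k) (ρ.prob_nonneg k)

/-- A finite-dimensional range is the orthogonal complement of the kernel. On the kernel the form of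
ρ_A vanishes, hence so do all the nonnegative terms it is a sum of, and eigenvectors of positive
weight are orthogonal to it. -/
theorem mem_range_marginal (hr : ∀ k i, 0 ≤ r k i)
    (hb : ∀ k i, (ρ.cond k).op (b k i) = (r k i : ℂ) • b k i)
    [FiniteDimensional ℂ (ρ.marginal : A →ₗ[ℂ] A).range] {k : κ} {i : ι k}
    (hi : ρ.prob k * r k i ≠ 0) : b k i ∈ (ρ.marginal : A →ₗ[ℂ] A).range := by
  rw [← Submodule.orthogonal_orthogonal (ρ.marginal : A →ₗ[ℂ] A).range,
    LinearMap.IsSymmetric.orthogonal_range ρ.isPositive_marginal.isSymmetric,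
    Submodule.mem_orthogonal']
  intro x hx
  have hx0 : ρ.marginal x = 0 := hx
  have h1 : quad ρ.marginal x = 0 := by simp [quad, hx0]
  have h2 := ρ.hasSum_quad_marginal x
  rw [h1] at h2
  have h3 := congrFun ((hasSum_zero_iff_of_nonneg
    fun k => quad_nonneg (ρ.isPositive_smul_cond k) x).1 h2) k
  have h4 := hasSum_quad_eigenbasis (ρ.isPositive_smul_cond k) (b k) (ρ.smul_cond_apply hb k) x
  rw [h3] at h4
  have h5 := congrFun ((hasSum_zero_iff_of_nonneg fun i => mul_nonneg
    (mul_nonneg (ρ.prob_nonneg k) (hr k i)) (sq_nonneg _)).1 h4) i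
  have h6 := (mul_eq_zero.1 h5).resolve_left hi
  exact norm_eq_zero.1 (pow_eq_zero_iff two_ne_zero |>.1 h6)

theorem exists_finset_card_le (hr : ∀ k i, 0 ≤ r k i)
    (hb : ∀ k i, (ρ.cond k).op (b k i) = (r k i : ℂ) • b k i)
    [FiniteDimensional ℂ (ρ.marginal : A →ₗ[ℂ] A).range] (k : κ) :
    ∃ s : Finset (ι k), (∀ i, i ∉ s → ρ.prob k * r k i = 0) ∧
      s.card ≤ Module.finrank ℂ (ρ.marginal : A →ₗ[ℂ] A).range := by
  classical
  let f : {i // ρ.prob k * r k i ≠ 0} → (ρ.marginal : A →ₗ[ℂ] A).range :=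
    fun i => ⟨b k i, ρ.mem_range_marginal hr hb i.2⟩
  have hf : LinearIndependent ℂ f := by
    refine LinearIndependent.of_comp (ρ.marginal : A →ₗ[ℂ] A).range.subtype ?_
    exact (b k).orthonormal.linearIndependent.comp _ Subtype.val_injective
  have hfin : Finite {i // ρ.prob k * r k i ≠ 0} := hf.finite
  have := Fintype.ofFinite {i // ρ.prob k * r k i ≠ 0}
  refine ⟨Finset.univ.map (Function.Embedding.subtype fun i => ρ.prob k * r k i ≠ 0),
    fun i hi => ?_, ?_⟩
  · by_contra h
    exact hi (Finset.mem_map.2 ⟨⟨i, h⟩, Finset.mem_univ _, rfl⟩)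
  · rw [Finset.card_map, Finset.card_univ]
    exact hf.fintype_card_le_finrank

theorem tsum_homEnt_le_of_finrank (hr : ∀ k i, 0 ≤ r k i)
    (hb : ∀ k i, (ρ.cond k).op (b k i) = (r k i : ℂ) • b k i)
    [FiniteDimensional ℂ (ρ.marginal : A →ₗ[ℂ] A).range]
    {t : ∀ k, ι k → ℝ} {T : κ → ℝ} {s : ℝ} (ht : ∀ k i, 0 ≤ t k i)
    (htr : ∀ k i, t k i ≤ ρ.prob k * r k i) (hT : ∀ k, HasSum (t k) (T k)) (hs : HasSum T s) :
    ∑' k, homEnt (t k) (T k) ≤ ENNReal.ofReal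
      (s * Real.log (Module.finrank ℂ (ρ.marginal : A →ₗ[ℂ] A).range)) := by
  rw [← tsum_ofReal_of_hasSum (fun k => mul_nonneg ((hT k).nonneg (ht k))
    (Real.log_natCast_nonneg _)) (hs.mul_right _)]
  refine ENNReal.tsum_le_tsum fun k => ?_
  obtain ⟨S, hS, hcard⟩ := ρ.exists_finset_card_le hr hb k
  exact homEnt_le_of_card_le (ht k) (hT k)
    (fun i hi => le_antisymm ((htr k i).trans (hS i hi).le) (ht k i)) hcard

/-- The remainder bound applied with the whole state as the remainder. -/
theorem condEntropy_lt_top_of_finrank [FiniteDimensional ℂ (ρ.marginal : A →ₗ[ℂ] A).range] :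
    ρ.condEntropy < ∞ := by
  obtain ⟨ι, b, r, hr, hb⟩ := ρ.exists_eigenbasis_cond
  rw [ρ.condEntropy_eq hr hb]
  exact (ρ.tsum_homEnt_le_of_finrank hr hb (fun k i => mul_nonneg (ρ.prob_nonneg k) (hr k i))
    (fun _ _ => le_rfl) (ρ.hasSum_prob_mul hr hb) ρ.hasSum_prob).trans_lt ENNReal.ofReal_lt_top

theorem condEntropy_sub_le_upperEnvelope [FiniteDimensional ℂ (ρ.marginal : A →ₗ[ℂ] A).range]
    (σ : QCState A e) {ε : ℝ} (hε : ε ∈ Set.Icc (0 : ℝ) 1)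
    (h : traceDist ρ.toState σ.toState ≤ ENNReal.ofReal ε) :
    (ρ.condEntropy : EReal) - (σ.condEntropy : EReal) ≤
      ((upperEnvelope (fun t => t * Real.log (Module.finrank ℂ (ρ.marginal : A →ₗ[ℂ] A).range) +
        Real.binEntropy t) ε : ℝ) : EReal) := by
  set d := Module.finrank ℂ (ρ.marginal : A →ₗ[ℂ] A).range with hd
  obtain ⟨ι, b, r, hr, hb⟩ := ρ.exists_eigenbasis_cond
  obtain ⟨t, T, s, ht, htr, hT, hs, hs0, hsε, hle⟩ :=
    ρ.condEntropy_le_add σ hε.1 hε.2 h b hr hb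
  have h1 : ρ.condEntropy ≤ σ.condEntropy + ENNReal.ofReal
      (upperEnvelope (fun t => t * Real.log d + Real.binEntropy t) ε) := by
    refine hle.trans ?_
    rw [add_assoc]
    gcongr
    refine (add_le_add_left (ρ.tsum_homEnt_le_of_finrank hr hb ht htr hT hs) _).trans ?_
    rw [← ENNReal.ofReal_add (mul_nonneg hs0 (Real.log_natCast_nonneg _))
      (Real.binEntropy_nonneg hs0 (hsε.trans hε.2))]
    exact ENNReal.ofReal_le_ofReal (le_upperEnvelope d ⟨hs0, hsε⟩)
  have h2 := coe_sub_le_of_le_add h1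
  rwa [EReal.coe_ennreal_ofReal, max_eq_left (upperEnvelope_nonneg d hε.1)] at h2

end QCState

/-! ### Diagonals, positive parts and trace norms in eigenbases -/

section DiagonalSum

variable {V : Type*} [NormedAddCommGroup V] [InnerProductSpace ℂ V] [CompleteSpace V]
  {J κ : Type*} {ι : κ → Type*} {φ : HilbertBasis J ℂ V} {b : ∀ k, HilbertBasis (ι k) ℂ V}

theorem diagonalSum_add_le {t u w : ∀ k, ι k → ℝ} (ht : ∀ k i, 0 ≤ t k i) (hu : ∀ k i, 0 ≤ u k i)
    (h : ∀ k i, t k i + u k i ≤ w k i) (j : J) :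
    diagonalSum φ b t j + diagonalSum φ b u j ≤ diagonalSum φ b w j := by
  simp only [diagonalSum]
  rw [← ENNReal.tsum_add]
  refine ENNReal.tsum_le_tsum fun k => ?_
  rw [← ENNReal.tsum_add]
  refine ENNReal.tsum_le_tsum fun i => ?_
  rw [← add_mul, ← ENNReal.ofReal_add (ht k i) (hu k i)]
  exact mul_le_mul_left (ENNReal.ofReal_le_ofReal (h k i)) _

theorem posPart_apply_eigenvector {T : V →L[ℂ] V} (hT : IsSelfAdjoint T) {v : V} {r : ℝ}
    (h : T v = (r : ℂ) • v) : T⁺ v = ((r⁺ : ℝ) : ℂ) • v := by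
  rw [CFC.posPart_def, cfcₙ_eq_cfc]
  exact cfc_apply_eigenvector hT h _ (by fun_prop)

theorem traceNorm_eigenbasis {T : V →L[ℂ] V} (hT : IsSelfAdjoint T) (φ : HilbertBasis J ℂ V)
    {r : J → ℝ} (h : ∀ j, T (φ j) = (r j : ℂ) • φ j) :
    traceNorm T = ∑' j, ENNReal.ofReal |r j| := by
  rw [traceNorm, CFC.abs_eq_cfc_norm T hT]
  exact opTrace_eigenbasis (isPositive_cfc fun x _ => norm_nonneg x) φ
    fun j => cfc_apply_eigenvector hT (h j) _ (by fun_prop)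

end DiagonalSum

/-! ### The energy-constrained bound -/

namespace QCState

variable {A : Type u} [NormedAddCommGroup A] [InnerProductSpace ℂ A] [CompleteSpace A]
  {B : Type*} [NormedAddCommGroup B] [InnerProductSpace ℂ B] [CompleteSpace B] {κ : Type*}
  {e : HilbertBasis κ ℂ B} (ρ : QCState A e)
  {H : PositiveOperator A} {J : Type*} {φ : HilbertBasis J ℂ A} {E : J → ℝ≥0∞}
  {ι : κ → Type*} {b : ∀ k, HilbertBasis (ι k) ℂ A} {r : ∀ k, ι k → ℝ}

theorem meanEnergy_marginal_eq
    (hH : ∀ ω : A →L[ℂ] A, ω.IsPositive →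
      H.meanEnergy ω = ∑' j, E j * ENNReal.ofReal (quad ω (φ j)))
    (hr : ∀ k i, 0 ≤ r k i) (hb : ∀ k i, (ρ.cond k).op (b k i) = (r k i : ℂ) • b k i) :
    H.meanEnergy ρ.marginal =
      ∑' j, E j * diagonalSum φ b (fun k i => ρ.prob k * r k i) j := by
  rw [hH _ ρ.isPositive_marginal]
  refine tsum_congr fun j => ?_
  rw [ρ.ofReal_quad_marginal, diagonalSum]
  congr 1
  exact tsum_congr fun k => ofReal_quad_eigenbasis (ρ.isPositive_smul_cond k) (b k)
    (fun i => mul_nonneg (ρ.prob_nonneg k) (hr k i)) (ρ.smul_cond_apply hb k) _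

theorem energyAbove_eq
    (hH : ∀ ω : A →L[ℂ] A, ω.IsPositive →
      H.meanEnergy ω = ∑' j, E j * ENNReal.ofReal (quad ω (φ j)))
    (hb : ∀ k i, (ρ.cond k).op (b k i) = (r k i : ℂ) • b k i) (ε : ℝ) :
    ρ.energyAbove H ε =
      ∑' j, E j * diagonalSum φ b (fun k i => (ρ.prob k * r k i - ε)⁺) j := by
  have hsa : ∀ k, IsSelfAdjoint (ρ.prob k • (ρ.cond k).op - ε • (1 : A →L[ℂ] A)) := fun k =>
    (ρ.isPositive_smul_cond k).isSelfAdjoint.sub ((IsSelfAdjoint.all ε).smul (.one _))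
  have hpos : ∀ k, ((ρ.prob k • (ρ.cond k).op - ε • (1 : A →L[ℂ] A))⁺).IsPositive := fun k =>
    (ContinuousLinearMap.nonneg_iff_isPositive _).1 (CFC.posPart_nonneg _)
  have happ : ∀ k i, (ρ.prob k • (ρ.cond k).op - ε • (1 : A →L[ℂ] A))⁺ (b k i) =
      (((ρ.prob k * r k i - ε)⁺ : ℝ) : ℂ) • b k i := fun k i =>
    posPart_apply_eigenvector (hsa k) (by
      rw [sub_apply, ρ.smul_cond_apply hb k i, smul_apply, one_apply_eq_self,
        Complex.ofReal_sub, sub_smul, Complex.coe_smul ε])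
  simp only [energyAbove, diagonalSum]
  simp_rw [hH _ (hpos _), ← ENNReal.tsum_mul_left]
  rw [ENNReal.tsum_comm]
  refine tsum_congr fun j => tsum_congr fun k => ?_
  rw [ofReal_quad_eigenbasis (hpos k) (b k) (fun i => posPart_nonneg _) (happ k),
    ENNReal.tsum_mul_left]

/-- Eigenvalue by eigenvalue, `t ≤ min (p r, ε) = p r - (p r - ε)⁺`; the energy is additive on
diagonals. This is where the correction E_{H,ε}(ρ) comes from. -/
theorem tsum_mul_diagonalSum_add_energyAbove_le
    (hH : ∀ ω : A →L[ℂ] A, ω.IsPositive →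
      H.meanEnergy ω = ∑' j, E j * ENNReal.ofReal (quad ω (φ j)))
    (hr : ∀ k i, 0 ≤ r k i) (hb : ∀ k i, (ρ.cond k).op (b k i) = (r k i : ℂ) • b k i)
    {t : ∀ k, ι k → ℝ} {ε : ℝ} (ht : ∀ k i, 0 ≤ t k i)
    (htr : ∀ k i, t k i ≤ ρ.prob k * r k i) (htε : ∀ k i, t k i ≤ ε) :
    (∑' j, E j * diagonalSum φ b t j) + ρ.energyAbove H ε ≤ H.meanEnergy ρ.marginal := by
  rw [ρ.energyAbove_eq hH hb, ρ.meanEnergy_marginal_eq hH hr hb, ← ENNReal.tsum_add]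
  refine ENNReal.tsum_le_tsum fun j => ?_
  rw [← mul_add]
  refine mul_le_mul_right (diagonalSum_add_le ht (fun k i => posPart_nonneg _) (fun k i => ?_) j) _
  rw [posPart_def, ← max_add_add_left]
  refine max_le ?_ ?_
  · linarith [htε k i]
  · simpa using htr k i

theorem energyAbove_le
    (hH : ∀ ω : A →L[ℂ] A, ω.IsPositive →
      H.meanEnergy ω = ∑' j, E j * ENNReal.ofReal (quad ω (φ j))) {ε : ℝ} (hε : 0 ≤ ε) :
    ρ.energyAbove H ε ≤ H.meanEnergy ρ.marginal := by
  obtain ⟨ι, b, r, hr, hb⟩ := ρ.exists_eigenbasis_cond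
  exact le_add_self.trans (ρ.tsum_mul_diagonalSum_add_energyAbove_le hH hr hb (t := fun _ _ => 0)
    (fun _ _ => le_rfl) (fun k i => mul_nonneg (ρ.prob_nonneg k) (hr k i)) fun _ _ => hε)

theorem condEntropy_lt_top_of_meanEnergy
    (hH : ∀ ω : A →L[ℂ] A, ω.IsPositive →
      H.meanEnergy ω = ∑' j, E j * ENNReal.ofReal (quad ω (φ j)))
    (hZ : ∀ β : ℝ, 0 < β → ∑' j, boltzmann β (E j) ≠ ∞) {j₀ : J} (hj₀ : E j₀ = 0)
    (hE : H.meanEnergy ρ.marginal < ∞) : ρ.condEntropy < ∞ := by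
  obtain ⟨ι, b, r, hr, hb⟩ := ρ.exists_eigenbasis_cond
  rw [ρ.condEntropy_eq hr hb]
  refine (PositiveOperator.tsum_homEnt_le_mul_maxEntropy hH hj₀ b
    (fun k i => mul_nonneg (ρ.prob_nonneg k) (hr k i)) (ρ.hasSum_prob_mul hr hb) ρ.hasSum_prob
    one_pos le_rfl).trans_lt ?_
  rw [← ρ.meanEnergy_marginal_eq hH hr hb, ENNReal.ofReal_one, one_mul, div_one]
  refine (PositiveOperator.maxEntropy_le hH one_pos _).trans_lt ?_
  exact ENNReal.add_lt_top.2 ⟨ENNReal.mul_lt_top ENNReal.ofReal_lt_top hE, (hZ 1 one_pos).lt_top⟩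

theorem condEntropy_sub_le_maxEntropy
    (hH : ∀ ω : A →L[ℂ] A, ω.IsPositive →
      H.meanEnergy ω = ∑' j, E j * ENNReal.ofReal (quad ω (φ j)))
    {j₀ : J} (hj₀ : E j₀ = 0) (hE : H.meanEnergy ρ.marginal < ∞) (σ : QCState A e) {ε : ℝ}
    (hε : ε ∈ Set.Ioc (0 : ℝ) 1) (h : traceDist ρ.toState σ.toState ≤ ENNReal.ofReal ε) :
    (ρ.condEntropy : EReal) - (σ.condEntropy : EReal) ≤
      ((ENNReal.ofReal ε * H.maxEntropy
          ((H.meanEnergy ρ.marginal - ρ.energyAbove H ε) / ENNReal.ofReal ε) +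
        ENNReal.ofReal (binEntropyUp ε) : ℝ≥0∞) : EReal) := by
  obtain ⟨ι, b, r, hr, hb⟩ := ρ.exists_eigenbasis_cond
  obtain ⟨t, T, s, ht, htr, hT, hs, hs0, hsε, hle⟩ :=
    ρ.condEntropy_le_add σ hε.1.le hε.2 h b hr hb
  refine coe_sub_le_of_le_add (hle.trans ?_)
  rw [add_assoc]
  -- A single removed eigenvalue is at most the total removed mass `s ≤ ε`.
  have htε : ∀ k i, t k i ≤ ε := fun k i =>
    ((le_hasSum (hT k) i fun j _ => ht k j).trans
      (le_hasSum hs k fun l _ => (hT l).nonneg (ht l))).trans hsε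
  gcongr
  · refine (PositiveOperator.tsum_homEnt_le_mul_maxEntropy hH hj₀ b ht hT hs hε.1 hsε).trans ?_
    refine mul_le_mul_right (PositiveOperator.maxEntropy_mono (ENNReal.div_le_div_right ?_ _)) _
    -- Subtraction in `[0, ∞]` is truncated, so the subtracted energy has to be finite.
    refine ENNReal.le_sub_of_add_le_right ?_
      (ρ.tsum_mul_diagonalSum_add_energyAbove_le hH hr hb ht htr htε)
    exact ne_top_of_le_ne_top hE.ne (ρ.energyAbove_le hH hε.1.le)
  · exact binEntropy_le_binEntropyUp hs0 hsε

end QCState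

/-! ### States showing near-optimality -/

section Optimality

variable {A : Type u} [NormedAddCommGroup A] [InnerProductSpace ℂ A] [CompleteSpace A]
  {B : Type*} [NormedAddCommGroup B] [InnerProductSpace ℂ B] [CompleteSpace B] {κ : Type*}

set_option synthInstance.maxHeartbeats 200000 in
/-- The product of a state with a basis state of the classical system. -/
theorem exists_qcState (e : HilbertBasis κ ℂ B) (k₀ : κ) (ω : State A) :
    ∃ ρ : QCState A e, ρ.marginal = ω.op ∧ ρ.condEntropy = ω.entropy ∧
      ρ.op = opTensor ω.op (InnerProductSpace.rankOne ℂ (e k₀) (e k₀)) := by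
  classical
  let ρ : QCState A e :=
    { op := opTensor ω.op (InnerProductSpace.rankOne ℂ (e k₀) (e k₀))
      isPositive := isPositive_opTensor_rankOne ω.isPositive _
      trace_eq_one := by rw [opTrace_opTensor_rankOne e ω.isPositive, ω.trace_eq_one]
      prob := fun k => if k = k₀ then 1 else 0
      cond := fun _ => ω
      prob_nonneg := fun k => by split_ifs <;> norm_num
      hasSum_prob := hasSum_ite_eq k₀ 1
      hasSum_op := by
        have h := hasSum_single (f := fun k => (if k = k₀ then (1 : ℝ) else 0) •
          opTensor ω.op (InnerProductSpace.rankOne ℂ (e k) (e k))) k₀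
          fun k hk => by rw [if_neg hk, zero_smul]
        simpa using h }
  refine ⟨ρ, ?_, ?_, rfl⟩
  · refine ρ.hasSum_marginal.unique ?_
    have h : HasSum (fun k => (if k = k₀ then (1 : ℝ) else 0) • ω.op) ω.op := by
      simpa using hasSum_ite_eq k₀ ω.op
    exact h
  · change ∑' k, ENNReal.ofReal (if k = k₀ then 1 else 0) * ω.entropy = ω.entropy
    rw [tsum_eq_single k₀ fun k hk => by simp [hk]]
    simp

theorem traceNorm_opTensor_sub (e : HilbertBasis κ ℂ B) (k₀ : κ) {J : Type*}
    (φ : HilbertBasis J ℂ A) {ω τ : State A} {q s : J → ℝ}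
    (hω : ∀ j, ω.op (φ j) = (q j : ℂ) • φ j) (hτ : ∀ j, τ.op (φ j) = (s j : ℂ) • φ j) :
    traceNorm (opTensor ω.op (InnerProductSpace.rankOne ℂ (e k₀) (e k₀)) -
      opTensor τ.op (InnerProductSpace.rankOne ℂ (e k₀) (e k₀))) =
      ∑' j, ENNReal.ofReal |q j - s j| := by
  classical
  rw [traceNorm_eigenbasis (r := fun p : κ × J => if p.1 = k₀ then q p.2 - s p.2 else 0)
    ((isPositive_opTensor_rankOne ω.isPositive _).isSelfAdjoint.sub
      (isPositive_opTensor_rankOne τ.isPositive _).isSelfAdjoint) (tensorBasis φ e)]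
  · rw [ENNReal.tsum_prod', tsum_eq_single k₀ fun k hk => by simp [hk]]
    simp
  · rintro ⟨k, j⟩
    rw [tensorBasis_apply, sub_apply, opTensor_rankOne, opTensor_rankOne]
    simp only [ContinuousLinearMap.comp_apply]
    rw [adjoint_tensorRight_apply, orthonormal_iff_ite.1 e.orthonormal]
    by_cases hk : k = k₀
    · subst hk
      simp only [if_true, one_smul, hω, hτ, map_smul, Complex.ofReal_sub, sub_smul]
    · simp [hk, Ne.symm hk]

/-- The classical system stays in one basis state, so the problem reduces to `A`: the mixture of a
maximizer with the ground level against the pure ground state, whose entropy and energy are zero. -/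
theorem exists_maxEntropy_le_condEntropy_sub (e : HilbertBasis κ ℂ B) (k₀ : κ)
    {H : PositiveOperator A} {J : Type*} {φ : HilbertBasis J ℂ A} {E : J → ℝ≥0∞}
    (hH : ∀ ω : A →L[ℂ] A, ω.IsPositive →
      H.meanEnergy ω = ∑' j, E j * ENNReal.ofReal (quad ω (φ j)))
    (hZ : ∀ β : ℝ, 0 < β → ∑' j, boltzmann β (E j) ≠ ∞)
    {j₀ j₁ : J} (hj₀ : E j₀ = 0) (hj : j₁ ≠ j₀) (hj₁ : E j₁ ≠ ∞) {x : ℝ} (hx : 0 < x) {ε : ℝ}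
    (hε : ε ∈ Set.Ioc (0 : ℝ) 1) : ∃ ρ σ : QCState A e,
      H.meanEnergy ρ.marginal ≤ ENNReal.ofReal x ∧ H.meanEnergy σ.marginal ≤ ENNReal.ofReal x ∧
      traceDist ρ.toState σ.toState ≤ ENNReal.ofReal ε ∧
      ((ENNReal.ofReal ε * H.maxEntropy (ENNReal.ofReal x / ENNReal.ofReal ε) : ℝ≥0∞) : EReal) ≤
        (ρ.condEntropy : EReal) - (σ.condEntropy : EReal) ∧
      (ε < 1 →
        ((ENNReal.ofReal ε * H.maxEntropy (ENNReal.ofReal x / ENNReal.ofReal ε) : ℝ≥0∞) :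
          EReal) < (ρ.condEntropy : EReal) - (σ.condEntropy : EReal)) := by
  classical
  have hε0 : ENNReal.ofReal ε ≠ 0 := by simpa using hε.1
  have hx0 : ENNReal.ofReal x ≠ 0 := by simpa using hx
  obtain ⟨q, hq0, hqs, hqE, hqd, hqS, hqS'⟩ := exists_mixture_entropy_gt hH hZ hj₀ hj hj₁
    (e := ENNReal.ofReal x / ENNReal.ofReal ε)
    (ENNReal.div_ne_zero.2 ⟨hx0, ENNReal.ofReal_ne_top⟩)
    (ENNReal.div_ne_top ENNReal.ofReal_ne_top hε0) hε.1 hε.2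
  rw [ENNReal.mul_div_cancel hε0 ENNReal.ofReal_ne_top] at hqE
  obtain ⟨ω, hω, hωE, hωS⟩ := PositiveOperator.exists_diagonal_state hH hq0 hqs
  obtain ⟨τ, hτ, hτE, hτS⟩ := PositiveOperator.exists_diagonal_state hH
    (q := fun j => if j = j₀ then 1 else 0) (fun j => by split_ifs <;> norm_num)
    (hasSum_ite_eq j₀ 1)
  have hτE0 : H.meanEnergy τ.op = 0 := by
    rw [hτE]
    refine ENNReal.tsum_eq_zero.2 fun j => ?_
    by_cases h : j = j₀ <;> simp [h, hj₀]
  have hτS0 : τ.entropy = 0 := by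
    rw [hτS]
    refine ENNReal.tsum_eq_zero.2 fun j => ?_
    by_cases h : j = j₀ <;> simp [h]
  obtain ⟨ρ, hρA, hρS, hρ⟩ := exists_qcState e k₀ ω
  obtain ⟨σ, hσA, hσS, hσ⟩ := exists_qcState e k₀ τ
  refine ⟨ρ, σ, ?_, ?_, ?_, ?_, ?_⟩
  · rw [hρA, hωE]; exact hqE
  · rw [hσA, hτE0]; exact bot_le
  · rw [traceDist, hρ, hσ, traceNorm_opTensor_sub e k₀ φ hω hτ]
    refine ENNReal.div_le_of_le_mul ?_
    rw [mul_comm]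
    exact hqd
  · rw [hσS, hτS0, hρS, hωS, EReal.coe_ennreal_zero, sub_zero]
    exact EReal.coe_ennreal_le_coe_ennreal_iff.2 hqS
  · intro hε'
    rw [hσS, hτS0, hρS, hωS, EReal.coe_ennreal_zero, sub_zero]
    exact EReal.coe_ennreal_lt_coe_ennreal_iff.2 (hqS' hε')

end Optimality

end QCEntropy

end

/-! ### Assembly of the theorem -/

open QCEntropy in
theorem proposition7
    {A B κ : Type*}
    [NormedAddCommGroup A] [InnerProductSpace ℂ A] [CompleteSpace A]
    [TopologicalSpace.SeparableSpace A]
    [NormedAddCommGroup B] [InnerProductSpace ℂ B] [CompleteSpace B]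
    [TopologicalSpace.SeparableSpace B] [Nontrivial B]
    (e : HilbertBasis κ ℂ B) :
    -- Part A: semicontinuity bound with the rank constraint, and its faithfulness
    (∀ ρ : QCState A e, FiniteDimensional ℂ (ρ.marginal : A →ₗ[ℂ] A).range →
      ∀ d : ℕ, d = Module.finrank ℂ (ρ.marginal : A →ₗ[ℂ] A).range →
        ρ.condEntropy < ∞ ∧
        (∀ ε ∈ Set.Icc (0 : ℝ) 1, ∀ σ : QCState A e,
          traceDist ρ.toState σ.toState ≤ ENNReal.ofReal ε →
            (ρ.condEntropy : EReal) - (σ.condEntropy : EReal) ≤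
              ((upperEnvelope (fun t => t * Real.log d + Real.binEntropy t) ε : ℝ) : EReal)) ∧
        (∀ ε ∈ Set.Icc (0 : ℝ) 1,
          upperEnvelope (fun t => t * Real.log d + Real.binEntropy t) ε ≤
            ε * Real.log d + binEntropyUp ε) ∧
        Filter.Tendsto (fun ε : ℝ =>
          upperEnvelope (fun t => t * Real.log d + Real.binEntropy t) ε) (𝓝[>] 0) (𝓝 0) ∧
        Filter.Tendsto (fun ε : ℝ => ε * Real.log d + binEntropyUp ε) (𝓝[>] 0) (𝓝 0)) ∧
    -- Part B: semicontinuity bounds with the energy constraint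
    (∀ H : PositiveOperator A, H.Gibbs → H.GroundEnergyZero →
      (∀ ρ : QCState A e, ∀ E : ℝ≥0∞, E = H.meanEnergy ρ.marginal → E < ∞ →
        ρ.condEntropy < ∞ ∧
        (∀ ε ∈ Set.Ioc (0 : ℝ) 1, ρ.energyAbove H ε ≤ E) ∧
        (∀ ε ∈ Set.Ioc (0 : ℝ) 1, ∀ σ : QCState A e,
          traceDist ρ.toState σ.toState ≤ ENNReal.ofReal ε →
            (ρ.condEntropy : EReal) - (σ.condEntropy : EReal) ≤
              ((ENNReal.ofReal ε * H.maxEntropy ((E - ρ.energyAbove H ε) / ENNReal.ofReal ε) +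
                ENNReal.ofReal (binEntropyUp ε) : ℝ≥0∞) : EReal)) ∧
        (∀ ε ∈ Set.Ioc (0 : ℝ) 1,
          ENNReal.ofReal ε * H.maxEntropy ((E - ρ.energyAbove H ε) / ENNReal.ofReal ε) +
              ENNReal.ofReal (binEntropyUp ε) ≤
            ENNReal.ofReal ε * H.maxEntropy (E / ENNReal.ofReal ε) +
              ENNReal.ofReal (binEntropyUp ε)) ∧
        -- faithfulness of both bounds
        Filter.Tendsto (fun ε : ℝ =>
          ENNReal.ofReal ε * H.maxEntropy ((E - ρ.energyAbove H ε) / ENNReal.ofReal ε) +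
            ENNReal.ofReal (binEntropyUp ε)) (𝓝[>] 0) (𝓝 0) ∧
        Filter.Tendsto (fun ε : ℝ =>
          ENNReal.ofReal ε * H.maxEntropy (E / ENNReal.ofReal ε) +
            ENNReal.ofReal (binEntropyUp ε)) (𝓝[>] 0) (𝓝 0)) ∧
      -- closeness to optimality
      (1 < Module.rank ℂ H.op.domain →
        ∀ E : ℝ, 0 < E → ∀ ε ∈ Set.Ioc (0 : ℝ) 1, ∃ ρ σ : QCState A e,
          H.meanEnergy ρ.marginal ≤ ENNReal.ofReal E ∧
          H.meanEnergy σ.marginal ≤ ENNReal.ofReal E ∧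
          traceDist ρ.toState σ.toState ≤ ENNReal.ofReal ε ∧
          ((ENNReal.ofReal ε * H.maxEntropy (ENNReal.ofReal E / ENNReal.ofReal ε) : ℝ≥0∞) : EReal) ≤
            (ρ.condEntropy : EReal) - (σ.condEntropy : EReal) ∧
          (ε < 1 →
            ((ENNReal.ofReal ε * H.maxEntropy (ENNReal.ofReal E / ENNReal.ofReal ε) : ℝ≥0∞) :
              EReal) < (ρ.condEntropy : EReal) - (σ.condEntropy : EReal)))) := by
  -- A nonzero `B` has a basis vector, needed to build the states in the optimality statement.
  obtain ⟨k₀⟩ : Nonempty κ := by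
    by_contra h
    rw [not_nonempty_iff] at h
    obtain ⟨x, hx⟩ := exists_ne (0 : B)
    exact hx (eq_zero_of_inner_basis e fun k => isEmptyElim k)
  refine ⟨fun ρ _ d hd => ?_, fun H hG h0 => ?_⟩
  · subst hd
    exact ⟨ρ.condEntropy_lt_top_of_finrank,
      fun ε hε σ h => ρ.condEntropy_sub_le_upperEnvelope σ hε h,
      fun ε hε => upperEnvelope_le _ hε.1, tendsto_upperEnvelope _,
      tendsto_mul_log_add_binEntropyUp _⟩
  obtain ⟨J, φ, E, hH, hZ, hground, hrank⟩ := H.exists_energyBasis hG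
  obtain ⟨j₀, hj₀⟩ := hground h0
  refine ⟨fun ρ x hx hfin => ?_, fun hdim x hx ε hε => ?_⟩
  · subst hx
    have hmono : ∀ ε : ℝ,
        ENNReal.ofReal ε * H.maxEntropy
            ((H.meanEnergy ρ.marginal - ρ.energyAbove H ε) / ENNReal.ofReal ε) +
          ENNReal.ofReal (binEntropyUp ε) ≤
        ENNReal.ofReal ε * H.maxEntropy (H.meanEnergy ρ.marginal / ENNReal.ofReal ε) +
          ENNReal.ofReal (binEntropyUp ε) := fun ε => by
      gcongr
      exact PositiveOperator.maxEntropy_mono (ENNReal.div_le_div_right tsub_le_self _)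
    have hlim : Filter.Tendsto (fun ε : ℝ =>
        ENNReal.ofReal ε * H.maxEntropy (H.meanEnergy ρ.marginal / ENNReal.ofReal ε) +
          ENNReal.ofReal (binEntropyUp ε)) (𝓝[>] 0) (𝓝 0) := by
      simpa using (PositiveOperator.tendsto_mul_maxEntropy hH hZ hfin.ne).add
        (ENNReal.tendsto_ofReal tendsto_binEntropyUp)
    exact ⟨ρ.condEntropy_lt_top_of_meanEnergy hH hZ hj₀ hfin,
      fun ε hε => ρ.energyAbove_le hH hε.1.le,
      fun ε hε σ h => ρ.condEntropy_sub_le_maxEntropy hH hj₀ hfin σ hε h,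
      fun ε _ => hmono ε,
      tendsto_of_tendsto_of_tendsto_of_le_of_le tendsto_const_nhds hlim (fun _ => bot_le) hmono,
      hlim⟩
  · obtain ⟨i, j, hij, hi, hj⟩ := hrank hdim
    obtain ⟨j₁, hj₁, hfin⟩ : ∃ j₁, j₁ ≠ j₀ ∧ E j₁ ≠ ∞ := by
      by_cases h : i = j₀
      · exact ⟨j, fun h' => hij (h.trans h'.symm), hj⟩
      · exact ⟨i, h, hi⟩
    exact exists_maxEntropy_le_condEntropy_sub e k₀ hH hZ hj₀ hj₁ hfin hx hε
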